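/- **Setting.** Let $(M,g)$ be a smooth $n$-dimensional semi-Riemannian manifold (i.e. $g$ is a smooth field of nondegenerate symmetric bilinear forms on the tangent spaces), with Levi-Civita covariant derivative $\nabla$ and curvature $R(X,Y)=[\nabla_X,\nabla_Y]-\nabla_{[X,Y]}$. Let $\gamma$ be a closed geodesic, regarded as a smooth geodesic $\gamma:\mathbb R\to M$ of period $1$, and let $T$ be a smooth $1$-periodic orthonormal frame along $\gamma$: smooth $1$-periodic vector fields $T_1,\dots,T_n$ along $\gamma$ with $g(T_i,T_j)=\epsilon_i\delta_{ij}$, $\epsilon_i\in\{1,-1\}$. Write $T_t:\mathbb R^n\to T_{\gamma(t)}M$ for the isomorphism $v\mapsto\sum_i v_iT_i(t)$, $G(v,w)=\sum_i\epsilon_iv_iw_i$, $\Gamma_t v=T_t^{-1}\tfrac{D}{dt}(T_tv)$ (for constant $v\in\mathbb R^n$) and $\overline R_t=T_t^{-1}\circ R(\dot\gamma(t),\cdot)\dot\gamma(t)\circ T_t$. The spectral flow $\mathfrak{sf}(\gamma)$, computed with the frame $T$, is the spectral flow (in the sense of Phillips) of the path $[0,1]\ni t\mapsto B_t$ of symmetric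 Fredholm forms $$B_t(V,W)=\int_0^1 G(V',W')+t\,G(\Gamma_{tr}V,W')+t\,G(V',\Gamma_{tr}W)+t^2G(\Gamma_{tr}V,\Gamma_{tr}W)+t^2G(\overline R_{tr}V,W)\,\mathrm dr$$ on the Hilbert space of all $V\in H^1([0,1],\mathbb R^n)$ with $V(0)=V(1)$, with inner product $V(0)\cdot W(0)+\int_0^1V'\cdot W'\,\mathrm dr$. That is, if $A_t$ is the self-adjoint Fredholm operator representing $B_t$, then $$\mathfrak{sf}(\gamma)=\sum_j\Big(\operatorname{rank}\chi_{[0,\varepsilon_j]}(A_{t_{j+1}})-\operatorname{rank}\chi_{[0,\varepsilon_j]}(A_{t_j})\Big)$$ for any partition $0=t_0\le\dots\le t_m=1$ and any $\varepsilon_j>0$ such that, for all $t\in[t_j,t_{j+1}]$, $\pm\varepsilon_j$ are not in the spectrum of $A_t$ and $[-\varepsilon_j,\varepsilon_j]$ does not meet its essential spectrum. For $N\ge1$ let $\gamma^{(N)}(t)=\gamma(Nt)$ be the $N$-th iterate; $\mathfrak{sf}(\gamma^{(N)})$ is computed with the frame $t\mapsto T_{Nt}$. **Statement.** For every $N\ge1$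 the spectral flow $\mathfrak{sf}(\gamma^{(N)})\in\mathbb Z$ is well defined. The limit $$L_\gamma=\lim_{N\to\infty}\tfrac1N\,\mathfrak{sf}(\gamma^{(N)})$$ exists in $\mathbb R$, and the sequence $N\mapsto\mathfrak{sf}(\gamma^{(N)})$, $N\ge1$, is bounded if and only if $L_\gamma=0$. Moreover, the sequence is either bounded, or it has uniform linear growth: $L_\gamma\ne0$ and there is a constant $\alpha\in\mathbb R$ such that for all integers $N\ge1$ and $P\ge0$ $$L_\gamma P-\alpha\le\mathfrak{sf}(\gamma^{(N+P)})-\mathfrak{sf}(\gamma^{(N)})\le L_\gamma P+\alpha .$$ -/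

import Mathlib

open Set Filter Topology MeasureTheory Manifold
open scoped ContDiff

noncomputable section

namespace SemiRiem

/-! ### Spectral flow of a path of self-adjoint Fredholm operators -/

section SpectralFlow

variable {𝕜 : Type*} [RCLike 𝕜] {H : Type*} [NormedAddCommGroup H] [InnerProductSpace 𝕜 H]

/-- A continuous path `[0,1] ∋ t ↦ T t` of bounded self-adjoint Fredholm operators. -/
structure IsFredholmPath (T : ℝ → H →L[𝕜] H) : Prop where
  continuousOn : ContinuousOn T (Icc 0 1)
  symmetric : ∀ t ∈ Icc (0 : ℝ) 1, (T t : H →ₗ[𝕜] H).IsSymmetric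
  fredholm : ∀ t ∈ Icc (0 : ℝ) 1, (T t).IsFredholm

/-- `ε > 0` is admissible for the self-adjoint operator `T`: the endpoints `± ε` are not in the
spectrum and no point of `[-ε, ε]` is in the essential spectrum. Then the spectral projection
`χ_[-ε, ε](T)` has finite rank, and it depends continuously on `T` as long as `ε` stays
admissible. -/
structure IsAdmissible (T : H →L[𝕜] H) (ε : ℝ) : Prop where
  pos : 0 < ε
  notMem_spectrum : ((ε : ℝ) : 𝕜) ∉ spectrum 𝕜 T
  neg_notMem_spectrum : ((-ε : ℝ) : 𝕜) ∉ spectrum 𝕜 T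
  fredholm : ∀ μ ∈ Icc (-ε) ε, (T - ((μ : ℝ) : 𝕜) • ContinuousLinearMap.id 𝕜 H).IsFredholm

/-- The rank of the spectral projection `χ_[0, ε](T)`, for `ε` admissible: the number of
eigenvalues of `T` in `[0, ε]`, counted with multiplicity. -/
def nonnegRank (T : H →L[𝕜] H) (ε : ℝ) : ℕ :=
  Module.finrank 𝕜
    (⨆ μ ∈ Icc (0 : ℝ) ε, Module.End.eigenspace (T : H →ₗ[𝕜] H) ((μ : ℝ) : 𝕜) : Submodule 𝕜 H)

/-- Phillips' definition: the spectral flow of `T` on `[0,1]` is `k` if for some partition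
`0 = t₀ ≤ ⋯ ≤ tₘ = 1` and some numbers `εⱼ` admissible on `[tⱼ, tⱼ₊₁]`, `k` is the sum of
`rank χ_[0, εⱼ](T (tⱼ₊₁)) - rank χ_[0, εⱼ](T (tⱼ))`. -/
def IsSpectralFlow (T : ℝ → H →L[𝕜] H) (k : ℤ) : Prop :=
  IsFredholmPath T ∧ ∃ (m : ℕ) (t ε : ℕ → ℝ), Monotone t ∧ t 0 = 0 ∧ t m = 1 ∧
    (∀ j < m, ∀ s ∈ Icc (t j) (t (j + 1)), IsAdmissible (T s) (ε j)) ∧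
    k = ∑ j ∈ Finset.range m,
      ((nonnegRank (T (t (j + 1))) (ε j) : ℤ) - (nonnegRank (T (t j)) (ε j) : ℤ))

/-- The spectral flow of a path of bounded Fredholm forms on a Hilbert space is the spectral flow
of the path of operators that represent the forms with respect to the inner product. -/
def IsFormSpectralFlow (B : ℝ → H → H → 𝕜) (k : ℤ) : Prop :=
  ∃ T : ℝ → H →L[𝕜] H,
    (∀ t ∈ Icc (0 : ℝ) 1, ∀ V W, inner 𝕜 (T t V) W = B t V W) ∧ IsSpectralFlow T k

end SpectralFlow

/-! ### Semi-Riemannian metrics, covariant derivative and curvature in charts -/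

section Geometry

/-- A smooth semi-Riemannian metric on an `n`-dimensional manifold: a smooth field of
nondegenerate symmetric bilinear forms on the tangent spaces. -/
structure Metric (n : ℕ) (M : Type*) [TopologicalSpace M]
    [ChartedSpace (EuclideanSpace ℝ (Fin n)) M] [IsManifold (𝓡 n) ∞ M] where
  form : ∀ x : M, TangentSpace (𝓡 n) x →L[ℝ] TangentSpace (𝓡 n) x →L[ℝ] ℝ
  symm : ∀ x v w, form x v w = form x w v
  nondegenerate : ∀ x v, (∀ w, form x v w = 0) → v = 0
  contMDiff : ContMDiff (𝓡 n)
    ((𝓡 n).prod 𝓘(ℝ, EuclideanSpace ℝ (Fin n) →L[ℝ] EuclideanSpace ℝ (Fin n) →L[ℝ] ℝ)) ∞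
    (fun x : M ↦ Bundle.TotalSpace.mk'
      (EuclideanSpace ℝ (Fin n) →L[ℝ] EuclideanSpace ℝ (Fin n) →L[ℝ] ℝ) x (form x))

variable {n : ℕ} {M : Type*} [TopologicalSpace M] [ChartedSpace (EuclideanSpace ℝ (Fin n)) M]

/-- Coordinates of a tangent vector at `p` in the chart centred at `x₀`. -/
def chartCoord (x₀ p : M) (v : TangentSpace (𝓡 n) p) : EuclideanSpace ℝ (Fin n) :=
  mfderiv (𝓡 n) (𝓡 n) (extChartAt (𝓡 n) x₀) p v

/-- The tangent vector at the point with coordinates `y` in the chart centred at `x₀`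
whose coordinates in this chart are `u`. -/
def chartVec (x₀ : M) (y u : EuclideanSpace ℝ (Fin n)) :
    TangentSpace (𝓡 n) ((extChartAt (𝓡 n) x₀).symm y) :=
  mfderiv (𝓡 n) (𝓡 n) (extChartAt (𝓡 n) x₀).symm y u

/-- The standard basis vectors of `ℝⁿ`. -/
def stdVec (i : Fin n) : EuclideanSpace ℝ (Fin n) := EuclideanSpace.single i 1

/-- Partial derivative in the `i`-th coordinate direction. -/
def partialDeriv (i : Fin n) (f : EuclideanSpace ℝ (Fin n) → ℝ) (y : EuclideanSpace ℝ (Fin n)) :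
    ℝ :=
  fderiv ℝ f y (stdVec i)

variable [IsManifold (𝓡 n) ∞ M]

/-- The matrix `g_ij` of the metric in the chart centred at `x₀`. -/
def metricMatrix (g : Metric n M) (x₀ : M) (y : EuclideanSpace ℝ (Fin n)) :
    Matrix (Fin n) (Fin n) ℝ :=
  Matrix.of fun i j ↦ g.form _ (chartVec x₀ y (stdVec i)) (chartVec x₀ y (stdVec j))

/-- The Christoffel symbol `Γ^k_ij` of the Levi-Civita connection in the chart centred at `x₀`. -/
def christoffel (g : Metric n M) (x₀ : M) (k i j : Fin n) (y : EuclideanSpace ℝ (Fin n)) : ℝ :=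
  (1 / 2) * ∑ l, (metricMatrix g x₀ y)⁻¹ k l *
    (partialDeriv i (fun z ↦ metricMatrix g x₀ z j l) y
      + partialDeriv j (fun z ↦ metricMatrix g x₀ z i l) y
      - partialDeriv l (fun z ↦ metricMatrix g x₀ z i j) y)

/-- The `l`-th component of `R(∂_i, ∂_j) ∂_k` in the chart centred at `x₀`, with
`R(X, Y) = [∇_X, ∇_Y] - ∇_[X,Y]`. -/
def curvatureCoeff (g : Metric n M) (x₀ : M) (l i j k : Fin n) (y : EuclideanSpace ℝ (Fin n)) :
    ℝ :=
  partialDeriv i (christoffel g x₀ l j k) y - partialDeriv j (christoffel g x₀ l i k) y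
    + ∑ m, (christoffel g x₀ l i m y * christoffel g x₀ m j k y
      - christoffel g x₀ l j m y * christoffel g x₀ m i k y)

/-- The tangent vector at `x` with coordinates `u` in the chart centred at `x`. -/
def vecAt (x : M) (u : EuclideanSpace ℝ (Fin n)) : TangentSpace (𝓡 n) x :=
  mfderiv (𝓡 n) (𝓡 n) (extChartAt (𝓡 n) x).symm (extChartAt (𝓡 n) x x) u

/-- The curvature tensor `R(u, v) w` at the point `x`. -/
def curvature (g : Metric n M) (x : M) (u v w : TangentSpace (𝓡 n) x) : TangentSpace (𝓡 n) x :=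
  vecAt x (WithLp.toLp 2 fun l ↦ ∑ i, ∑ j, ∑ k,
    curvatureCoeff g x l i j k (extChartAt (𝓡 n) x x)
      * chartCoord x x u i * chartCoord x x v j * chartCoord x x w k)

/-- The velocity of a curve. -/
def velocity (γ : ℝ → M) (t : ℝ) : TangentSpace (𝓡 n) (γ t) :=
  mfderiv 𝓘(ℝ, ℝ) (𝓡 n) γ t (1 : ℝ)

/-- The covariant derivative `DV/dt` at time `t` of a vector field `V` along the curve `γ`,
computed in the chart centred at `γ t`. -/
def covDeriv (g : Metric n M) (γ : ℝ → M) (V : ∀ t, TangentSpace (𝓡 n) (γ t)) (t : ℝ) :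
    TangentSpace (𝓡 n) (γ t) :=
  vecAt (γ t) (WithLp.toLp 2 fun k ↦
    deriv (fun s ↦ chartCoord (γ t) (γ s) (V s) k) t
      + ∑ i, ∑ j, christoffel g (γ t) k i j (extChartAt (𝓡 n) (γ t) (γ t))
        * chartCoord (γ t) (γ t) (velocity γ t) i * chartCoord (γ t) (γ t) (V t) j)

/-- A closed geodesic, extended from `[0,1]` to a smooth curve of period `1` on `ℝ`. -/
structure IsClosedGeodesic (g : Metric n M) (γ : ℝ → M) : Prop where
  contMDiff : ContMDiff 𝓘(ℝ, ℝ) (𝓡 n) ∞ γ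
  periodic : Function.Periodic γ 1
  geodesic : ∀ t, covDeriv g γ (velocity γ) t = 0

/-- `T` is a smooth periodic orthonormal frame along `γ`, with `g(Tᵢ, Tⱼ) = ϵᵢ δᵢⱼ`. -/
structure IsPeriodicFrame (g : Metric n M) (γ : ℝ → M)
    (T : Fin n → ∀ t, TangentSpace (𝓡 n) (γ t)) (ϵ : Fin n → ℝ) : Prop where
  contMDiff : ∀ i, ContMDiff 𝓘(ℝ, ℝ) (𝓡 n).tangent ∞
    (fun t ↦ (⟨γ t, T i t⟩ : TangentBundle (𝓡 n) M))
  periodic : ∀ i, Function.Periodic (fun t ↦ (⟨γ t, T i t⟩ : TangentBundle (𝓡 n) M)) 1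
  sign : ∀ i, ϵ i = 1 ∨ ϵ i = -1
  orthonormal : ∀ t i j, g.form (γ t) (T i t) (T j t) = if i = j then ϵ i else 0

/-- The map `T_t : ℝⁿ → T_{γ(t)} M` given by the frame. -/
def frameVec (γ : ℝ → M) (T : Fin n → ∀ t, TangentSpace (𝓡 n) (γ t)) (t : ℝ)
    (v : EuclideanSpace ℝ (Fin n)) : TangentSpace (𝓡 n) (γ t) :=
  ∑ i, v i • T i t

/-- The inverse of `T_t`: the components of a tangent vector in the orthonormal frame. -/
def frameCoord (g : Metric n M) (γ : ℝ → M) (T : Fin n → ∀ t, TangentSpace (𝓡 n) (γ t))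
    (ϵ : Fin n → ℝ) (t : ℝ) (w : TangentSpace (𝓡 n) (γ t)) : EuclideanSpace ℝ (Fin n) :=
  WithLp.toLp 2 fun i ↦ ϵ i * g.form (γ t) w (T i t)

/-- The Christoffel symbol `Γ_t` of the frame: `Γ_t v = T_t⁻¹ (D/dt (T_t v))` for constant `v`. -/
def frameChristoffel (g : Metric n M) (γ : ℝ → M) (T : Fin n → ∀ t, TangentSpace (𝓡 n) (γ t))
    (ϵ : Fin n → ℝ) (t : ℝ) (v : EuclideanSpace ℝ (Fin n)) : EuclideanSpace ℝ (Fin n) :=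
  frameCoord g γ T ϵ t (covDeriv g γ (fun s ↦ frameVec γ T s v) t)

/-- The pull-back by the frame of the endomorphism `R(γ', ·) γ'`. -/
def frameCurvature (g : Metric n M) (γ : ℝ → M) (T : Fin n → ∀ t, TangentSpace (𝓡 n) (γ t))
    (ϵ : Fin n → ℝ) (t : ℝ) (v : EuclideanSpace ℝ (Fin n)) : EuclideanSpace ℝ (Fin n) :=
  frameCoord g γ T ϵ t (curvature g (γ t) (velocity γ t) (frameVec γ T t v) (velocity γ t))

/-- The pull-back `G` of the metric by the frame. -/
def frameForm (ϵ : Fin n → ℝ) (v w : EuclideanSpace ℝ (Fin n)) : ℝ := ∑ i, ϵ i * v i * w i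

end Geometry

/-! ### The Sobolev space of periodic fields and the spectral flow of a closed geodesic -/

section Sobolev

/-- The Hilbert space `H¹([0,1], ℝⁿ)` with the inner product `V(0)·W(0) + ∫₀¹ V'·W'`.
An element is stored as the pair `(V(0), V') ∈ ℝⁿ × L²([0,1], ℝⁿ)`; the corresponding (absolutely
continuous) function is `H1.val`. -/
abbrev H1 (n : ℕ) : Type :=
  WithLp 2 (EuclideanSpace ℝ (Fin n) ×
    Lp (EuclideanSpace ℝ (Fin n)) 2 (volume.restrict (Icc (0 : ℝ) 1)))

variable {n : ℕ}

/-- The derivative `V'` of `V ∈ H¹`. -/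
def H1.der (V : H1 n) : ℝ → EuclideanSpace ℝ (Fin n) := V.snd

/-- The value `V(r) = V(0) + ∫₀ʳ V'`, for `r ∈ [0,1]`. -/
def H1.val (V : H1 n) (r : ℝ) : EuclideanSpace ℝ (Fin n) := V.fst + ∫ s in (0 : ℝ)..r, V.der s

theorem H1.intervalIntegrable_der (V : H1 n) : IntervalIntegrable V.der volume 0 1 := by
  rw [intervalIntegrable_iff_integrableOn_Icc_of_le zero_le_one]
  exact (Lp.memLp V.snd).integrable (by norm_num)

theorem H1.val_one_add (V W : H1 n) : (V + W).val 1 = V.val 1 + W.val 1 := by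
  have h : (∫ s in (0 : ℝ)..1, (V + W).der s)
      = (∫ s in (0 : ℝ)..1, V.der s) + ∫ s in (0 : ℝ)..1, W.der s := by
    rw [← intervalIntegral.integral_add V.intervalIntegrable_der W.intervalIntegrable_der]
    refine intervalIntegral.integral_congr_ae_restrict ?_
    rw [uIoc_of_le zero_le_one]
    exact ae_restrict_of_ae_restrict_of_subset Ioc_subset_Icc_self (Lp.coeFn_add V.snd W.snd)
  simp only [H1.val, h, WithLp.add_fst]
  abel

theorem H1.val_one_smul (c : ℝ) (V : H1 n) : (c • V).val 1 = c • V.val 1 := by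
  have h : (∫ s in (0 : ℝ)..1, (c • V).der s) = c • ∫ s in (0 : ℝ)..1, V.der s := by
    rw [← intervalIntegral.integral_smul]
    refine intervalIntegral.integral_congr_ae_restrict ?_
    rw [uIoc_of_le zero_le_one]
    exact ae_restrict_of_ae_restrict_of_subset Ioc_subset_Icc_self (Lp.coeFn_smul c V.snd)
  simp only [H1.val, h, WithLp.smul_fst, smul_add]

theorem H1.val_zero (V : H1 n) : V.val 0 = V.fst := by simp [H1.val]

/-- The space `H¹_per([0,1], ℝⁿ)` of all `V ∈ H¹` with `V(0) = V(1)`. -/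
def H1per (n : ℕ) : Submodule ℝ (H1 n) where
  carrier := {V | V.val 0 = V.val 1}
  add_mem' {V W} hV hW := by
    simp only [mem_ofPred_eq, H1.val_zero] at hV hW ⊢
    rw [H1.val_one_add, ← hV, ← hW, WithLp.add_fst]
  zero_mem' := by
    have h := H1.val_one_smul (0 : ℝ) (0 : H1 n)
    simp only [zero_smul] at h
    simp only [mem_ofPred_eq, H1.val_zero, h, WithLp.zero_fst]
  smul_mem' c V hV := by
    simp only [mem_ofPred_eq, H1.val_zero] at hV ⊢
    rw [H1.val_one_smul, ← hV, WithLp.smul_fst]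

variable {M : Type*} [TopologicalSpace M] [ChartedSpace (EuclideanSpace ℝ (Fin n)) M]
  [IsManifold (𝓡 n) ∞ M]

/-- The path of bilinear forms `B_t` on `H¹_per([0,1], ℝⁿ)` associated with a closed geodesic and
a periodic orthonormal frame: for `t > 0` it is the index form of the restriction of the geodesic to
`[0,t]`, rescaled to `[0,1]` and multiplied by `t²`. -/
def indexForm (g : Metric n M) (γ : ℝ → M) (T : Fin n → ∀ t, TangentSpace (𝓡 n) (γ t))
    (ϵ : Fin n → ℝ) (t : ℝ) (V W : H1per n) : ℝ :=
  ∫ r in (0 : ℝ)..1,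
    (frameForm ϵ (V.1.der r) (W.1.der r)
      + t * frameForm ϵ (frameChristoffel g γ T ϵ (t * r) (V.1.val r)) (W.1.der r)
      + t * frameForm ϵ (V.1.der r) (frameChristoffel g γ T ϵ (t * r) (W.1.val r))
      + t ^ 2 * frameForm ϵ (frameChristoffel g γ T ϵ (t * r) (V.1.val r))
          (frameChristoffel g γ T ϵ (t * r) (W.1.val r))
      + t ^ 2 * frameForm ϵ (frameCurvature g γ T ϵ (t * r) (V.1.val r)) (W.1.val r))

/-- `k` is the spectral flow of the path `[0,1] ∋ t ↦ B_t`. -/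
def IsGeodesicSpectralFlow (g : Metric n M) (γ : ℝ → M)
    (T : Fin n → ∀ t, TangentSpace (𝓡 n) (γ t)) (ϵ : Fin n → ℝ) (k : ℤ) : Prop :=
  IsFormSpectralFlow (𝕜 := ℝ) (indexForm g γ T ϵ) k

open Classical in
/-- The spectral flow `sf(γ)` of a closed geodesic `γ`, computed with the periodic frame `T`. -/
def geodesicSpectralFlow (g : Metric n M) (γ : ℝ → M)
    (T : Fin n → ∀ t, TangentSpace (𝓡 n) (γ t)) (ϵ : Fin n → ℝ) : ℤ :=
  if h : ∃ k, IsGeodesicSpectralFlow g γ T ϵ k then h.choose else 0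

/-- The `N`-th iterate `t ↦ γ(N t)` of a closed curve. -/
def iterateCurve (γ : ℝ → M) (N : ℕ) (t : ℝ) : M := γ (N * t)

/-- The frame `t ↦ T_{N t}` along the `N`-th iterate. -/
def iterateFrame (γ : ℝ → M) (T : Fin n → ∀ t, TangentSpace (𝓡 n) (γ t)) (N : ℕ) (i : Fin n)
    (t : ℝ) : TangentSpace (𝓡 n) (iterateCurve γ N t) :=
  T i (N * t)

end Sobolev

end SemiRiem

end

/-! The argument shows that `N ↦ sf N` is additive up to a bounded error, with defect at most `5 *
n`, and then treats it as an abstract quasi-additive sequence.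

Spectral flow as a relative index. In the given Hilbert structure the operator representing `B_t` is
`J + K_t`, where `J` multiplies the components by the signs `ϵ` (so `J² = 1`) and `K_t` is a norm
limit of finite rank operators, because every term other than `∫ G(V', W')` contains an
undifferentiated field (`isFiniteRankLimit_indexOp_sub`). Hence the essential spectrum avoids `(-1,
1)` and the spectral flow exists. On a large finite-dimensional `J`-invariant subspace `E` the
compressions of such operators inherit invertibility, and the eigenvalues in `[0, ε]` are counted by
the positive index of `T + δ` minus that of `T - ε`. The contributions of `T - ε` cancel along each
piece of the partition, and the sum telescopes: for small `δ > 0` and all large `E`, the spectral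
flow is the positive index of `T 1 + δ` on `E` minus that of `T 0 + δ`
(`IsSpectralFlow.eventually_eq`). Uniqueness follows, and only the endpoints of the path matter.

Iterates. Reparametrization turns the index forms of the `N`-th iterate into the forms `B_{Nt}` with
the periodic coefficients of the original geodesic (`indexForm_iterate`), so `sf N` compares `B_N`
with `B_0`. Cut `[0, 1]` at `θ = N / (N + P)`. Fields vanishing at `0` and `θ` are pairs of rescaled
fields vanishing at `0`, and by periodicity `B_{N+P}` splits as `θ⁻¹ B_N + (1 - θ)⁻¹ B_P` on them
(`energy_primPer_add`). The conditions at the cut points have finite codimension, and positive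
indices change by at most the dimension of what is added (`abs_sub_le_of_gluing`); the total error
is at most `5 * n`.

Growth. Fekete's lemma applied to `a + K` and to `-a + K` gives `|a N - L * N| ≤ K`
(`exists_linear_growth`), from which all assertions about boundedness and growth follow.

Geometry. The coefficients must be continuous and periodic, and the curvature term symmetric.
Covariant derivative and curvature are defined in the chart centred at the moving point, so
continuity rests on the transformation laws under change of charts; the symmetry is the pair
symmetry of the curvature tensor. -/

noncomputable section

namespace SemiRiem

/-! ### The index of positivity of a quadratic form on a finite-dimensional subspace -/

section PosIdx

variable {V V' : Type*} [AddCommGroup V] [Module ℝ V] [AddCommGroup V'] [Module ℝ V']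

/-- The largest dimension of a subspace of `E` on which `Q` is positive definite. -/
def posIdx (Q : QuadraticForm ℝ V) (E : Submodule ℝ V) : ℕ := sigPos (Q.restrict E)

variable {Q : QuadraticForm ℝ V} {E F : Submodule ℝ V}

theorem finrank_le_posIdx [FiniteDimensional ℝ E] (hFE : F ≤ E)
    (hF : ∀ v ∈ F, v ≠ 0 → 0 < Q v) : Module.finrank ℝ F ≤ posIdx Q E := by
  have h : ((Q.restrict E).restrict (F.submoduleOf E)).PosDef := by
    rintro ⟨⟨v, hvE⟩, hvF⟩ hv
    exact hF v hvF fun h ↦ hv (by subst h; rfl)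
  have := le_sigPos_of_posDef _ h
  rwa [(Submodule.submoduleOfEquivOfLe hFE).finrank_eq] at this

theorem exists_pos_finrank_eq_posIdx (Q : QuadraticForm ℝ V) (E : Submodule ℝ V)
    [FiniteDimensional ℝ E] :
    ∃ F ≤ E, Module.finrank ℝ F = posIdx Q E ∧ ∀ v ∈ F, v ≠ 0 → 0 < Q v := by
  obtain ⟨F, hF, hpos⟩ := exists_finrank_eq_sigPos_and_posDef (Q.restrict E)
  refine ⟨F.map E.subtype, Submodule.map_subtype_le E F, ?_, ?_⟩
  · rw [posIdx, ← hF]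
    exact LinearEquiv.finrank_eq (Submodule.equivMapOfInjective _ E.injective_subtype F).symm
  · rintro _ ⟨v, hv, rfl⟩ hne
    exact hpos ⟨v, hv⟩ fun h ↦ hne (by simpa using congrArg (fun x : F ↦ (x : E)) h)

/-- A maximal negative definite subspace together with the radical is nonpositive, and Sylvester's
law gives its dimension. Upper bounds for `posIdx` are obtained by exhibiting such subspaces, as
lower bounds are by positive definite ones. -/
theorem exists_nonpos_finrank_add (Q : QuadraticForm ℝ V) (E : Submodule ℝ V)
    [FiniteDimensional ℝ E] :
    ∃ N ≤ E, (∀ v ∈ N, Q v ≤ 0) ∧ posIdx Q E + Module.finrank ℝ N = Module.finrank ℝ E := by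
  obtain ⟨F, hF, hneg⟩ := exists_finrank_eq_sigNeg_and_negDef (Q.restrict E)
  have hneg' : ∀ v ∈ F, v ≠ 0 → Q.restrict E v < 0 := by
    intro v hv hne
    have := hneg ⟨v, hv⟩ fun h ↦ hne (by simpa using congrArg (fun x : F ↦ (x : E)) h)
    simpa using this
  have hdisj : Disjoint F (Q.restrict E).radical := by
    rw [Submodule.disjoint_def]
    intro v hv hr
    by_contra hne
    have h1 := hneg' v hv hne
    rw [(QuadraticMap.mem_radical_iff'.1 hr).1] at h1
    exact lt_irrefl _ h1
  refine ⟨(F ⊔ (Q.restrict E).radical).map E.subtype, Submodule.map_subtype_le E _, ?_, ?_⟩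
  · rintro _ ⟨v, hv, rfl⟩
    obtain ⟨x, hx, y, hy, rfl⟩ := Submodule.mem_sup.1 hv
    have h1 := (QuadraticMap.mem_radical_iff'.1 hy).2 x
    change Q.restrict E (x + y) ≤ 0
    rw [add_comm, h1]
    rcases eq_or_ne x 0 with rfl | hne
    · simp
    · exact (hneg' x hx hne).le
  · have h2 := Submodule.finrank_sup_add_finrank_inf_eq F (Q.restrict E).radical
    rw [hdisj.eq_bot, finrank_bot, add_zero] at h2
    have h3 := LinearEquiv.finrank_eq
      (Submodule.equivMapOfInjective _ E.injective_subtype (F ⊔ (Q.restrict E).radical))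
    have h4 := QuadraticForm.sigPos_add_sigNeg_add_radical (Q := Q.restrict E)
    rw [← h3, h2, hF, ← h4, posIdx]
    ring

theorem posIdx_add_finrank_le [FiniteDimensional ℝ E] {N : Submodule ℝ V} (hNE : N ≤ E)
    (hN : ∀ v ∈ N, Q v ≤ 0) : posIdx Q E + Module.finrank ℝ N ≤ Module.finrank ℝ E := by
  have := QuadraticForm.sigPos_add_finrank_le_of_nonpos (Q := Q.restrict E)
    (V := N.submoduleOf E) fun x hx ↦ hN x hx
  rwa [LinearEquiv.finrank_eq (Submodule.submoduleOfEquivOfLe hNE)] at this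

theorem posIdx_mono {Q' : QuadraticForm ℝ V} [FiniteDimensional ℝ E] (hFE : F ≤ E)
    (h : ∀ v ∈ F, Q v ≤ Q' v) : posIdx Q F ≤ posIdx Q' E := by
  have : FiniteDimensional ℝ F := Submodule.finiteDimensional_of_le hFE
  obtain ⟨G, hG, hdim, hpos⟩ := exists_pos_finrank_eq_posIdx Q F
  rw [← hdim]
  exact finrank_le_posIdx (hG.trans hFE) fun v hv hne ↦ (hpos v hv hne).trans_le (h v (hG hv))

/-- A nonpositive subspace of `E` of maximal dimension stays nonpositive in `E ⊔ C`, while the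
ambient dimension grows by at most that of `C`. -/
theorem posIdx_sup_le (Q : QuadraticForm ℝ V) (E C : Submodule ℝ V) [FiniteDimensional ℝ E]
    [FiniteDimensional ℝ C] : posIdx Q (E ⊔ C) ≤ posIdx Q E + Module.finrank ℝ C := by
  obtain ⟨N, hN, hnp, hdim⟩ := exists_nonpos_finrank_add Q E
  have h1 := posIdx_add_finrank_le (E := E ⊔ C) (hN.trans le_sup_left) hnp
  have h2 := Submodule.finrank_add_le_finrank_add_finrank E C
  omega

theorem finrank_sup_of_disjoint {E₁ E₂ : Submodule ℝ V} [FiniteDimensional ℝ E₁]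
    [FiniteDimensional ℝ E₂] (h : Disjoint E₁ E₂) :
    Module.finrank ℝ ↥(E₁ ⊔ E₂) = Module.finrank ℝ E₁ + Module.finrank ℝ E₂ := by
  have h2 := Submodule.finrank_sup_add_finrank_inf_eq E₁ E₂
  rwa [h.eq_bot, finrank_bot, add_zero] at h2

/-- Sums of nonpositive subspaces of the two orthogonal blocks bound the index from above, sums of
positive definite ones bound it from below. -/
theorem posIdx_sup_of_orthogonal {E₁ E₂ : Submodule ℝ V} [FiniteDimensional ℝ E₁]
    [FiniteDimensional ℝ E₂] (hd : Disjoint E₁ E₂)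
    (h : ∀ v ∈ E₁, ∀ w ∈ E₂, Q (v + w) = Q v + Q w) :
    posIdx Q (E₁ ⊔ E₂) = posIdx Q E₁ + posIdx Q E₂ := by
  apply le_antisymm
  · obtain ⟨N₁, hN₁, hnp₁, hdim₁⟩ := exists_nonpos_finrank_add Q E₁
    obtain ⟨N₂, hN₂, hnp₂, hdim₂⟩ := exists_nonpos_finrank_add Q E₂
    have : FiniteDimensional ℝ N₁ := Submodule.finiteDimensional_of_le hN₁
    have : FiniteDimensional ℝ N₂ := Submodule.finiteDimensional_of_le hN₂
    have h1 : ∀ v ∈ N₁ ⊔ N₂, Q v ≤ 0 := by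
      intro v hv
      obtain ⟨x, hx, y, hy, rfl⟩ := Submodule.mem_sup.1 hv
      rw [h x (hN₁ hx) y (hN₂ hy)]
      linarith [hnp₁ x hx, hnp₂ y hy]
    have h2 := posIdx_add_finrank_le (sup_le_sup hN₁ hN₂) h1
    rw [finrank_sup_of_disjoint hd, finrank_sup_of_disjoint (hd.mono hN₁ hN₂)] at h2
    omega
  · obtain ⟨F₁, hF₁, hdim₁, hp₁⟩ := exists_pos_finrank_eq_posIdx Q E₁
    obtain ⟨F₂, hF₂, hdim₂, hp₂⟩ := exists_pos_finrank_eq_posIdx Q E₂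
    have : FiniteDimensional ℝ F₁ := Submodule.finiteDimensional_of_le hF₁
    have : FiniteDimensional ℝ F₂ := Submodule.finiteDimensional_of_le hF₂
    rw [← hdim₁, ← hdim₂, ← finrank_sup_of_disjoint (hd.mono hF₁ hF₂)]
    refine finrank_le_posIdx (sup_le_sup hF₁ hF₂) ?_
    intro v hv hne
    obtain ⟨x, hx, y, hy, rfl⟩ := Submodule.mem_sup.1 hv
    rw [h x (hF₁ hx) y (hF₂ hy)]
    rcases eq_or_ne x 0 with rfl | hx0
    · have := hp₂ y hy (by simpa using hne)
      simpa using this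
    · rcases eq_or_ne y 0 with rfl | hy0
      · simpa using hp₁ x hx hx0
      · linarith [hp₁ x hx hx0, hp₂ y hy hy0]

theorem posIdx_eq_finrank [FiniteDimensional ℝ E] (h : ∀ v ∈ E, v ≠ 0 → 0 < Q v) :
    posIdx Q E = Module.finrank ℝ E :=
  le_antisymm (sigPos_le_finrank _) (finrank_le_posIdx le_rfl h)

theorem posIdx_eq_zero [FiniteDimensional ℝ E] (h : ∀ v ∈ E, Q v ≤ 0) : posIdx Q E = 0 := by
  have := posIdx_add_finrank_le (E := E) le_rfl h
  omega

theorem posIdx_map {Q' : QuadraticForm ℝ V'} (f : V →ₗ[ℝ] V') (hf : Function.Injective f) {c : ℝ}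
    (hc : 0 < c) [FiniteDimensional ℝ E] (h : ∀ v ∈ E, Q' (f v) = c * Q v) :
    posIdx Q' (E.map f) = posIdx Q E := by
  apply le_antisymm
  · obtain ⟨N, hN, hnp, hdim⟩ := exists_nonpos_finrank_add Q E
    have h1 := posIdx_add_finrank_le (Q := Q') (Submodule.map_mono (f := f) hN) (by
      rintro _ ⟨v, hv, rfl⟩
      rw [h v (hN hv)]
      exact mul_nonpos_of_nonneg_of_nonpos hc.le (hnp v hv))
    rw [← LinearEquiv.finrank_eq (Submodule.equivMapOfInjective f hf E),
      ← LinearEquiv.finrank_eq (Submodule.equivMapOfInjective f hf N)] at h1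
    omega
  · obtain ⟨F, hF, hdim, hp⟩ := exists_pos_finrank_eq_posIdx Q E
    rw [← hdim, LinearEquiv.finrank_eq (Submodule.equivMapOfInjective f hf F)]
    refine finrank_le_posIdx (Submodule.map_mono hF) ?_
    rintro _ ⟨v, hv, rfl⟩ hne
    rw [h v (hF hv)]
    exact mul_pos hc (hp v hv fun h0 ↦ hne (by rw [h0, map_zero]))

end PosIdx

/-! ### Quadratic forms of bounded operators -/

section OpForm

variable {H : Type*} [NormedAddCommGroup H] [InnerProductSpace ℝ H]

/-- The quadratic form `v ↦ ⟪A v, v⟫`. -/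
def opForm (A : H →L[ℝ] H) : QuadraticForm ℝ H :=
  LinearMap.BilinMap.toQuadraticMap ((innerₗ H).comp (A : H →ₗ[ℝ] H))

theorem opForm_apply (A : H →L[ℝ] H) (v : H) : opForm A v = inner ℝ (A v) v := rfl

theorem opForm_add (A B : H →L[ℝ] H) (v : H) : opForm (A + B) v = opForm A v + opForm B v := by
  simp [opForm_apply, inner_add_left]

theorem abs_opForm_le (A : H →L[ℝ] H) (v : H) : |opForm A v| ≤ ‖A‖ * ‖v‖ ^ 2 := by
  rw [opForm_apply]
  calc |inner ℝ (A v) v| ≤ ‖A v‖ * ‖v‖ := abs_real_inner_le_norm _ _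
    _ ≤ ‖A‖ * ‖v‖ * ‖v‖ := by gcongr; exact A.le_opNorm v
    _ = _ := by ring

theorem exists_forall_mul_sq_le (A : H →L[ℝ] H) (F : Submodule ℝ H) [FiniteDimensional ℝ F]
    (h : ∀ v ∈ F, v ≠ 0 → 0 < opForm A v) : ∃ c > 0, ∀ v ∈ F, c * ‖v‖ ^ 2 ≤ opForm A v := by
  have hcont : Continuous fun v : F ↦ opForm A (v : H) := by
    simp only [opForm_apply]
    fun_prop
  have hK : IsCompact (Metric.sphere (0 : F) 1) := isCompact_sphere _ _
  rcases (Metric.sphere (0 : F) 1).eq_empty_or_nonempty with he | hne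
  -- An empty unit sphere forces `F = 0`, and then any constant works; otherwise the minimum over
  -- the compact sphere is the constant.
  · refine ⟨1, one_pos, fun v hv ↦ ?_⟩
    have : v = 0 := by
      by_contra h0
      have hn : ‖v‖ ≠ 0 := norm_ne_zero_iff.2 h0
      have : (‖v‖⁻¹ • (⟨v, hv⟩ : F)) ∈ Metric.sphere (0 : F) 1 := by
        simp [norm_smul, hn]
      rw [he] at this
      exact this
    simp [this]
  · obtain ⟨x, hx, hmin⟩ := hK.exists_isMinOn hne hcont.continuousOn
    have hx1 : ‖(x : H)‖ = 1 := by simpa using hx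
    refine ⟨opForm A x, h x x.2 fun h0 ↦ by simp [h0] at hx1, fun v hv ↦ ?_⟩
    rcases eq_or_ne v 0 with rfl | h0
    · simp
    · have hn : ‖v‖ ≠ 0 := norm_ne_zero_iff.2 h0
      have hm : (‖v‖⁻¹ • (⟨v, hv⟩ : F)) ∈ Metric.sphere (0 : F) 1 := by
        simp [norm_smul, hn]
      have h1 : opForm A x ≤ opForm A (‖v‖⁻¹ • v) := hmin hm
      rw [QuadraticMap.map_smul] at h1
      have h2 : ‖v‖ ^ 2 * (‖v‖⁻¹ * ‖v‖⁻¹ * opForm A v) = opForm A v := by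
        field_simp
      calc opForm A x * ‖v‖ ^ 2 ≤ (‖v‖⁻¹ * ‖v‖⁻¹ * opForm A v) * ‖v‖ ^ 2 := by
            gcongr
            simpa using h1
        _ = opForm A v := by rw [mul_comm, h2]

/-- Positive definiteness on a finite-dimensional subspace is an open condition. -/
theorem eventually_posIdx_le {X : Type*} {l : Filter X} {A : X → H →L[ℝ] H} {A₀ : H →L[ℝ] H}
    (hA : Tendsto A l (𝓝 A₀)) (E : Submodule ℝ H) [FiniteDimensional ℝ E] :
    ∀ᶠ x in l, posIdx (opForm A₀) E ≤ posIdx (opForm (A x)) E := by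
  obtain ⟨F, hF, hdim, hp⟩ := exists_pos_finrank_eq_posIdx (opForm A₀) E
  have : FiniteDimensional ℝ F := Submodule.finiteDimensional_of_le hF
  obtain ⟨c, hc, hcF⟩ := exists_forall_mul_sq_le A₀ F hp
  have h1 : ∀ᶠ x in l, ‖A x - A₀‖ < c := by
    have := (tendsto_iff_norm_sub_tendsto_zero.1 hA).eventually_lt_const hc
    exact this
  filter_upwards [h1] with x hx
  rw [← hdim]
  refine finrank_le_posIdx hF fun v hv hne ↦ ?_
  have h2 : opForm (A x) v = opForm A₀ v + opForm (A x - A₀) v := by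
    rw [← opForm_add]
    congr 2
    abel
  have h3 := (abs_le.1 (abs_opForm_le (A x - A₀) v)).1
  have h4 : 0 < ‖v‖ ^ 2 := by positivity
  nlinarith [hcF v hv]

/-- The symmetric operator `A` is nondegenerate as a bilinear form on `E`. -/
def IsNondegOn (A : H →L[ℝ] H) (E : Submodule ℝ H) : Prop :=
  ∀ v ∈ E, (∀ w ∈ E, inner ℝ (A v) w = 0) → v = 0

/-- Nondegeneracy kills the radical in Sylvester's law. Each of the two indices is lower
semicontinuous in the operator, so a constant sum makes both locally constant. -/
theorem posIdx_add_posIdx_neg {A : H →L[ℝ] H} (hA : (A : H →ₗ[ℝ] H).IsSymmetric)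
    {E : Submodule ℝ H} [FiniteDimensional ℝ E] (hE : IsNondegOn A E) :
    posIdx (opForm A) E + posIdx (opForm (-A)) E = Module.finrank ℝ E := by
  have h := QuadraticForm.sigPos_add_sigNeg_add_radical (Q := (opForm A).restrict E)
  have hr : ((opForm A).restrict E).radical = ⊥ := by
    rw [Submodule.eq_bot_iff]
    rintro ⟨v, hv⟩ hvr
    obtain ⟨h0, h1⟩ := QuadraticMap.mem_radical_iff'.1 hvr
    have : v = 0 := by
      refine hE v hv fun w hw ↦ ?_
      have h2 : opForm A (v + w) = opForm A w := h1 ⟨w, hw⟩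
      have h3 : opForm A v = 0 := h0
      have h4 : inner ℝ (A w) v = inner ℝ (A v) w := by
        rw [real_inner_comm]
        exact (hA v w).symm
      simp only [opForm_apply, map_add, inner_add_left, inner_add_right] at h2 h3
      linarith
    exact Subtype.ext this
  rw [hr, finrank_bot, add_zero] at h
  have h5 : (-(opForm A).restrict E) = (opForm (-A)).restrict E := by
    ext v
    simp [opForm_apply]
  rw [posIdx, posIdx, ← h, ← h5]
  rfl

/-- The index of positivity is constant along paths of nondegenerate symmetric forms. -/
theorem posIdx_eq_of_path {A : ℝ → H →L[ℝ] H} {a b : ℝ} (hab : a ≤ b)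
    (hA : ContinuousOn A (Icc a b)) (hs : ∀ s ∈ Icc a b, (A s : H →ₗ[ℝ] H).IsSymmetric)
    (E : Submodule ℝ H) [FiniteDimensional ℝ E] (hE : ∀ s ∈ Icc a b, IsNondegOn (A s) E) :
    posIdx (opForm (A b)) E = posIdx (opForm (A a)) E := by
  have hloc : ∀ x ∈ Icc a b, ∀ᶠ y in 𝓝[Icc a b] x,
      posIdx (opForm (A y)) E = posIdx (opForm (A x)) E := by
    intro x hx
    -- Neither the positive index of `A` nor that of `-A` can drop near `x`, and their sum is `dim
    -- E` at every point, so neither can jump up.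
    have h1 := eventually_posIdx_le (hA x hx) E
    have h2 := eventually_posIdx_le (hA x hx).neg E
    filter_upwards [h1, h2, self_mem_nhdsWithin] with y hy1 hy2 hy
    simp only [Pi.neg_apply] at hy2
    have h3 := posIdx_add_posIdx_neg (hs x hx) (hE x hx)
    have h4 := posIdx_add_posIdx_neg (hs y hy) (hE y hy)
    omega
  have hc : ContinuousOn (fun s ↦ posIdx (opForm (A s)) E) (Icc a b) := by
    intro x hx
    exact tendsto_nhds_of_eventually_eq (hloc x hx)
  exact (isPreconnected_Icc.constant hc (right_mem_Icc.2 hab) (left_mem_Icc.2 hab))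

end OpForm

/-! ### Symmetric Fredholm operators -/

section Fredholm

variable {H : Type*} [NormedAddCommGroup H] [InnerProductSpace ℝ H]

/-- The operator `T - μ`. -/
def shift (T : H →L[ℝ] H) (μ : ℝ) : H →L[ℝ] H := T - μ • ContinuousLinearMap.id ℝ H

@[simp] theorem shift_apply (T : H →L[ℝ] H) (μ : ℝ) (v : H) : shift T μ v = T v - μ • v := rfl

theorem shift_zero (T : H →L[ℝ] H) : shift T 0 = T := by simp [shift]

theorem isSymmetric_shift {T : H →L[ℝ] H} (hT : (T : H →ₗ[ℝ] H).IsSymmetric) (μ : ℝ) :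
    (shift T μ : H →ₗ[ℝ] H).IsSymmetric := by
  intro v w
  have := hT v w
  simp only [ContinuousLinearMap.coe_coe] at this
  simp [inner_sub_left, inner_sub_right, real_inner_smul_left, real_inner_smul_right, this]

theorem opForm_shift (T : H →L[ℝ] H) (μ : ℝ) (v : H) :
    opForm (shift T μ) v = opForm T v - μ * ‖v‖ ^ 2 := by
  simp [opForm_apply, inner_sub_left, real_inner_smul_left]

theorem continuous_shift (T : H →L[ℝ] H) : Continuous (shift T) := by
  unfold shift
  fun_prop

theorem norm_shift_sub_le (T : H →L[ℝ] H) (μ ν : ℝ) (v : H) :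
    ‖shift T μ v‖ ≤ ‖shift T ν v‖ + |μ - ν| * ‖v‖ := by
  have h : shift T μ v = shift T ν v - (μ - ν) • v := by
    simp [sub_smul]
  rw [h]
  refine (norm_sub_le _ _).trans ?_
  rw [norm_smul, Real.norm_eq_abs]

/-- An invertible operator is bounded below. -/
theorem exists_le_norm_of_isUnit {S : H →L[ℝ] H} (hS : IsUnit S) :
    ∃ c > 0, ∀ v, c * ‖v‖ ≤ ‖S v‖ := by
  obtain ⟨u, rfl⟩ := hS
  refine ⟨(‖(↑u⁻¹ : H →L[ℝ] H)‖ + 1)⁻¹, by positivity, fun v ↦ ?_⟩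
  rw [inv_mul_le_iff₀ (by positivity)]
  calc ‖v‖ = ‖(↑u⁻¹ : H →L[ℝ] H) ((u : H →L[ℝ] H) v)‖ := by
        simp [← mul_apply_eq_comp]
    _ ≤ ‖(↑u⁻¹ : H →L[ℝ] H)‖ * ‖(u : H →L[ℝ] H) v‖ := ContinuousLinearMap.le_opNorm _ _
    _ ≤ _ := by gcongr; linarith

variable [CompleteSpace H]

/-- A Fredholm operator is bounded below on the orthogonal complement of its kernel. -/
theorem exists_le_norm_of_isFredholm {S : H →L[ℝ] H} (hS : S.IsFredholm) :
    ∃ c > 0, ∀ v ∈ (S : H →ₗ[ℝ] H).kerᗮ, c * ‖v‖ ≤ ‖S v‖ := by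
  have := hS.finite_ker
  obtain ⟨Z, hZ⟩ := hS.closedComplemented_range.exists_isTopCompl
  let p := hS.fredholmPackage (Submodule.isTopCompl_orthogonal (K := (S : H →ₗ[ℝ] H).ker)) hZ
  have hX : p.decDom.X₁ = (S : H →ₗ[ℝ] H).kerᗮ := rfl
  let e : p.decCodom.X₁ →L[ℝ] p.decDom.X₁ := p.equiv.symm
  refine ⟨(‖e‖ + 1)⁻¹, by positivity, fun v hv ↦ ?_⟩
  rw [← hX] at hv
  rw [inv_mul_le_iff₀ (by positivity)]
  have h2 : ((p.equiv ⟨v, hv⟩ : p.decCodom.X₁) : H) = S v :=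
     congrArg (fun f ↦ ((f ⟨v, hv⟩ : p.decCodom.X₁) : H)) p.equiv_eq_restrict
  have h3 : e (p.equiv ⟨v, hv⟩) = ⟨v, hv⟩ := p.equiv.symm_apply_apply _
  calc ‖v‖ = ‖e (p.equiv ⟨v, hv⟩)‖ := by rw [h3]; rfl
    _ ≤ ‖e‖ * ‖p.equiv ⟨v, hv⟩‖ := e.le_opNorm _
    _ = ‖e‖ * ‖S v‖ := by rw [← h2]; rfl
    _ ≤ _ := by gcongr; linarith

/-- Bounded below means injective with closed range; by symmetry the orthogonal complement of the
range is the kernel, which is zero. -/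
theorem isUnit_of_forall_le_norm {S : H →L[ℝ] H} (hs : (S : H →ₗ[ℝ] H).IsSymmetric) {c : ℝ}
    (hc : 0 < c) (h : ∀ v, c * ‖v‖ ≤ ‖S v‖) : IsUnit S := by
  rw [ContinuousLinearMap.isUnit_iff_bijective]
  have hanti : AntilipschitzWith (Real.toNNReal c⁻¹) S := by
    refine S.antilipschitz_of_bound fun v ↦ ?_
    have := h v
    rw [Real.coe_toNNReal _ (by positivity), inv_mul_eq_div, le_div_iff₀ hc]
    linarith
  refine ⟨hanti.injective, ?_⟩
  have hclosed : IsClosed ((S : H →ₗ[ℝ] H).range : Set H) := by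
    exact hanti.isClosed_range S.uniformContinuous
  have : CompleteSpace (S : H →ₗ[ℝ] H).range := hclosed.completeSpace_coe
  have hr : (S : H →ₗ[ℝ] H).range = ⊤ := by
    rw [← Submodule.orthogonal_eq_bot_iff, hs.orthogonal_range, LinearMap.ker_eq_bot]
    exact hanti.injective
  exact LinearMap.range_eq_top.1 hr

omit [CompleteSpace H] in
theorem ker_shift (T : H →L[ℝ] H) (μ : ℝ) :
    (shift T μ : H →ₗ[ℝ] H).ker = Module.End.eigenspace (T : H →ₗ[ℝ] H) μ := by
  ext v
  simp [sub_eq_zero]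

/-- Zero is isolated in the spectrum of a symmetric Fredholm operator. -/
theorem exists_isUnit_shift {T : H →L[ℝ] H} (hs : (T : H →ₗ[ℝ] H).IsSymmetric)
    (hT : T.IsFredholm) : ∃ c > 0, ∀ μ, μ ≠ 0 → |μ| < c → IsUnit (shift T μ) := by
  obtain ⟨c, hc, h⟩ := exists_le_norm_of_isFredholm hT
  have := hT.finite_ker
  refine ⟨c, hc, fun μ hμ0 hμ ↦ ?_⟩
  have hμ0' : 0 < |μ| := abs_pos.2 hμ0
  refine isUnit_of_forall_le_norm (c := min |μ| (c - |μ|)) (isSymmetric_shift hs μ)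
    (lt_min hμ0' (by linarith)) fun v ↦ ?_
  -- On the kernel `T - μ` is `-μ`; on its orthogonal complement it is bounded below by `c - |μ|`.
  -- The two images are orthogonal, so the bounds combine by Pythagoras.
  obtain ⟨k, hk, w, hw, rfl⟩ :=
    Submodule.exists_add_mem_mem_orthogonal (K := (T : H →ₗ[ℝ] H).ker) v
  have hk' : T k = 0 := hk
  have hTw : inner ℝ k (T w) = 0 := by
    have := hs k w
    simp only [ContinuousLinearMap.coe_coe, hk', inner_zero_left] at this
    exact this.symm
  have hkw : inner ℝ k w = 0 := hw k hk
  set m := min |μ| (c - |μ|) with hm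
  have hm0 : 0 < m := lt_min hμ0' (by linarith)
  have h1 : ‖k + w‖ ^ 2 = ‖k‖ ^ 2 + ‖w‖ ^ 2 := by
    rw [norm_add_sq_real, hkw]; ring
  have h2 : shift T μ (k + w) = -(μ • k) + shift T μ w := by
    simp only [shift_apply, map_add, hk']
    module
  have h3 : ‖shift T μ (k + w)‖ ^ 2 = |μ| ^ 2 * ‖k‖ ^ 2 + ‖shift T μ w‖ ^ 2 := by
    rw [h2, norm_add_sq_real, norm_neg, norm_smul, Real.norm_eq_abs, mul_pow]
    simp [inner_sub_right, real_inner_smul_left, real_inner_smul_right, hTw, hkw]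
  have h4 : (c - |μ|) * ‖w‖ ≤ ‖shift T μ w‖ := by
    have := norm_shift_sub_le T 0 μ w
    rw [shift_zero, zero_sub, abs_neg] at this
    have := h w hw
    linarith
  have h5 : m * ‖w‖ ≤ ‖shift T μ w‖ :=
    (mul_le_mul_of_nonneg_right (min_le_right _ _) (norm_nonneg _)).trans h4
  have h6 : m * ‖k‖ ≤ |μ| * ‖k‖ := mul_le_mul_of_nonneg_right (min_le_left _ _) (norm_nonneg _)
  refine le_of_sq_le_sq ?_ (norm_nonneg _) |>.trans le_rfl
  rw [mul_pow, h1, h3]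
  have h7 : (m * ‖w‖) ^ 2 ≤ ‖shift T μ w‖ ^ 2 := by gcongr
  have h8 : (m * ‖k‖) ^ 2 ≤ (|μ| * ‖k‖) ^ 2 := by gcongr
  nlinarith

/-- The span of the eigenvectors with eigenvalue in `[0, ε]`. -/
def nonnegSpace (T : H →L[ℝ] H) (ε : ℝ) : Submodule ℝ H :=
  ⨆ μ ∈ Icc (0 : ℝ) ε, Module.End.eigenspace (T : H →ₗ[ℝ] H) μ

omit [CompleteSpace H] in
theorem nonnegRank_eq (T : H →L[ℝ] H) (ε : ℝ) :
    nonnegRank T ε = Module.finrank ℝ (nonnegSpace T ε) := rfl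

omit [CompleteSpace H] in
theorem IsAdmissible.isFredholm_shift {T : H →L[ℝ] H} {ε : ℝ} (h : IsAdmissible T ε) {μ : ℝ}
    (hμ : μ ∈ Icc (-ε) ε) : (shift T μ).IsFredholm := h.fredholm μ hμ

omit [CompleteSpace H] in
theorem IsAdmissible.isUnit_shift {T : H →L[ℝ] H} {ε : ℝ} (h : IsAdmissible T ε) :
    IsUnit (shift T ε) := by
  have := h.notMem_spectrum
  rw [spectrum.notMem_iff, ← IsUnit.neg_iff, neg_sub] at this
  convert this using 1
  rw [Algebra.algebraMap_eq_smul_one]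
  rfl

/-- Each point of `[0, ε]` has a neighbourhood containing no other eigenvalue, and its own
eigenspace is finite-dimensional by the Fredholm property. Compactness of `[0, ε]` leaves finitely
many such neighbourhoods. -/
theorem finiteDimensional_nonnegSpace {T : H →L[ℝ] H} {ε : ℝ}
    (hs : (T : H →ₗ[ℝ] H).IsSymmetric) (h : IsAdmissible T ε) :
    FiniteDimensional ℝ (nonnegSpace T ε) := by
  refine isCompact_Icc.induction_on (p := fun S ↦ FiniteDimensional ℝ
      ↥(⨆ μ ∈ S, Module.End.eigenspace (T : H →ₗ[ℝ] H) μ)) ?_ ?_ ?_ ?_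
  · change FiniteDimensional ℝ ↥(⨆ μ ∈ (∅ : Set ℝ), Module.End.eigenspace (T : H →ₗ[ℝ] H) μ)
    rw [iSup_emptyset]
    infer_instance
  · intro S S' hSS' hS'
    exact Submodule.finiteDimensional_of_le (biSup_mono hSS')
  · intro S S' hS hS'
    change FiniteDimensional ℝ ↥(⨆ μ ∈ S ∪ S', Module.End.eigenspace (T : H →ₗ[ℝ] H) μ)
    rw [iSup_union]
    exact Submodule.finiteDimensional_sup _ _
  · intro μ hμ
    have hF : (shift T μ).IsFredholm := h.isFredholm_shift ⟨by linarith [hμ.1, h.pos], hμ.2⟩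
    obtain ⟨c, hc, hu⟩ := exists_isUnit_shift (isSymmetric_shift hs μ) hF
    refine ⟨Metric.ball μ c, mem_nhdsWithin_of_mem_nhds (Metric.ball_mem_nhds μ hc), ?_⟩
    have := hF.finite_ker
    refine Submodule.finiteDimensional_of_le (S₂ := (shift T μ : H →ₗ[ℝ] H).ker) ?_
    refine iSup₂_le fun ν hν ↦ ?_
    rw [ker_shift]
    rcases eq_or_ne ν μ with rfl | hne
    · exact le_rfl
    · have h1 := hu (ν - μ) (sub_ne_zero.2 hne) (by simpa [Real.dist_eq] using hν)
      have h2 : shift (shift T μ) (ν - μ) = shift T ν := by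
        ext v
        simp [sub_smul]
      rw [h2] at h1
      obtain ⟨d, hd, h3⟩ := exists_le_norm_of_isUnit h1
      rw [← ker_shift]
      intro v hv
      have hv0 : shift T ν v = 0 := hv
      have h4 := h3 v
      rw [hv0, norm_zero] at h4
      have h5 : ‖v‖ ≤ 0 := by nlinarith [norm_nonneg v]
      rw [norm_le_zero_iff.1 h5]
      exact Submodule.zero_mem _

/-- On the orthogonal complement of `nonnegSpace T ε`, the operators `T - μ` are uniformly bounded
below for `μ` in a neighbourhood of `[0, ε]`. -/
theorem exists_le_norm_shift {T : H →L[ℝ] H} {ε : ℝ} (h : IsAdmissible T ε) :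
    ∃ r > 0, ∀ μ ∈ Icc (-r) ε, ∀ v ∈ (nonnegSpace T ε)ᗮ, r * ‖v‖ ≤ ‖shift T μ v‖ := by
  have key : ∃ r > 0, ∀ μ ∈ Icc 0 ε, ∀ v ∈ (nonnegSpace T ε)ᗮ, r * ‖v‖ ≤ ‖shift T μ v‖ := by
    refine isCompact_Icc.induction_on (p := fun S ↦ ∃ r > 0, ∀ μ ∈ S,
      ∀ v ∈ (nonnegSpace T ε)ᗮ, r * ‖v‖ ≤ ‖shift T μ v‖) ?_ ?_ ?_ ?_
    · exact ⟨1, one_pos, by simp⟩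
    · rintro S S' hSS' ⟨r, hr, h'⟩
      exact ⟨r, hr, fun μ hμ ↦ h' μ (hSS' hμ)⟩
    · rintro S S' ⟨r, hr, h1⟩ ⟨r', hr', h2⟩
      refine ⟨min r r', lt_min hr hr', fun μ hμ v hv ↦ ?_⟩
      rcases hμ with hμ | hμ
      · exact (mul_le_mul_of_nonneg_right (min_le_left _ _) (norm_nonneg v)).trans (h1 μ hμ v hv)
      · exact (mul_le_mul_of_nonneg_right (min_le_right _ _) (norm_nonneg v)).trans (h2 μ hμ v hv)
    · intro μ hμ
      have hF : (shift T μ).IsFredholm := h.isFredholm_shift ⟨by linarith [hμ.1, h.pos], hμ.2⟩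
      obtain ⟨c, hc, hle⟩ := exists_le_norm_of_isFredholm hF
      refine ⟨Metric.ball μ (c / 2), mem_nhdsWithin_of_mem_nhds (Metric.ball_mem_nhds μ (by positivity)),
        c / 2, by positivity, fun ν hν v hv ↦ ?_⟩
      -- Vectors orthogonal to `nonnegSpace T ε` are orthogonal to the kernel of `T - μ`, where the
      -- Fredholm bound `c` applies; moving `μ` by less than `c / 2` costs at most half of it.
      have hker : (shift T μ : H →ₗ[ℝ] H).ker ≤ nonnegSpace T ε := by
        rw [ker_shift]
        exact le_iSup₂_of_le μ hμ le_rfl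
      have h1 := hle v (Submodule.orthogonal_le hker hv)
      have h2 := norm_shift_sub_le T μ ν v
      have h3 : |μ - ν| < c / 2 := by
        rw [abs_sub_comm]
        simpa [Real.dist_eq] using hν
      nlinarith [norm_nonneg v]
  obtain ⟨r, hr, h'⟩ := key
  -- Halving the bound at `0` pays for negative `μ` down to `-(r / 2)`. This margin below `0` is
  -- where the shift by `δ` will live.
  refine ⟨r / 2, by positivity, fun μ hμ v hv ↦ ?_⟩
  rcases le_total 0 μ with h0 | h0
  · have := h' μ ⟨h0, hμ.2⟩ v hv
    nlinarith [norm_nonneg v]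
  · have h1 := h' 0 ⟨le_rfl, h.pos.le⟩ v hv
    have h2 := norm_shift_sub_le T 0 μ v
    have h3 : |0 - μ| ≤ r / 2 := by
      rw [zero_sub, abs_neg, abs_of_nonpos h0]
      linarith [hμ.1]
    nlinarith [norm_nonneg v]

omit [CompleteSpace H] in
theorem map_mem_nonnegSpace (T : H →L[ℝ] H) (ε : ℝ) {v : H} (hv : v ∈ nonnegSpace T ε) :
    T v ∈ nonnegSpace T ε := by
  have h : nonnegSpace T ε ≤ (nonnegSpace T ε).comap (T : H →ₗ[ℝ] H) := by
    refine iSup₂_le fun μ hμ w hw ↦ ?_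
    have h1 : T w = μ • w := Module.End.mem_eigenspace_iff.1 hw
    rw [Submodule.mem_comap, ContinuousLinearMap.coe_coe, h1]
    exact Submodule.smul_mem _ _ ((le_iSup₂_of_le μ hμ le_rfl :
      Module.End.eigenspace (T : H →ₗ[ℝ] H) μ ≤ nonnegSpace T ε) hw)
  exact h hv

omit [CompleteSpace H] in
-- Eigenspaces of a symmetric operator are mutually orthogonal, so on a sum of eigenvectors the form
-- is the sum of the `‖f i‖ ^ 2` weighted by eigenvalues in `[0, ε]`.
theorem opForm_mem_nonnegSpace {T : H →L[ℝ] H} (hs : (T : H →ₗ[ℝ] H).IsSymmetric) (ε : ℝ) {v : H}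
    (hv : v ∈ nonnegSpace T ε) : 0 ≤ opForm T v ∧ opForm T v ≤ ε * ‖v‖ ^ 2 := by
  rw [nonnegSpace, iSup_subtype', Submodule.mem_iSup_iff_exists_finsupp] at hv
  obtain ⟨f, hf, rfl⟩ := hv
  have hT : ∀ i, T (f i) = (i : ℝ) • f i := fun i ↦ Module.End.mem_eigenspace_iff.1 (hf i)
  have ho : ∀ i j, i ≠ j → inner ℝ (f i) (f j) = 0 := by
    intro i j hij
    exact hs.orthogonalFamily_eigenspaces (i := (i : ℝ)) (j := (j : ℝ))
      (fun h ↦ hij (Subtype.ext h)) ⟨f i, hf i⟩ ⟨f j, hf j⟩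
  have hsum : ∀ c : Icc (0 : ℝ) ε → ℝ,
      inner ℝ (∑ i ∈ f.support, c i • f i) (∑ j ∈ f.support, f j)
        = ∑ i ∈ f.support, c i * ‖f i‖ ^ 2 := by
    intro c
    rw [sum_inner]
    refine Finset.sum_congr rfl fun i hi ↦ ?_
    rw [inner_sum, Finset.sum_eq_single i]
    · rw [real_inner_smul_left, real_inner_self_eq_norm_sq]
    · intro j _ hji
      rw [real_inner_smul_left, ho i j hji.symm, mul_zero]
    · exact fun h ↦ absurd hi h
  have h1 : opForm T (f.sum fun _ x ↦ x) = ∑ i ∈ f.support, (i : ℝ) * ‖f i‖ ^ 2 := by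
    rw [opForm_apply, Finsupp.sum, map_sum, ← hsum]
    simp_rw [hT]
  have h2 : ‖f.sum fun _ x ↦ x‖ ^ 2 = ∑ i ∈ f.support, ‖f i‖ ^ 2 := by
    rw [← real_inner_self_eq_norm_sq, Finsupp.sum]
    have := hsum fun _ ↦ 1
    simpa using this
  rw [h1, h2, Finset.mul_sum]
  refine ⟨Finset.sum_nonneg fun i _ ↦ mul_nonneg i.2.1 (by positivity),
    Finset.sum_le_sum fun i _ ↦ mul_le_mul_of_nonneg_right i.2.2 (by positivity)⟩

end Fredholm

/-! ### Galerkin approximation -/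

section Galerkin

variable {V : Type*} [AddCommGroup V] [Module ℝ V]

/-- The filter of large finite-dimensional `J`-invariant subspaces. -/
def fdFilter (J : V →ₗ[ℝ] V) : Filter (Submodule ℝ V) where
  sets := {S | ∃ F : Submodule ℝ V, FiniteDimensional ℝ F ∧
    ∀ E : Submodule ℝ V, FiniteDimensional ℝ E → (∀ v ∈ E, J v ∈ E) → F ≤ E → E ∈ S}
  univ_sets := ⟨⊥, inferInstance, fun _ _ _ _ ↦ trivial⟩
  sets_of_superset := by
    rintro S S' ⟨F, hF, h⟩ hS
    exact ⟨F, hF, fun E h1 h2 h3 ↦ hS (h E h1 h2 h3)⟩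
  inter_sets := by
    rintro S S' ⟨F, hF, h⟩ ⟨F', hF', h'⟩
    exact ⟨F ⊔ F', inferInstance, fun E h1 h2 h3 ↦
      ⟨h E h1 h2 (le_sup_left.trans h3), h' E h1 h2 (le_sup_right.trans h3)⟩⟩

theorem eventually_fdFilter {J : V →ₗ[ℝ] V} {p : Submodule ℝ V → Prop} :
    (∀ᶠ E in fdFilter J, p E) ↔ ∃ F : Submodule ℝ V, FiniteDimensional ℝ F ∧
      ∀ E : Submodule ℝ V, FiniteDimensional ℝ E → (∀ v ∈ E, J v ∈ E) → F ≤ E → p E := Iff.rfl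

theorem eventually_fdFilter_finiteDimensional (J : V →ₗ[ℝ] V) :
    ∀ᶠ E : Submodule ℝ V in fdFilter J, FiniteDimensional ℝ E :=
  ⟨⊥, inferInstance, fun _ h _ _ ↦ h⟩

theorem eventually_fdFilter_invariant (J : V →ₗ[ℝ] V) :
    ∀ᶠ E in fdFilter J, ∀ v ∈ E, J v ∈ E :=
  ⟨⊥, inferInstance, fun _ _ h _ ↦ h⟩

theorem eventually_fdFilter_ge (J : V →ₗ[ℝ] V) (F : Submodule ℝ V) [FiniteDimensional ℝ F] :
    ∀ᶠ E in fdFilter J, F ≤ E :=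
  ⟨F, inferInstance, fun _ _ _ h ↦ h⟩

/-- The smallest invariant subspace that contains `F`, for an involution `J`. -/
theorem sup_map_invariant {J : V →ₗ[ℝ] V} (hJ : ∀ v, J (J v) = v) (F : Submodule ℝ V) :
    ∀ v ∈ F ⊔ F.map J, J v ∈ F ⊔ F.map J := by
  intro v hv
  obtain ⟨x, hx, _, ⟨y, hy, rfl⟩, rfl⟩ := Submodule.mem_sup.1 hv
  rw [map_add, hJ, add_comm]
  exact Submodule.add_mem_sup hy (Submodule.mem_map_of_mem hx)

theorem fdFilter_neBot {J : V →ₗ[ℝ] V} (hJ : ∀ v, J (J v) = v) : (fdFilter J).NeBot := by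
  refine ⟨fun h ↦ ?_⟩
  have : ∀ᶠ _ in fdFilter J, False := by rw [h]; trivial
  obtain ⟨F, hF, h⟩ := eventually_fdFilter.1 this
  exact h (F ⊔ F.map J) inferInstance (sup_map_invariant hJ F) le_sup_left

variable {H : Type*} [NormedAddCommGroup H] [InnerProductSpace ℝ H]

/-- `K` is a norm limit of operators of finite rank. -/
def IsFiniteRankLimit {H' : Type*} [NormedAddCommGroup H'] [InnerProductSpace ℝ H']
    (K : H →L[ℝ] H') : Prop :=
  ∀ η > 0, ∃ K' : H →L[ℝ] H', FiniteDimensional ℝ (K' : H →ₗ[ℝ] H').range ∧ ‖K - K'‖ < η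

/-- The subspace `E` is invariant under `A` up to an error of relative size `η`. -/
def IsAlmostInvariant (A : H →L[ℝ] H) (η : ℝ) (E : Submodule ℝ H) : Prop :=
  ∀ v ∈ E, ∃ u ∈ E, ‖A v - u‖ ≤ η * ‖v‖

theorem IsAlmostInvariant.shift {A : H →L[ℝ] H} {η : ℝ} {E : Submodule ℝ H}
    (h : IsAlmostInvariant A η E) (μ : ℝ) : IsAlmostInvariant (shift A μ) η E := by
  intro v hv
  obtain ⟨u, hu, h1⟩ := h v hv
  refine ⟨u - μ • v, E.sub_mem hu (E.smul_mem _ hv), ?_⟩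
  convert h1 using 2
  simp

/-- If `A v` is orthogonal to `E`, then `‖A v‖² = ⟪A v, A v - u⟫ ≤ ‖A v‖ * η * ‖v‖` for the
approximating `u ∈ E`, which contradicts the lower bound `r > η` unless `v = 0`. Thus the
compression to an almost invariant subspace inherits nondegeneracy. -/
theorem IsAlmostInvariant.eq_zero {A : H →L[ℝ] H} {η r : ℝ} {E : Submodule ℝ H}
    (h : IsAlmostInvariant A η E) (hη : η < r) {v : H} (hv : v ∈ E) (hr : r * ‖v‖ ≤ ‖A v‖)
    (h0 : ∀ w ∈ E, inner ℝ (A v) w = 0) : v = 0 := by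
  obtain ⟨u, hu, h1⟩ := h v hv
  have h2 : ‖A v‖ * ‖A v‖ ≤ ‖A v‖ * (η * ‖v‖) := by
    calc ‖A v‖ * ‖A v‖ = inner ℝ (A v) (A v - u) := by
          rw [inner_sub_right, h0 u hu, sub_zero, real_inner_self_eq_norm_mul_norm]
      _ ≤ ‖A v‖ * ‖A v - u‖ := real_inner_le_norm _ _
      _ ≤ _ := by gcongr
  by_contra hne
  have hpos : 0 < ‖v‖ := norm_pos_iff.2 hne
  rcases (norm_nonneg (A v)).eq_or_lt with h3 | h3
  · have : u = 0 ∨ True := Or.inr trivial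
    rw [← h3] at hr
    have h4 : 0 ≤ η * ‖v‖ := (norm_nonneg _).trans h1
    nlinarith
  · have := le_of_mul_le_mul_left h2 h3
    nlinarith

/-- Up to an error `η`, `A` is `J` plus an operator `K'` of finite rank, and both preserve a
`J`-invariant subspace that contains the range of `K'`. This is why the filter only admits
`J`-invariant subspaces. -/
theorem eventually_isAlmostInvariant {J A : H →L[ℝ] H} (hA : IsFiniteRankLimit (A - J)) {η : ℝ}
    (hη : 0 < η) : ∀ᶠ E in fdFilter (J : H →ₗ[ℝ] H), IsAlmostInvariant A η E := by
  obtain ⟨K', hfd, hK⟩ := hA η hη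
  filter_upwards [eventually_fdFilter_ge (J : H →ₗ[ℝ] H) (K' : H →ₗ[ℝ] H).range,
    eventually_fdFilter_invariant (J : H →ₗ[ℝ] H)] with E hE hJ v hv
  refine ⟨J v + K' v, E.add_mem (hJ v hv) (hE ⟨v, rfl⟩), ?_⟩
  have h1 : A v - (J v + K' v) = (A - J - K') v := by
    simp only [sub_apply]
    abel
  rw [h1]
  exact ((A - J - K').le_opNorm v).trans (by gcongr)

theorem eventually_forall_isAlmostInvariant {J : H →L[ℝ] H} {A : ℝ → H →L[ℝ] H} {a b : ℝ}
    (hA : ∀ s ∈ Icc a b, IsFiniteRankLimit (A s - J)) (hc : ContinuousOn A (Icc a b)) {η : ℝ}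
    (hη : 0 < η) : ∀ᶠ E in fdFilter (J : H →ₗ[ℝ] H), ∀ s ∈ Icc a b, IsAlmostInvariant (A s) η E := by
  refine isCompact_Icc.induction_on (p := fun S ↦ ∀ᶠ E in fdFilter (J : H →ₗ[ℝ] H),
    ∀ s ∈ S, IsAlmostInvariant (A s) η E) ?_ ?_ ?_ ?_
  · simp
  · intro S S' hSS' h
    filter_upwards [h] with E hE s hs using hE s (hSS' hs)
  · intro S S' h h'
    filter_upwards [h, h'] with E hE hE' s hs
    exact hs.elim (hE s) (hE' s)
  · intro s hs
    have h1 : ∀ᶠ x in 𝓝[Icc a b] s, ‖A x - A s‖ < η / 2 :=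
      (tendsto_iff_norm_sub_tendsto_zero.1 (hc s hs)).eventually_lt_const (by positivity)
    refine ⟨_, h1, ?_⟩
    filter_upwards [eventually_isAlmostInvariant (hA s hs) (half_pos hη)] with E hE x hx v hv
    obtain ⟨u, hu, h2⟩ := hE v hv
    refine ⟨u, hu, ?_⟩
    have h3 : A x v - u = (A x - A s) v + (A s v - u) := by
      simp only [sub_apply]
      abel
    rw [h3]
    refine (norm_add_le _ _).trans ?_
    have h4 : ‖(A x - A s) v‖ ≤ η / 2 * ‖v‖ :=
      ((A x - A s).le_opNorm v).trans (mul_le_mul_of_nonneg_right hx.le (norm_nonneg v))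
    linarith

variable [CompleteSpace H]

/-- The eigenvalues in `[0, ε]` are counted by the positive indices of `T + δ` and `T - ε` on a
large subspace. -/
theorem eventually_posIdx_shift {J T : H →L[ℝ] H} {ε : ℝ} (hs : (T : H →ₗ[ℝ] H).IsSymmetric)
    (hT : IsFiniteRankLimit (T - J)) (h : IsAdmissible T ε) :
    ∀ᶠ δ in 𝓝[>] (0 : ℝ), ∀ᶠ E in fdFilter (J : H →ₗ[ℝ] H),
      posIdx (opForm (shift T (-δ))) E = nonnegRank T ε + posIdx (opForm (shift T ε)) E := by
  obtain ⟨r, hr, hle⟩ := exists_le_norm_shift h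
  have := finiteDimensional_nonnegSpace hs h
  set W := nonnegSpace T ε with hW
  filter_upwards [Ioo_mem_nhdsGT hr] with δ hδ
  filter_upwards [eventually_isAlmostInvariant hT (half_pos hr),
    eventually_fdFilter_finiteDimensional _, eventually_fdFilter_ge _ W] with E hE hfd hWE
  -- Since `W` is `T`-invariant, this decomposition of `E` is orthogonal for the forms of all `T -
  -- μ` at once, and positive indices add over the two blocks.
  have hdec : W ⊔ Wᗮ ⊓ E = E := Submodule.sup_orthogonal_inf_of_hasOrthogonalProjection hWE
  have hfd' : FiniteDimensional ℝ ↥(Wᗮ ⊓ E) := Submodule.finiteDimensional_of_le inf_le_right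
  have hd : Disjoint W (Wᗮ ⊓ E) := W.orthogonal_disjoint.mono_right inf_le_left
  have horth : ∀ v ∈ W, ∀ w ∈ Wᗮ, ∀ μ, inner ℝ (shift T μ v) w = 0 := by
    intro v hv w hw μ
    refine hw _ ?_
    rw [shift_apply]
    exact W.sub_mem (map_mem_nonnegSpace T ε hv) (W.smul_mem _ hv)
  have horth' : ∀ v ∈ W, ∀ w ∈ Wᗮ, ∀ μ, inner ℝ (shift T μ w) v = 0 := by
    intro v hv w hw μ
    have h1 := isSymmetric_shift hs μ w v
    rw [ContinuousLinearMap.coe_coe] at h1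
    rw [h1, real_inner_comm]
    exact horth v hv w hw μ
  have hadd : ∀ μ, ∀ v ∈ W, ∀ w ∈ Wᗮ ⊓ E,
      opForm (shift T μ) (v + w) = opForm (shift T μ) v + opForm (shift T μ) w := by
    intro μ v hv w hw
    simp only [opForm_apply, map_add, inner_add_left, inner_add_right, horth v hv w hw.1 μ,
      horth' v hv w hw.1 μ]
    ring
  have hsplit : ∀ μ, posIdx (opForm (shift T μ)) E
      = posIdx (opForm (shift T μ)) W + posIdx (opForm (shift T μ)) (Wᗮ ⊓ E) := by
    intro μ
    rw [← posIdx_sup_of_orthogonal hd (hadd μ), hdec]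
  -- On `W` the spectrum lies in `[0, ε]`: `T + δ` is positive definite there and `T - ε` is
  -- nonpositive.
  have h1 : posIdx (opForm (shift T (-δ))) W = nonnegRank T ε := by
    rw [nonnegRank_eq]
    refine posIdx_eq_finrank fun v hv hne ↦ ?_
    rw [opForm_shift]
    have := (opForm_mem_nonnegSpace hs ε hv).1
    have h2 : 0 < ‖v‖ ^ 2 := by positivity
    nlinarith [hδ.1]
  have h2 : posIdx (opForm (shift T ε)) W = 0 := by
    refine posIdx_eq_zero fun v hv ↦ ?_
    rw [opForm_shift]
    linarith [(opForm_mem_nonnegSpace hs ε hv).2]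
  -- On the other block no `T - s` with `s ∈ [-δ, ε]` degenerates, as `T - s` is bounded below by
  -- `r` there and `E` is invariant up to `r / 2`. Hence the index does not change along `s`.
  have h3 : posIdx (opForm (shift T ε)) (Wᗮ ⊓ E) = posIdx (opForm (shift T (-δ))) (Wᗮ ⊓ E) := by
    refine posIdx_eq_of_path (A := shift T) (by linarith [hδ.1, h.pos])
      (continuous_shift T).continuousOn (fun s _ ↦ isSymmetric_shift hs s) _ fun s hsI v hv h0 ↦ ?_
    refine (hE.shift s).eq_zero (half_lt_self hr) hv.2
      (hle s ⟨by linarith [hsI.1, hδ.2], hsI.2⟩ v hv.1) fun w hw ↦ ?_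
    rw [← hdec] at hw
    obtain ⟨x, hx, y, hy, rfl⟩ := Submodule.mem_sup.1 hw
    rw [inner_add_right, horth' x hx v hv.1, h0 y hy, add_zero]
  rw [hsplit, hsplit, h1, h2, h3]
  ring

omit [CompleteSpace H] in
-- Admissibility keeps `ε` out of the spectrum along the whole interval, so by compactness `T s - ε`
-- is bounded below uniformly in `s`, and its compressions to a large `E` form a path of
-- nondegenerate forms.
theorem eventually_posIdx_eq {J : H →L[ℝ] H} {T : ℝ → H →L[ℝ] H} {a b ε : ℝ} (hab : a ≤ b)
    (hc : ContinuousOn T (Icc a b)) (hs : ∀ s ∈ Icc a b, (T s : H →ₗ[ℝ] H).IsSymmetric)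
    (hT : ∀ s ∈ Icc a b, IsFiniteRankLimit (T s - J))
    (h : ∀ s ∈ Icc a b, IsAdmissible (T s) ε) :
    ∀ᶠ E in fdFilter (J : H →ₗ[ℝ] H),
      posIdx (opForm (shift (T b) ε)) E = posIdx (opForm (shift (T a) ε)) E := by
  have hc' : ContinuousOn (fun s ↦ shift (T s) ε) (Icc a b) := by
    unfold shift
    exact hc.sub continuousOn_const
  have key : ∃ r > 0, ∀ s ∈ Icc a b, ∀ v, r * ‖v‖ ≤ ‖shift (T s) ε v‖ := by
    refine isCompact_Icc.induction_on (p := fun S ↦ ∃ r > 0, ∀ s ∈ S, ∀ v,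
      r * ‖v‖ ≤ ‖shift (T s) ε v‖) ?_ ?_ ?_ ?_
    · exact ⟨1, one_pos, by simp⟩
    · rintro S S' hSS' ⟨r, hr, h'⟩
      exact ⟨r, hr, fun μ hμ ↦ h' μ (hSS' hμ)⟩
    · rintro S S' ⟨r, hr, h1⟩ ⟨r', hr', h2⟩
      refine ⟨min r r', lt_min hr hr', fun μ hμ v ↦ ?_⟩
      rcases hμ with hμ | hμ
      · exact (mul_le_mul_of_nonneg_right (min_le_left _ _) (norm_nonneg v)).trans (h1 μ hμ v)
      · exact (mul_le_mul_of_nonneg_right (min_le_right _ _) (norm_nonneg v)).trans (h2 μ hμ v)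
    · intro s hsI
      obtain ⟨r, hr, hle⟩ := exists_le_norm_of_isUnit (h s hsI).isUnit_shift
      have h1 : ∀ᶠ x in 𝓝[Icc a b] s, ‖shift (T x) ε - shift (T s) ε‖ < r / 2 :=
        (tendsto_iff_norm_sub_tendsto_zero.1 (hc' s hsI)).eventually_lt_const (by positivity)
      refine ⟨_, h1, r / 2, by positivity, fun x hx v ↦ ?_⟩
      have h2 : ‖(shift (T x) ε - shift (T s) ε) v‖ ≤ r / 2 * ‖v‖ :=
        (ContinuousLinearMap.le_opNorm _ v).trans
          (mul_le_mul_of_nonneg_right hx.le (norm_nonneg v))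
      have h3 : ‖shift (T s) ε v‖ ≤ ‖(shift (T x) ε - shift (T s) ε) v‖ + ‖shift (T x) ε v‖ := by
        rw [sub_apply, norm_sub_rev]
        exact norm_le_norm_sub_add _ _
      linarith [hle v]
  obtain ⟨r, hr, hle⟩ := key
  filter_upwards [eventually_forall_isAlmostInvariant hT hc (half_pos hr),
    eventually_fdFilter_finiteDimensional _] with E hE hfd
  refine posIdx_eq_of_path (A := fun s ↦ shift (T s) ε) hab hc'
    (fun s h ↦ isSymmetric_shift (hs s h) ε) E fun s hsI v hv h0 ↦ ?_
  exact ((hE s hsI).shift ε).eq_zero (half_lt_self hr) hv (hle s hsI v) h0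

/-! ### The spectral flow of a path of compact perturbations of a symmetry -/

/-- The spectral flow is the difference of the indices of positivity at the endpoints. -/
theorem IsSpectralFlow.eventually_eq {J : H →L[ℝ] H} {T : ℝ → H →L[ℝ] H} {k : ℤ}
    (h : IsSpectralFlow T k) (hT : ∀ s ∈ Icc (0 : ℝ) 1, IsFiniteRankLimit (T s - J)) :
    ∀ᶠ δ in 𝓝[>] (0 : ℝ), ∀ᶠ E in fdFilter (J : H →ₗ[ℝ] H),
      k = (posIdx (opForm (shift (T 1) (-δ))) E : ℤ) - posIdx (opForm (shift (T 0) (-δ))) E := by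
  obtain ⟨hpath, m, t, ε, hmono, h0, hm, hadm, rfl⟩ := h
  have hsub : ∀ j < m, Icc (t j) (t (j + 1)) ⊆ Icc 0 1 := by
    intro j hj
    rw [← h0, ← hm]
    exact Icc_subset_Icc (hmono (Nat.zero_le j)) (hmono hj)
  have hj : ∀ j ∈ Finset.range m, ∀ᶠ δ in 𝓝[>] (0 : ℝ), ∀ᶠ E in fdFilter (J : H →ₗ[ℝ] H),
      (nonnegRank (T (t (j + 1))) (ε j) : ℤ) - nonnegRank (T (t j)) (ε j)
        = (posIdx (opForm (shift (T (t (j + 1))) (-δ))) E : ℤ)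
          - posIdx (opForm (shift (T (t j)) (-δ))) E := by
    intro j hjm
    rw [Finset.mem_range] at hjm
    have hle : t j ≤ t (j + 1) := hmono (Nat.le_succ j)
    have hl := left_mem_Icc.2 hle
    have hr := right_mem_Icc.2 hle
    -- At both ends of the subinterval the rank of `χ_[0, ε]` is the index of `T + δ` minus that of
    -- `T - ε`. The latter agrees at the two ends and drops out; the former telescopes over the
    -- partition.
    have h1 := eventually_posIdx_shift (hpath.symmetric _ (hsub j hjm hl)) (hT _ (hsub j hjm hl))
      (hadm j hjm _ hl)
    have h2 := eventually_posIdx_shift (hpath.symmetric _ (hsub j hjm hr)) (hT _ (hsub j hjm hr))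
      (hadm j hjm _ hr)
    have h3 := eventually_posIdx_eq hle (hpath.continuousOn.mono (hsub j hjm))
      (fun s hs ↦ hpath.symmetric s (hsub j hjm hs)) (fun s hs ↦ hT s (hsub j hjm hs))
      (hadm j hjm)
    filter_upwards [h1, h2] with δ h1 h2
    filter_upwards [h1, h2, h3] with E h1 h2 h3
    omega
  have hj' := (Filter.eventually_all_finset _).2 hj
  filter_upwards [hj'] with δ hδ
  filter_upwards [(Filter.eventually_all_finset _).2 hδ] with E hE
  rw [Finset.sum_congr rfl hE,
    Finset.sum_range_sub (fun j ↦ (posIdx (opForm (shift (T (t j)) (-δ))) E : ℤ)), h0, hm]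

/-- With `K'` of finite rank and within `1 - |μ|` of `T - J`, the operator `J * (T - μ - K')`
differs from the identity by norm less than `1`. So `T - μ` is invertible up to finite rank, and the
essential spectrum avoids `(-1, 1)`. -/
theorem isFredholm_of_isFiniteRankLimit {J T : H →L[ℝ] H} (hJ : ∀ v, J (J v) = v)
    (hJn : ‖J‖ ≤ 1) (hT : IsFiniteRankLimit (T - J)) {μ : ℝ} (hμ : |μ| < 1) :
    (shift T μ).IsFredholm := by
  obtain ⟨K', hfd, hK⟩ := hT (1 - |μ|) (by linarith)
  have hJJ : J * J = 1 := by ext v; exact hJ v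
  set S : H →L[ℝ] H := shift T μ - K' with hS
  have h1 : J * S = 1 - J * (μ • ContinuousLinearMap.id ℝ H - (T - J - K')) := by
    rw [← hJJ, ← mul_sub]
    congr 1
    rw [hS, shift]
    abel
  have h2 : ‖J * (μ • ContinuousLinearMap.id ℝ H - (T - J - K'))‖ < 1 := by
    have h3 : ‖μ • ContinuousLinearMap.id ℝ H‖ ≤ |μ| := by
      rw [norm_smul, Real.norm_eq_abs]
      exact mul_le_of_le_one_right (abs_nonneg μ) ContinuousLinearMap.norm_id_le
    have h4 := norm_sub_le (μ • ContinuousLinearMap.id ℝ H) (T - J - K')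
    have h5 := norm_mul_le J (μ • ContinuousLinearMap.id ℝ H - (T - J - K'))
    have h6 : ‖J‖ * ‖μ • ContinuousLinearMap.id ℝ H - (T - J - K')‖
        ≤ 1 * ‖μ • ContinuousLinearMap.id ℝ H - (T - J - K')‖ := by gcongr
    linarith
  have hJu : IsUnit J := ⟨⟨J, J, hJJ, hJJ⟩, rfl⟩
  have hSu : IsUnit S := by
    have h7 : IsUnit (J * S) := by
      rw [h1]
      exact isUnit_one_sub_of_norm_lt_one h2
    have h8 : S = J * (J * S) := by rw [← mul_assoc, hJJ, one_mul]
    rw [h8]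
    exact hJu.mul h7
  obtain ⟨u, hu⟩ := hSu
  refine ContinuousLinearMap.IsFredholm.of_isQuasiInverse (v := (↑u⁻¹ : H →L[ℝ] H)) ?_
  have hdiff : shift T μ = (u : H →L[ℝ] H) + K' := by
    rw [hu, hS]
    abel
  have hK' : (K' : H →ₗ[ℝ] H).HasFiniteRange := by
    rw [LinearMap.hasFiniteRange_iff_range, Submodule.fg_iff_finiteDimensional]
    exact hfd
  constructor
  · rw [LinearMap.IsLeftQuasiInverse, LinearMap.FiniteRangeSetoid.equiv_iff_hasFiniteRange]
    have h9 : ((↑u⁻¹ : H →L[ℝ] H) : H →ₗ[ℝ] H) ∘ₗ (shift T μ : H →ₗ[ℝ] H) - LinearMap.id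
        = ((↑u⁻¹ : H →L[ℝ] H) : H →ₗ[ℝ] H) ∘ₗ (K' : H →ₗ[ℝ] H) := by
      ext v
      have : (↑u⁻¹ : H →L[ℝ] H) ((u : H →L[ℝ] H) v) = v := by simp [← mul_apply_eq_comp]
      simp [hdiff, this]
    exact h9 ▸ hK'.comp_left _
  · rw [LinearMap.IsRightQuasiInverse, LinearMap.FiniteRangeSetoid.equiv_iff_hasFiniteRange]
    have h9 : (shift T μ : H →ₗ[ℝ] H) ∘ₗ ((↑u⁻¹ : H →L[ℝ] H) : H →ₗ[ℝ] H) - LinearMap.id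
        = (K' : H →ₗ[ℝ] H) ∘ₗ ((↑u⁻¹ : H →L[ℝ] H) : H →ₗ[ℝ] H) := by
      ext v
      have : (u : H →L[ℝ] H) ((↑u⁻¹ : H →L[ℝ] H) v) = v := by simp [← mul_apply_eq_comp]
      simp [hdiff, this]
    exact h9 ▸ hK'.comp_right _

theorem exists_isAdmissible {J : H →L[ℝ] H} (hJ : ∀ v, J (J v) = v) (hJn : ‖J‖ ≤ 1)
    {T : ℝ → H →L[ℝ] H} {a b : ℝ} (hc : ContinuousOn T (Icc a b))
    (hs : ∀ s ∈ Icc a b, (T s : H →ₗ[ℝ] H).IsSymmetric)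
    (hT : ∀ s ∈ Icc a b, IsFiniteRankLimit (T s - J)) {s : ℝ} (hsI : s ∈ Icc a b) :
    ∃ ε, ∀ᶠ x in 𝓝[Icc a b] s, IsAdmissible (T x) ε := by
  have hF : (T s).IsFredholm := by
    simpa [shift_zero] using isFredholm_of_isFiniteRankLimit hJ hJn (hT s hsI) (μ := 0) (by simp)
  obtain ⟨c, hc0, hu⟩ := exists_isUnit_shift (hs s hsI) hF
  -- The bound `c / 2` keeps `± ε` out of the spectrum, as `0` is the only spectral value within
  -- `c`; the bound `1 / 2` keeps `[-ε, ε]` away from the essential spectrum. The first property is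
  -- open in the operator, the second holds along the whole path.
  set ε := min (c / 2) (1 / 2) with hε
  have hε0 : 0 < ε := lt_min (by positivity) (by norm_num)
  have hεc : ε < c := (min_le_left _ _).trans_lt (by linarith)
  have hε1 : ε < 1 := (min_le_right _ _).trans_lt (by norm_num)
  refine ⟨ε, ?_⟩
  have hopen : ∀ μ : ℝ, IsUnit (shift (T s) μ) →
      ∀ᶠ x in 𝓝[Icc a b] s, IsUnit (shift (T x) μ) := by
    intro μ hμ
    have h1 : ContinuousWithinAt (fun x ↦ shift (T x) μ) (Icc a b) s := by
      unfold shift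
      exact (hc s hsI).sub continuousWithinAt_const
    exact h1 (Units.isOpen.mem_nhds hμ)
  have hspec : ∀ (S : H →L[ℝ] H) (μ : ℝ), IsUnit (shift S μ) → ((μ : ℝ) : ℝ) ∉ spectrum ℝ S := by
    intro S μ h
    rw [spectrum.notMem_iff, ← IsUnit.neg_iff, neg_sub, Algebra.algebraMap_eq_smul_one]
    exact h
  filter_upwards [hopen ε (hu ε hε0.ne' (by rwa [abs_of_pos hε0])),
    hopen (-ε) (hu (-ε) (neg_ne_zero.2 hε0.ne') (by rwa [abs_neg, abs_of_pos hε0])),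
    self_mem_nhdsWithin] with x h1 h2 hx
  refine ⟨hε0, hspec _ _ h1, hspec _ _ h2, fun μ hμ ↦ ?_⟩
  have h3 : |μ| < 1 := abs_lt.2 ⟨by linarith [hμ.1], by linarith [hμ.2]⟩
  exact isFredholm_of_isFiniteRankLimit hJ hJn (hT x hx) h3

/-- Each parameter has a neighbourhood on which one `ε` is admissible; compactness of `[0, 1]`
yields a partition subordinate to this cover. -/
theorem exists_isSpectralFlow {J : H →L[ℝ] H} (hJ : ∀ v, J (J v) = v) (hJn : ‖J‖ ≤ 1)
    {T : ℝ → H →L[ℝ] H} (hc : ContinuousOn T (Icc 0 1))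
    (hs : ∀ s ∈ Icc (0 : ℝ) 1, (T s : H →ₗ[ℝ] H).IsSymmetric)
    (hT : ∀ s ∈ Icc (0 : ℝ) 1, IsFiniteRankLimit (T s - J)) : ∃ k, IsSpectralFlow T k := by
  have hpath : IsFredholmPath T := ⟨hc, hs, fun s h ↦ by
    simpa [shift_zero] using isFredholm_of_isFiniteRankLimit hJ hJn (hT s h) (μ := 0) (by simp)⟩
  have hcov : ∀ s : Icc (0 : ℝ) 1, ∃ ε : ℝ, ∃ U : Set (Icc (0 : ℝ) 1), IsOpen U ∧ s ∈ U ∧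
      ∀ x ∈ U, IsAdmissible (T x) ε := by
    rintro ⟨s, hsI⟩
    obtain ⟨ε, h⟩ := exists_isAdmissible hJ hJn hc hs hT hsI
    rw [nhdsWithin_eq_map_subtype_coe hsI, eventually_map] at h
    obtain ⟨U, hU, hUo, hsU⟩ := eventually_nhds_iff.1 h
    exact ⟨ε, U, hUo, hsU, hU⟩
  choose ε U hUo hsU hU using hcov
  obtain ⟨t, ht0, hmono, ⟨m, hm⟩, hsub⟩ := exists_monotone_Icc_subset_open_cover_Icc
    (zero_le_one' ℝ) hUo fun s _ ↦ mem_iUnion.2 ⟨s, hsU s⟩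
  choose i hi using hsub
  refine ⟨_, hpath, m, fun j ↦ t j, fun j ↦ ε (i j), fun _ _ h ↦ hmono h, ht0, hm m le_rfl, ?_, rfl⟩
  intro j _ s hsI
  exact hU (i j) ⟨s, (t j).2.1.trans hsI.1, hsI.2.trans (t (j + 1)).2.2⟩ (hi j ⟨hsI.1, hsI.2⟩)

end Galerkin

/-! ### Finite rank limits -/

section FiniteRankLimit

variable {H H' H'' : Type*} [NormedAddCommGroup H] [InnerProductSpace ℝ H]
  [NormedAddCommGroup H'] [InnerProductSpace ℝ H'] [NormedAddCommGroup H''] [InnerProductSpace ℝ H'']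

theorem IsFiniteRankLimit.add {K L : H →L[ℝ] H'} (hK : IsFiniteRankLimit K)
    (hL : IsFiniteRankLimit L) : IsFiniteRankLimit (K + L) := by
  intro η hη
  obtain ⟨K', hK', h1⟩ := hK (η / 2) (by positivity)
  obtain ⟨L', hL', h2⟩ := hL (η / 2) (by positivity)
  refine ⟨K' + L', ?_, ?_⟩
  · refine Submodule.finiteDimensional_of_le
      (S₂ := (K' : H →ₗ[ℝ] H').range ⊔ (L' : H →ₗ[ℝ] H').range) ?_
    rintro _ ⟨v, rfl⟩
    exact Submodule.add_mem_sup ⟨v, rfl⟩ ⟨v, rfl⟩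
  · have : K + L - (K' + L') = (K - K') + (L - L') := by abel
    rw [this]
    linarith [norm_add_le (K - K') (L - L')]

theorem IsFiniteRankLimit.comp_left {K : H →L[ℝ] H'} (hK : IsFiniteRankLimit K)
    (A : H' →L[ℝ] H'') : IsFiniteRankLimit (A ∘L K) := by
  intro η hη
  obtain ⟨K', hK', h1⟩ := hK (η / (‖A‖ + 1)) (by positivity)
  refine ⟨A ∘L K', ?_, ?_⟩
  · have h : ((A ∘L K' : H →L[ℝ] H'') : H →ₗ[ℝ] H'').range
        = (K' : H →ₗ[ℝ] H').range.map (A : H' →ₗ[ℝ] H'') := by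
      rw [← LinearMap.range_comp]
      rfl
    rw [h]
    infer_instance
  · rw [← ContinuousLinearMap.comp_sub]
    rw [lt_div_iff₀ (by positivity)] at h1
    have := A.opNorm_comp_le (K - K')
    nlinarith [norm_nonneg (K - K'), norm_nonneg A]

theorem IsFiniteRankLimit.comp_right {K : H' →L[ℝ] H''} (hK : IsFiniteRankLimit K)
    (A : H →L[ℝ] H') : IsFiniteRankLimit (K ∘L A) := by
  intro η hη
  obtain ⟨K', hK', h1⟩ := hK (η / (‖A‖ + 1)) (by positivity)
  refine ⟨K' ∘L A, ?_, ?_⟩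
  · refine Submodule.finiteDimensional_of_le (S₂ := (K' : H' →ₗ[ℝ] H'').range) ?_
    rintro _ ⟨v, rfl⟩
    exact ⟨A v, rfl⟩
  · rw [← ContinuousLinearMap.sub_comp]
    rw [lt_div_iff₀ (by positivity)] at h1
    have := (K - K').opNorm_comp_le A
    nlinarith [norm_nonneg (K - K'), norm_nonneg A]

theorem isFiniteRankLimit_of_finiteDimensional [FiniteDimensional ℝ H'] (K : H →L[ℝ] H') :
    IsFiniteRankLimit K :=
  fun η hη ↦ ⟨K, inferInstance, by simpa⟩

theorem IsFiniteRankLimit.adjoint [CompleteSpace H] [CompleteSpace H'] {K : H →L[ℝ] H'}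
    (hK : IsFiniteRankLimit K) : IsFiniteRankLimit (ContinuousLinearMap.adjoint K) := by
  intro η hη
  obtain ⟨K', hK', h1⟩ := hK η hη
  refine ⟨ContinuousLinearMap.adjoint K', ?_, ?_⟩
  -- The adjoint vanishes on the orthogonal complement of the range of `K'`, so its range is the
  -- image of a finite-dimensional space.
  · refine Submodule.finiteDimensional_of_le (S₂ := (K' : H →ₗ[ℝ] H').range.map
      (ContinuousLinearMap.adjoint K' : H' →ₗ[ℝ] H)) ?_
    rintro _ ⟨v, rfl⟩
    obtain ⟨x, hx, y, hy, rfl⟩ :=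
      Submodule.exists_add_mem_mem_orthogonal (K := (K' : H →ₗ[ℝ] H').range) v
    have hy0 : ContinuousLinearMap.adjoint K' y = 0 := by
      rw [← inner_self_eq_zero (𝕜 := ℝ), ContinuousLinearMap.adjoint_inner_right]
      exact hy _ ⟨_, rfl⟩
    refine ⟨x, hx, ?_⟩
    rw [map_add]
    simp [hy0]
  · rw [← map_sub, LinearIsometryEquiv.norm_map]
    exact h1

/-- An operator that is small on the kernels of operators of finite rank is a finite rank limit. -/
theorem isFiniteRankLimit_of_ker [CompleteSpace H] {K : H →L[ℝ] H'}
    (h : ∀ η > 0, ∃ (m : ℕ) (T : H →L[ℝ] EuclideanSpace ℝ (Fin m)),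
      ∀ v, T v = 0 → ‖K v‖ ≤ η * ‖v‖) : IsFiniteRankLimit K := by
  intro η hη
  obtain ⟨m, T, hT⟩ := h (η / 2) (by positivity)
  set Z := (T : H →ₗ[ℝ] EuclideanSpace ℝ (Fin m)).ker with hZ
  have hZc : IsClosed (Z : Set H) := T.isClosed_ker
  have : CompleteSpace Z := hZc.completeSpace_coe
  have hfd : FiniteDimensional ℝ Zᗮ := by
    refine FiniteDimensional.of_injective
      ((T : H →ₗ[ℝ] EuclideanSpace ℝ (Fin m)).domRestrict Zᗮ) ?_
    rw [← LinearMap.ker_eq_bot, Submodule.eq_bot_iff]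
    rintro ⟨v, hv⟩ hv0
    have h1 : v ∈ Z := hv0
    exact Subtype.ext (inner_self_eq_zero.1 (hv v h1))
  -- `T` is injective on `Zᗮ`, so this composite has finite rank; the remainder is `K` after
  -- projection onto `Z`, where `K` is small.
  refine ⟨K ∘L Zᗮ.starProjection, ?_, ?_⟩
  · refine Submodule.finiteDimensional_of_le (S₂ := Zᗮ.map (K : H →ₗ[ℝ] H')) ?_
    rintro _ ⟨v, rfl⟩
    exact ⟨Zᗮ.starProjection v, Submodule.starProjection_apply_mem _ v, rfl⟩
  · refine lt_of_le_of_lt ?_ (half_lt_self hη)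
    refine ContinuousLinearMap.opNorm_le_bound _ (by positivity) fun v ↦ ?_
    have h2 : (K - K ∘L Zᗮ.starProjection) v = K (Z.starProjection v) := by
      have := Z.starProjection_add_starProjection_orthogonal v
      nth_rewrite 1 [← this]
      simp
    rw [h2]
    refine (hT _ (Submodule.starProjection_apply_mem Z v)).trans ?_
    gcongr
    exact (Z.starProjection.le_opNorm v).trans
      (mul_le_of_le_one_left (norm_nonneg v) Z.starProjection_norm_le)

end FiniteRankLimit

/-! ### Values and multiplication operators on `H¹` -/

section Values

variable {n : ℕ}

/-- The Lebesgue space `L²([0,1], ℝⁿ)`. -/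
abbrev L2I (n : ℕ) : Type :=
  Lp (EuclideanSpace ℝ (Fin n)) 2 (volume.restrict (Icc (0 : ℝ) 1))

theorem L2I.intervalIntegrable (f : L2I n) {s r : ℝ} (hs : s ∈ Icc (0 : ℝ) 1)
    (hr : r ∈ Icc (0 : ℝ) 1) : IntervalIntegrable f volume s r := by
  have h : IntegrableOn f (Icc (0 : ℝ) 1) := (Lp.memLp f).integrable (by norm_num)
  rw [intervalIntegrable_iff]
  exact h.mono_set (uIoc_subset_uIcc.trans (ordConnected_Icc.uIcc_subset hs hr))

theorem ae_uIoc_of_ae {p : ℝ → Prop} (h : ∀ᵐ x ∂volume.restrict (Icc (0 : ℝ) 1), p x) {s r : ℝ}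
    (hs : s ∈ Icc (0 : ℝ) 1) (hr : r ∈ Icc (0 : ℝ) 1) :
    ∀ᵐ x ∂volume.restrict (uIoc s r), p x :=
  ae_restrict_of_ae_restrict_of_subset
    (uIoc_subset_uIcc.trans (ordConnected_Icc.uIcc_subset hs hr)) h

theorem L2I.integral_add (f g : L2I n) {s r : ℝ} (hs : s ∈ Icc (0 : ℝ) 1)
    (hr : r ∈ Icc (0 : ℝ) 1) :
    ∫ x in s..r, (f + g : L2I n) x = (∫ x in s..r, f x) + ∫ x in s..r, g x := by
  rw [← intervalIntegral.integral_add (f.intervalIntegrable hs hr) (g.intervalIntegrable hs hr)]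
  exact intervalIntegral.integral_congr_ae_restrict (ae_uIoc_of_ae (Lp.coeFn_add f g) hs hr)

theorem L2I.integral_smul (c : ℝ) (f : L2I n) {s r : ℝ} (hs : s ∈ Icc (0 : ℝ) 1)
    (hr : r ∈ Icc (0 : ℝ) 1) :
    ∫ x in s..r, (c • f : L2I n) x = c • ∫ x in s..r, f x := by
  rw [← intervalIntegral.integral_smul]
  exact intervalIntegral.integral_congr_ae_restrict (ae_uIoc_of_ae (Lp.coeFn_smul c f) hs hr)

/-- Cauchy–Schwarz: pairing `f` with the indicator of `(s, r]` times the integral `e` itself gives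
`‖e‖² ≤ √(r - s) * ‖e‖ * ‖f‖`. The resulting Hölder estimate for fields in `H¹` is the source of
compactness. -/
theorem L2I.norm_integral_le (f : L2I n) {s r : ℝ} (hs : 0 ≤ s) (hsr : s ≤ r) (hr : r ≤ 1) :
    ‖∫ x in s..r, f x‖ ≤ √(r - s) * ‖f‖ := by
  have h1 : ∫ x in s..r, f x = ∫ x in Ioc s r, f x ∂(volume.restrict (Icc (0 : ℝ) 1)) := by
    rw [intervalIntegral.integral_of_le hsr, Measure.restrict_restrict measurableSet_Ioc,
      inter_eq_left.2]
    exact fun x hx ↦ ⟨hs.trans hx.1.le, hx.2.trans hr⟩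
  set e := ∫ x in s..r, f x with he
  have h2 := L2.inner_indicatorConstLp_eq_inner_setIntegral ℝ (s := Ioc s r) measurableSet_Ioc
    (measure_ne_top (volume.restrict (Icc (0 : ℝ) 1)) _) e f
  rw [← h1, real_inner_self_eq_norm_sq] at h2
  have h3 := real_inner_le_norm (indicatorConstLp 2 (s := Ioc s r) measurableSet_Ioc
    (measure_ne_top (volume.restrict (Icc (0 : ℝ) 1)) _) e) f
  rw [h2, norm_indicatorConstLp (by norm_num) (by norm_num)] at h3
  have h4 : (volume.restrict (Icc (0 : ℝ) 1)).real (Ioc s r) = r - s := by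
    rw [measureReal_restrict_apply measurableSet_Ioc, inter_eq_left.2, Real.volume_real_Ioc_of_le hsr]
    exact fun x hx ↦ ⟨hs.trans hx.1.le, hx.2.trans hr⟩
  have h5 : (r - s) ^ (1 / (2 : ENNReal).toReal) = √(r - s) := by
    rw [Real.sqrt_eq_rpow]
    norm_num
  rw [h4, h5] at h3
  rcases (norm_nonneg e).eq_or_lt with h0 | h0
  · rw [← h0]
    positivity
  · have : ‖e‖ * ‖e‖ ≤ ‖e‖ * (√(r - s) * ‖f‖) := by nlinarith
    exact le_of_mul_le_mul_left this h0

theorem H1.val_sub_val (V : H1 n) {s r : ℝ} (hs : s ∈ Icc (0 : ℝ) 1) (hr : r ∈ Icc (0 : ℝ) 1) :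
    V.val r - V.val s = ∫ x in s..r, V.snd x := by
  have h0 : (0 : ℝ) ∈ Icc (0 : ℝ) 1 := left_mem_Icc.2 zero_le_one
  have := intervalIntegral.integral_add_adjacent_intervals (L2I.intervalIntegrable V.snd h0 hs)
    (L2I.intervalIntegrable V.snd hs hr)
  rw [H1.val, H1.val, H1.der, ← this]
  abel

theorem H1.norm_snd_le (V : H1 n) : ‖V.snd‖ ≤ ‖V‖ := by
  have := WithLp.prod_norm_sq_eq_of_L2 V
  refine le_of_sq_le_sq ?_ (norm_nonneg _)
  nlinarith [sq_nonneg ‖V.fst‖]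

theorem H1.norm_fst_le (V : H1 n) : ‖V.fst‖ ≤ ‖V‖ := by
  have := WithLp.prod_norm_sq_eq_of_L2 V
  refine le_of_sq_le_sq ?_ (norm_nonneg _)
  nlinarith [sq_nonneg ‖V.snd‖]

theorem H1.norm_val_sub_le (V : H1 n) {s r : ℝ} (hs : 0 ≤ s) (hsr : s ≤ r) (hr : r ≤ 1) :
    ‖V.val r - V.val s‖ ≤ √(r - s) * ‖V‖ := by
  rw [V.val_sub_val ⟨hs, hsr.trans hr⟩ ⟨hs.trans hsr, hr⟩]
  refine (L2I.norm_integral_le V.snd hs hsr hr).trans ?_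
  gcongr
  exact V.norm_snd_le

theorem H1.norm_val_le (V : H1 n) {r : ℝ} (hr : r ∈ Icc (0 : ℝ) 1) : ‖V.val r‖ ≤ 2 * ‖V‖ := by
  have h1 := V.norm_val_sub_le le_rfl hr.1 hr.2
  have h2 : √(r - 0) ≤ 1 := Real.sqrt_le_one.2 (by linarith [hr.2])
  have h3 := V.norm_fst_le
  rw [H1.val_zero] at h1
  have h4 := norm_le_norm_sub_add (V.val r) V.fst
  nlinarith [norm_nonneg V]

theorem H1.val_add (V W : H1 n) {r : ℝ} (hr : r ∈ Icc (0 : ℝ) 1) :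
    (V + W).val r = V.val r + W.val r := by
  have := L2I.integral_add V.snd W.snd (left_mem_Icc.2 zero_le_one) hr
  simp only [H1.val, H1.der, WithLp.add_fst, WithLp.add_snd, this]
  abel

theorem H1.val_smul (c : ℝ) (V : H1 n) {r : ℝ} (hr : r ∈ Icc (0 : ℝ) 1) :
    (c • V).val r = c • V.val r := by
  have := L2I.integral_smul c V.snd (left_mem_Icc.2 zero_le_one) hr
  simp only [H1.val, H1.der, WithLp.smul_fst, WithLp.smul_snd, this, smul_add]

theorem H1.continuousOn_val (V : H1 n) : ContinuousOn V.val (Icc 0 1) := by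
  have h : IntegrableOn V.der (uIcc (0 : ℝ) 1) := by
    rw [uIcc_of_le zero_le_one]
    exact (Lp.memLp V.snd).integrable (by norm_num)
  have := intervalIntegral.continuousOn_primitive_interval h
  rw [uIcc_of_le zero_le_one] at this
  exact continuousOn_const.add this

/-- Evaluation at a point of `[0,1]`. -/
def H1.valCLM (r : Icc (0 : ℝ) 1) : H1 n →L[ℝ] EuclideanSpace ℝ (Fin n) :=
  LinearMap.mkContinuous
    { toFun := fun V ↦ V.val r
      map_add' := fun V W ↦ V.val_add W r.2
      map_smul' := fun c V ↦ V.val_smul c r.2 } 2 fun V ↦ V.norm_val_le r.2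

theorem isClosed_H1per : IsClosed (H1per n : Set (H1 n)) := by
  have : (H1per n : Set (H1 n)) = {V | H1.valCLM ⟨0, left_mem_Icc.2 zero_le_one⟩ V
      = H1.valCLM ⟨1, right_mem_Icc.2 zero_le_one⟩ V} := rfl
  rw [this]
  exact isClosed_eq (ContinuousLinearMap.continuous _) (ContinuousLinearMap.continuous _)

instance : CompleteSpace (H1per n) := isClosed_H1per.completeSpace_coe

/-- Continuous endomorphism valued functions on `[0,1]`. -/
abbrev EndPath (n : ℕ) : Type :=
  C(Icc (0 : ℝ) 1, EuclideanSpace ℝ (Fin n) →L[ℝ] EuclideanSpace ℝ (Fin n))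

/-- The function `r ↦ a r (V r)`. -/
def mulVal (a : EndPath n) (V : H1 n) (r : ℝ) : EuclideanSpace ℝ (Fin n) :=
  a (projIcc 0 1 zero_le_one r) (V.val r)

theorem norm_mulVal_le (a : EndPath n) (V : H1 n) {r : ℝ} (hr : r ∈ Icc (0 : ℝ) 1) :
    ‖mulVal a V r‖ ≤ ‖a‖ * (2 * ‖V‖) :=
  (ContinuousLinearMap.le_opNorm _ _).trans
    (mul_le_mul (a.norm_coe_le_norm _) (V.norm_val_le hr) (norm_nonneg _) (by positivity))

theorem memLp_mulVal (a : EndPath n) (V : H1 n) :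
    MemLp (mulVal a V) 2 (volume.restrict (Icc (0 : ℝ) 1)) := by
  refine MemLp.of_bound (C := ‖a‖ * (2 * ‖V‖)) ?_ ?_
  · refine ContinuousOn.aestronglyMeasurable ?_ measurableSet_Icc
    exact (a.continuous.comp continuous_projIcc).continuousOn.clm_apply V.continuousOn_val
  · filter_upwards [ae_restrict_mem measurableSet_Icc] with r hr
    exact norm_mulVal_le a V hr

theorem norm_le_of_forall_Icc {f : L2I n} {g : ℝ → EuclideanSpace ℝ (Fin n)} {C : ℝ} (hC : 0 ≤ C)
    (hfg : f =ᵐ[volume.restrict (Icc (0 : ℝ) 1)] g) (h : ∀ r ∈ Icc (0 : ℝ) 1, ‖g r‖ ≤ C) :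
    ‖f‖ ≤ C := by
  have h1 : ∀ᵐ x ∂volume.restrict (Icc (0 : ℝ) 1), ‖f x‖ ≤ C := by
    filter_upwards [hfg, ae_restrict_mem measurableSet_Icc] with x hx hx1
    rw [hx]
    exact h x hx1
  have h2 := Lp.norm_le_of_ae_bound hC h1
  have h3 : measureUnivNNReal (volume.restrict (Icc (0 : ℝ) 1)) = 1 := by
    simp [measureUnivNNReal]
  simpa [h3] using h2

/-- Multiplication by `a` as an operator from `H¹` to `L²`. -/
def mulCLM : EndPath n →L[ℝ] H1 n →L[ℝ] L2I n :=
  LinearMap.mkContinuous₂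
    (LinearMap.mk₂ ℝ (fun a V ↦ (memLp_mulVal a V).toLp (mulVal a V))
      (fun a b V ↦ by
        rw [← MemLp.toLp_add]
        exact MemLp.toLp_congr _ _ (ae_of_all _ fun r ↦ rfl))
      (fun c a V ↦ by
        rw [← MemLp.toLp_const_smul]
        exact MemLp.toLp_congr _ _ (ae_of_all _ fun r ↦ rfl))
      (fun a V W ↦ by
        rw [← MemLp.toLp_add]
        refine MemLp.toLp_congr _ _ ?_
        filter_upwards [ae_restrict_mem measurableSet_Icc] with r hr
        simp [mulVal, V.val_add W hr])
      (fun c a V ↦ by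
        rw [← MemLp.toLp_const_smul]
        refine MemLp.toLp_congr _ _ ?_
        filter_upwards [ae_restrict_mem measurableSet_Icc] with r hr
        simp [mulVal, V.val_smul c hr])) 2 (fun a V ↦ by
      rw [LinearMap.mk₂_apply]
      refine norm_le_of_forall_Icc (by positivity) (MemLp.coeFn_toLp _) fun r hr ↦ ?_
      linarith [norm_mulVal_le a V hr])

theorem coeFn_mulCLM (a : EndPath n) (V : H1 n) :
    mulCLM a V =ᵐ[volume.restrict (Icc (0 : ℝ) 1)] mulVal a V :=
  MemLp.coeFn_toLp (memLp_mulVal a V)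

/-- The operator of multiplication from `H¹` to `L²` is a limit of operators of finite rank. -/
theorem isFiniteRankLimit_mulCLM (a : EndPath n) : IsFiniteRankLimit (mulCLM a) := by
  refine isFiniteRankLimit_of_ker fun η hη ↦ ?_
  -- A field vanishing at all grid points `k / m` is bounded by `√(1 / m) * ‖V‖`, because every `r`
  -- lies within `1 / m` of the grid point to its left. This `m` makes `‖a‖ * √(1 / m) ≤ η`, and
  -- evaluation on the grid is the finite rank operator.
  obtain ⟨m, hm⟩ := exists_nat_gt ((‖a‖ / η) ^ 2)
  have hm0 : 0 < (m : ℝ) := (sq_nonneg _).trans_lt hm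
  have hpt : ∀ k : Fin (m + 1), ((k : ℕ) : ℝ) / m ∈ Icc (0 : ℝ) 1 := by
    intro k
    refine ⟨by positivity, ?_⟩
    rw [div_le_one hm0]
    exact_mod_cast Nat.lt_succ_iff.1 k.2
  let T₀ : H1 n →L[ℝ] (Fin (m + 1) → EuclideanSpace ℝ (Fin n)) :=
    ContinuousLinearMap.pi fun k ↦ H1.valCLM ⟨((k : ℕ) : ℝ) / m, hpt k⟩
  let e := toEuclidean (E := Fin (m + 1) → EuclideanSpace ℝ (Fin n))
  refine ⟨_, e.toContinuousLinearMap ∘L T₀, fun V hV ↦ ?_⟩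
  have hV0 : T₀ V = 0 := by
    have : e (T₀ V) = 0 := hV
    simpa using this
  have hval : ∀ r ∈ Icc (0 : ℝ) 1, ‖V.val r‖ ≤ √(1 / m) * ‖V‖ := by
    intro r hr
    have hk : ⌊m * r⌋₊ < m + 1 := by
      rw [Nat.lt_succ_iff]
      refine Nat.floor_le_of_le ?_
      nlinarith [hr.2]
    have h1 : V.val (((⌊m * r⌋₊ : ℕ) : ℝ) / m) = 0 := congrFun hV0 ⟨⌊m * r⌋₊, hk⟩
    have h2 : ((⌊m * r⌋₊ : ℕ) : ℝ) / m ≤ r := by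
      rw [div_le_iff₀ hm0]
      linarith [Nat.floor_le (mul_nonneg hm0.le hr.1)]
    have h3 := V.norm_val_sub_le (by positivity) h2 hr.2
    rw [h1, sub_zero] at h3
    refine h3.trans ?_
    gcongr
    rw [sub_le_iff_le_add, ← add_div, le_div_iff₀ hm0]
    have := (Nat.lt_floor_add_one (m * r)).le
    linarith
  have h4 : ‖a‖ * √(1 / m) ≤ η := by
    rw [← Real.sqrt_sq (norm_nonneg a), ← Real.sqrt_mul (by positivity), Real.sqrt_le_left hη.le]
    rw [div_pow, div_lt_iff₀ (by positivity)] at hm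
    rw [mul_one_div, div_le_iff₀ hm0]
    linarith
  refine norm_le_of_forall_Icc (by positivity) (coeFn_mulCLM a V) fun r hr ↦ ?_
  calc ‖mulVal a V r‖ ≤ ‖a‖ * (√(1 / m) * ‖V‖) :=
        (ContinuousLinearMap.le_opNorm _ _).trans
          (mul_le_mul (a.norm_coe_le_norm _) (hval r hr) (norm_nonneg _) (by positivity))
    _ = (‖a‖ * √(1 / m)) * ‖V‖ := by ring
    _ ≤ η * ‖V‖ := by gcongr

end Values

/-! ### The operators that represent the index forms -/

section IndexOp

variable {n : ℕ}

/-- The diagonal operator with entries `ϵ`. -/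
def signMap (ϵ : Fin n → ℝ) : EuclideanSpace ℝ (Fin n) →L[ℝ] EuclideanSpace ℝ (Fin n) :=
  LinearMap.toContinuousLinearMap
    { toFun := fun v ↦ WithLp.toLp 2 fun i ↦ ϵ i * v i
      map_add' := fun v w ↦ by ext i; simp [mul_add]
      map_smul' := fun c v ↦ by ext i; simp; ring }

@[simp] theorem signMap_apply (ϵ : Fin n → ℝ) (v : EuclideanSpace ℝ (Fin n)) (i : Fin n) :
    signMap ϵ v i = ϵ i * v i := rfl

theorem frameForm_eq (ϵ : Fin n → ℝ) (v w : EuclideanSpace ℝ (Fin n)) :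
    frameForm ϵ v w = inner ℝ (signMap ϵ v) w := by
  simp only [frameForm, PiLp.inner_apply, signMap_apply, RCLike.inner_apply, conj_trivial]
  exact Finset.sum_congr rfl fun i _ ↦ by ring

theorem inner_signMap (ϵ : Fin n → ℝ) (v w : EuclideanSpace ℝ (Fin n)) :
    inner ℝ (signMap ϵ v) w = inner ℝ v (signMap ϵ w) := by
  rw [real_inner_comm (signMap ϵ w) v, ← frameForm_eq, ← frameForm_eq, frameForm, frameForm]
  exact Finset.sum_congr rfl fun i _ ↦ by ring

theorem signMap_signMap {ϵ : Fin n → ℝ} (hϵ : ∀ i, ϵ i = 1 ∨ ϵ i = -1)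
    (v : EuclideanSpace ℝ (Fin n)) : signMap ϵ (signMap ϵ v) = v := by
  ext i
  rcases hϵ i with h | h <;> simp [h]

theorem norm_signMap {ϵ : Fin n → ℝ} (hϵ : ∀ i, ϵ i = 1 ∨ ϵ i = -1)
    (v : EuclideanSpace ℝ (Fin n)) : ‖signMap ϵ v‖ = ‖v‖ := by
  have : ‖signMap ϵ v‖ ^ 2 = ‖v‖ ^ 2 := by
    rw [← real_inner_self_eq_norm_sq, inner_signMap, signMap_signMap hϵ, real_inner_self_eq_norm_sq]
  exact (sq_eq_sq₀ (norm_nonneg _) (norm_nonneg _)).1 this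

/-- The diagonal operator with entries `ϵ` on `L²`. -/
def signL2 (ϵ : Fin n → ℝ) : L2I n →L[ℝ] L2I n :=
  ContinuousLinearMap.compLpL 2 (volume.restrict (Icc (0 : ℝ) 1)) (signMap ϵ)

theorem coeFn_signL2 (ϵ : Fin n → ℝ) (f : L2I n) :
    signL2 ϵ f =ᵐ[volume.restrict (Icc (0 : ℝ) 1)] fun r ↦ signMap ϵ (f r) :=
  ContinuousLinearMap.coeFn_compLpL _ _

theorem inner_signL2 (ϵ : Fin n → ℝ) (f g : L2I n) :
    inner ℝ (signL2 ϵ f) g = inner ℝ f (signL2 ϵ g) := by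
  rw [L2.inner_def, L2.inner_def]
  refine integral_congr_ae ?_
  filter_upwards [coeFn_signL2 ϵ f, coeFn_signL2 ϵ g] with r h1 h2
  rw [h1, h2, inner_signMap]

theorem signL2_signL2 {ϵ : Fin n → ℝ} (hϵ : ∀ i, ϵ i = 1 ∨ ϵ i = -1) (f : L2I n) :
    signL2 ϵ (signL2 ϵ f) = f := by
  refine Lp.ext ?_
  filter_upwards [coeFn_signL2 ϵ f, coeFn_signL2 ϵ (signL2 ϵ f)] with r h1 h2
  rw [h2, h1, signMap_signMap hϵ]

theorem norm_signL2 {ϵ : Fin n → ℝ} (hϵ : ∀ i, ϵ i = 1 ∨ ϵ i = -1) (f : L2I n) :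
    ‖signL2 ϵ f‖ = ‖f‖ := by
  have : ‖signL2 ϵ f‖ ^ 2 = ‖f‖ ^ 2 := by
    rw [← real_inner_self_eq_norm_sq, inner_signL2, signL2_signL2 hϵ, real_inner_self_eq_norm_sq]
  exact (sq_eq_sq₀ (norm_nonneg _) (norm_nonneg _)).1 this

theorem integral_signL2 (ϵ : Fin n → ℝ) (f : L2I n) {s r : ℝ} (hs : s ∈ Icc (0 : ℝ) 1)
    (hr : r ∈ Icc (0 : ℝ) 1) : ∫ x in s..r, signL2 ϵ f x = signMap ϵ (∫ x in s..r, f x) := by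
  rw [← ContinuousLinearMap.intervalIntegral_comp_comm _ (f.intervalIntegrable hs hr)]
  exact intervalIntegral.integral_congr_ae_restrict (ae_uIoc_of_ae (coeFn_signL2 ϵ f) hs hr)

/-- Componentwise multiplication of a field by the signs `ϵ`. -/
def signH1 (ϵ : Fin n → ℝ) : H1 n →L[ℝ] H1 n :=
  (WithLp.prodContinuousLinearEquiv 2 ℝ _ _).symm.toContinuousLinearMap ∘L
    ((signMap ϵ).prodMap (signL2 ϵ)) ∘L
      (WithLp.prodContinuousLinearEquiv 2 ℝ _ _).toContinuousLinearMap

theorem signH1_fst (ϵ : Fin n → ℝ) (V : H1 n) : (signH1 ϵ V).fst = signMap ϵ V.fst := rfl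
theorem signH1_snd (ϵ : Fin n → ℝ) (V : H1 n) : (signH1 ϵ V).snd = signL2 ϵ V.snd := rfl

theorem H1.ext {V W : H1 n} (h1 : V.fst = W.fst) (h2 : V.snd = W.snd) : V = W := by
  have : V.ofLp = W.ofLp := Prod.ext h1 h2
  exact WithLp.ofLp_injective 2 this

theorem signH1_mem (ϵ : Fin n → ℝ) {V : H1 n} (hV : V ∈ H1per n) : signH1 ϵ V ∈ H1per n := by
  have h0 : (0 : ℝ) ∈ Icc (0 : ℝ) 1 := left_mem_Icc.2 zero_le_one
  have h1 : (1 : ℝ) ∈ Icc (0 : ℝ) 1 := right_mem_Icc.2 zero_le_one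
  have hV : V.val 0 = V.val 1 := hV
  rw [H1.val_zero, H1.val, H1.der] at hV
  change H1.val _ 0 = H1.val _ 1
  rw [H1.val_zero, H1.val, H1.der, signH1_fst, signH1_snd, integral_signL2 ϵ _ h0 h1, ← map_add,
    ← hV]

/-- Componentwise multiplication of a periodic field by the signs `ϵ`. -/
def signPer (ϵ : Fin n → ℝ) : H1per n →L[ℝ] H1per n :=
  (signH1 ϵ ∘L (H1per n).subtypeL).codRestrict (H1per n) fun V ↦ signH1_mem ϵ V.2

theorem signPer_coe (ϵ : Fin n → ℝ) (V : H1per n) : (signPer ϵ V : H1 n) = signH1 ϵ V := rfl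

variable {X : Type*} [NormedAddCommGroup X] [InnerProductSpace ℝ X] (ι : X →ₗᵢ[ℝ] H1 n)
  (J : X →L[ℝ] X)

/-- The initial value of a field. -/
def startCLM : X →L[ℝ] EuclideanSpace ℝ (Fin n) :=
  WithLp.fstL 2 ℝ _ _ ∘L ι.toContinuousLinearMap

/-- The derivative of a field. -/
def derCLM : X →L[ℝ] L2I n := WithLp.sndL 2 ℝ _ _ ∘L ι.toContinuousLinearMap

theorem inner_eq_H1 (V W : X) :
    inner ℝ V W = inner ℝ (ι V).fst (ι W).fst + inner ℝ (ι V).snd (ι W).snd := by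
  rw [← ι.inner_map_map]
  exact WithLp.prod_inner_apply _ _

section Sign

variable {ι J} {ϵ : Fin n → ℝ} (hJ : ∀ V, ι (J V) = signH1 ϵ (ι V))

include hJ

theorem sign_sign (hϵ : ∀ i, ϵ i = 1 ∨ ϵ i = -1) (V : X) : J (J V) = V := by
  apply ι.injective
  rw [hJ, hJ]
  refine H1.ext ?_ ?_
  · rw [signH1_fst, signH1_fst, signMap_signMap hϵ]
  · rw [signH1_snd, signH1_snd, signL2_signL2 hϵ]

theorem norm_sign_le (hϵ : ∀ i, ϵ i = 1 ∨ ϵ i = -1) : ‖J‖ ≤ 1 := by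
  refine ContinuousLinearMap.opNorm_le_bound _ zero_le_one fun V ↦ ?_
  rw [one_mul, ← ι.norm_map, ← ι.norm_map V, hJ]
  refine le_of_eq ((sq_eq_sq₀ (norm_nonneg _) (norm_nonneg _)).1 ?_)
  have h1 := WithLp.prod_norm_sq_eq_of_L2 (signH1 ϵ (ι V))
  have h2 := WithLp.prod_norm_sq_eq_of_L2 (ι V)
  rw [signH1_fst, signH1_snd, norm_signMap hϵ, norm_signL2 hϵ, ← h2] at h1
  exact h1

end Sign

/-- The path `t ↦ (r ↦ c t • a (t r))` of endomorphism valued functions. -/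
def scaledPath (a : ℝ → EuclideanSpace ℝ (Fin n) →L[ℝ] EuclideanSpace ℝ (Fin n))
    (ha : Continuous a) (c : ℝ → ℝ) (hc : Continuous c) : C(ℝ, EndPath n) :=
  ContinuousMap.curry ⟨fun p : ℝ × Icc (0 : ℝ) 1 ↦ c p.1 • a (p.1 * p.2), by fun_prop⟩

theorem mulVal_scaledPath (a : ℝ → EuclideanSpace ℝ (Fin n) →L[ℝ] EuclideanSpace ℝ (Fin n))
    (ha : Continuous a) (c : ℝ → ℝ) (hc : Continuous c) (t : ℝ) (V : H1 n) {r : ℝ}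
    (hr : r ∈ Icc (0 : ℝ) 1) : mulVal (scaledPath a ha c hc t) V r = c t • a (t * r) (V.val r) := by
  rw [mulVal, projIcc_of_mem _ hr]
  rfl

variable (Γ R : ℝ → EuclideanSpace ℝ (Fin n) →L[ℝ] EuclideanSpace ℝ (Fin n))

/-- The value of the integrand of the index form, for the values `v, w` and derivatives `v', w'`. -/
def indexDensity (ϵ : Fin n → ℝ) (t r : ℝ) (v v' w w' : EuclideanSpace ℝ (Fin n)) : ℝ :=
  frameForm ϵ v' w' + t * frameForm ϵ (Γ (t * r) v) w' + t * frameForm ϵ v' (Γ (t * r) w)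
    + t ^ 2 * frameForm ϵ (Γ (t * r) v) (Γ (t * r) w) + t ^ 2 * frameForm ϵ (R (t * r) v) w

/-- The index form for given continuous coefficients `Γ`, `R`. -/
def coeffForm (ϵ : Fin n → ℝ) (t : ℝ) (V W : H1 n) : ℝ :=
  ∫ r in (0 : ℝ)..1, indexDensity Γ R ϵ t r (V.val r) (V.der r) (W.val r) (W.der r)

variable [CompleteSpace X]

variable {Γ R} {ϵ : Fin n → ℝ} (hΓ : Continuous Γ) (hR : Continuous R)

/-- The covariant derivative `V ↦ V' + t Γ_{tr} V`. -/
def covOp (t : ℝ) : X →L[ℝ] L2I n :=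
  derCLM ι + mulCLM (scaledPath Γ hΓ (fun t ↦ t) continuous_id t) ∘L ι.toContinuousLinearMap

/-- The curvature term `V ↦ t² G R_{tr} V`. -/
def curvOp (ϵ : Fin n → ℝ) (t : ℝ) : X →L[ℝ] L2I n :=
  mulCLM (scaledPath (fun s ↦ signMap ϵ ∘L R s) (by fun_prop) (fun t ↦ t ^ 2) (by fun_prop) t)
    ∘L ι.toContinuousLinearMap

/-- The inclusion of `H¹` into `L²`. -/
def inclL2 : X →L[ℝ] L2I n :=
  mulCLM (ContinuousMap.const _ (ContinuousLinearMap.id ℝ _)) ∘L ι.toContinuousLinearMap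

/-- The operator that represents the index form. -/
def indexOp (ϵ : Fin n → ℝ) (t : ℝ) : X →L[ℝ] X :=
  ContinuousLinearMap.adjoint (covOp ι hΓ t) ∘L signL2 ϵ ∘L covOp ι hΓ t
    + ContinuousLinearMap.adjoint (inclL2 ι) ∘L curvOp ι hR ϵ t

theorem inner_indexOp (t : ℝ) (V W : X) :
    inner ℝ (indexOp ι hΓ hR ϵ t V) W = inner ℝ (signL2 ϵ (covOp ι hΓ t V)) (covOp ι hΓ t W)
      + inner ℝ (curvOp ι hR ϵ t V) (inclL2 ι W) := by
  simp only [indexOp, add_apply, ContinuousLinearMap.comp_apply, inner_add_left,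
    ContinuousLinearMap.adjoint_inner_left]

omit [CompleteSpace X] in
theorem coeFn_covOp (t : ℝ) (V : X) :
    covOp ι hΓ t V =ᵐ[volume.restrict (Icc (0 : ℝ) 1)]
      fun r ↦ (ι V).der r + t • Γ (t * r) ((ι V).val r) := by
  have h1 := Lp.coeFn_add (derCLM ι V)
    (mulCLM (scaledPath Γ hΓ (fun t ↦ t) continuous_id t) (ι V))
  filter_upwards [h1, coeFn_mulCLM (scaledPath Γ hΓ (fun t ↦ t) continuous_id t) (ι V),
    ae_restrict_mem measurableSet_Icc] with r h1 h2 hr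
  rw [mulVal_scaledPath _ _ _ _ _ _ hr] at h2
  have h3 : covOp ι hΓ t V r = _ := h1
  rw [h3, Pi.add_apply, h2]
  rfl

omit [CompleteSpace X] in
theorem coeFn_curvOp (ϵ : Fin n → ℝ) (t : ℝ) (V : X) :
    curvOp ι hR ϵ t V =ᵐ[volume.restrict (Icc (0 : ℝ) 1)]
      fun r ↦ t ^ 2 • signMap ϵ (R (t * r) ((ι V).val r)) := by
  filter_upwards [coeFn_mulCLM (scaledPath (fun s ↦ signMap ϵ ∘L R s) (by fun_prop)
    (fun t ↦ t ^ 2) (by fun_prop) t) (ι V), ae_restrict_mem measurableSet_Icc] with r h hr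
  rw [mulVal_scaledPath _ _ _ _ _ _ hr] at h
  exact h

omit [CompleteSpace X] in
theorem coeFn_inclL2 (V : X) :
    inclL2 ι V =ᵐ[volume.restrict (Icc (0 : ℝ) 1)] (ι V).val :=
  coeFn_mulCLM (ContinuousMap.const _ (ContinuousLinearMap.id ℝ _)) (ι V)

omit [CompleteSpace X] in
include hΓ hR in
-- The first four terms of the density are the expansion of `G(V' + tΓV, W' + tΓW)`. Hence the form
-- is represented by `D* G D` plus a curvature term of order zero, with `D` the covariant
-- derivative.
theorem indexDensity_ae_eq (t : ℝ) (V W : X) :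
    (fun r ↦ indexDensity Γ R ϵ t r ((ι V).val r) ((ι V).der r) ((ι W).val r) ((ι W).der r))
      =ᵐ[volume.restrict (Icc (0 : ℝ) 1)] fun r ↦
        inner ℝ (signL2 ϵ (covOp ι hΓ t V) r) (covOp ι hΓ t W r)
          + inner ℝ (curvOp ι hR ϵ t V r) (inclL2 ι W r) := by
  filter_upwards [coeFn_signL2 ϵ (covOp ι hΓ t V), coeFn_covOp ι hΓ t V, coeFn_covOp ι hΓ t W,
    coeFn_curvOp ι hR ϵ t V, coeFn_inclL2 ι W] with r h1 h2 h3 h4 h5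
  rw [h1, h2, h3, h4, h5]
  simp only [indexDensity, frameForm_eq, map_add, map_smul, inner_add_left, inner_add_right,
    real_inner_smul_left, real_inner_smul_right]
  ring

omit [CompleteSpace X] in
include hΓ hR in
theorem integrable_indexDensity (t : ℝ) (V W : X) :
    Integrable (fun r ↦ indexDensity Γ R ϵ t r ((ι V).val r) ((ι V).der r) ((ι W).val r) ((ι W).der r))
      (volume.restrict (Icc (0 : ℝ) 1)) :=
  ((L2.integrable_inner _ _).add (L2.integrable_inner _ _)).congr
    (indexDensity_ae_eq ι hΓ hR t V W).symm

theorem inner_indexOp_eq (t : ℝ) (V W : X) :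
    inner ℝ (indexOp ι hΓ hR ϵ t V) W = coeffForm Γ R ϵ t (ι V) (ι W) := by
  rw [inner_indexOp, L2.inner_def, L2.inner_def,
    ← integral_add (L2.integrable_inner _ _) (L2.integrable_inner _ _), coeffForm,
    intervalIntegral.integral_of_le zero_le_one, ← integral_Icc_eq_integral_Ioc]
  exact (integral_congr_ae (indexDensity_ae_eq ι hΓ hR t V W)).symm

/-- `D* G D` is symmetric because `G` is, whatever `Γ` may be; only the curvature term uses the
hypothesis on `R`. -/
theorem isSymmetric_indexOp (hsymm : ∀ t v w, frameForm ϵ (R t v) w = frameForm ϵ (R t w) v)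
    (t : ℝ) : (indexOp ι hΓ hR ϵ t : X →ₗ[ℝ] X).IsSymmetric := by
  intro V W
  rw [ContinuousLinearMap.coe_coe, real_inner_comm (indexOp ι hΓ hR ϵ t W) V, inner_indexOp, inner_indexOp,
    inner_signL2, real_inner_comm]
  congr 1
  rw [L2.inner_def, L2.inner_def]
  refine integral_congr_ae ?_
  filter_upwards [coeFn_curvOp ι hR ϵ t V, coeFn_inclL2 ι W, coeFn_curvOp ι hR ϵ t W,
    coeFn_inclL2 ι V] with r h1 h2 h3 h4
  rw [h1, h2, h3, h4, real_inner_smul_left, real_inner_smul_left, ← frameForm_eq, ← frameForm_eq,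
    hsymm]

omit [CompleteSpace X] in
theorem continuous_covOp : Continuous (covOp ι hΓ) := by
  have := (mulCLM (n := n)).continuous.comp
    (scaledPath Γ hΓ (fun t ↦ t) continuous_id).continuous
  exact continuous_const.add (this.clm_comp continuous_const)

omit [CompleteSpace X] in
theorem continuous_curvOp : Continuous (curvOp ι hR ϵ) := by
  have := (mulCLM (n := n)).continuous.comp
    (scaledPath (fun s ↦ signMap ϵ ∘L R s) (by fun_prop) (fun t ↦ t ^ 2) (by fun_prop)).continuous
  exact this.clm_comp continuous_const

theorem continuous_comp_left {E F G : Type*} [NormedAddCommGroup E] [NormedSpace ℝ E]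
    [NormedAddCommGroup F] [NormedSpace ℝ F] [NormedAddCommGroup G] [NormedSpace ℝ G]
    (A : F →L[ℝ] G) {B : ℝ → E →L[ℝ] F} (hB : Continuous B) : Continuous fun t ↦ A ∘L B t :=
  continuous_const.clm_comp hB

theorem continuous_adjoint_comp {E F : Type*} [NormedAddCommGroup E] [InnerProductSpace ℝ E]
    [CompleteSpace E] [NormedAddCommGroup F] [InnerProductSpace ℝ F] [CompleteSpace F]
    {A B : ℝ → E →L[ℝ] F} (hA : Continuous A) (hB : Continuous B) :
    Continuous fun t ↦ ContinuousLinearMap.adjoint (A t) ∘L B t :=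
  (ContinuousLinearMap.adjoint.continuous.comp hA).clm_comp hB

theorem continuous_indexOp : Continuous (indexOp ι hΓ hR ϵ) :=
  (continuous_adjoint_comp (continuous_covOp ι hΓ)
    (continuous_comp_left (signL2 ϵ) (continuous_covOp ι hΓ))).add
    (continuous_comp_left (ContinuousLinearMap.adjoint (inclL2 ι)) (continuous_curvOp ι hR))

variable {ι J}

theorem isFiniteRankLimit_indexOp_sub
    (hJ : ∀ V, ι (J V) = signH1 ϵ (ι V)) (t : ℝ) :
    IsFiniteRankLimit (indexOp ι hΓ hR ϵ t - J) := by
  set M : X →L[ℝ] L2I n :=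
    mulCLM (scaledPath Γ hΓ (fun t ↦ t) continuous_id t) ∘L ι.toContinuousLinearMap with hM
  have hMl : IsFiniteRankLimit M := (isFiniteRankLimit_mulCLM _).comp_right _
  have hC : IsFiniteRankLimit (curvOp ι hR ϵ t) := (isFiniteRankLimit_mulCLM _).comp_right _
  have hcov : covOp ι hΓ t = derCLM ι + M := rfl
  -- Write `D = d/dr + M` with `M` multiplication by `tΓ`. The term without `M` cancels against the
  -- derivative part of `J`, leaving minus its finite rank part at the initial value; each other
  -- summand contains `M` or the curvature multiplication, which are finite rank limits from `H¹` to
  -- `L²`.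
  have key : indexOp ι hΓ hR ϵ t - J
      = ContinuousLinearMap.adjoint (startCLM ι) ∘L (-signMap ϵ ∘L startCLM ι)
        + ContinuousLinearMap.adjoint (derCLM ι) ∘L signL2 ϵ ∘L M
        + ContinuousLinearMap.adjoint M ∘L signL2 ϵ ∘L derCLM ι
        + ContinuousLinearMap.adjoint M ∘L signL2 ϵ ∘L M
        + ContinuousLinearMap.adjoint (inclL2 ι) ∘L curvOp ι hR ϵ t := by
    ext1 V
    refine ext_inner_right ℝ fun W ↦ ?_
    have h1 : inner ℝ (J V) W
        = inner ℝ (signMap ϵ (startCLM ι V)) (startCLM ι W) + inner ℝ (signL2 ϵ (derCLM ι V)) (derCLM ι W) := by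
      rw [inner_eq_H1 ι, hJ, signH1_fst, signH1_snd]
      rfl
    rw [sub_apply, inner_sub_left, inner_indexOp, h1, hcov]
    simp only [add_apply, ContinuousLinearMap.comp_apply, inner_add_left, inner_add_right,
      ContinuousLinearMap.adjoint_inner_left, map_add, neg_apply,
      inner_neg_left]
    ring
  rw [key]
  exact (((((isFiniteRankLimit_of_finiteDimensional _).comp_left _).add
    ((hMl.comp_left _).comp_left _)).add (hMl.adjoint.comp_right _)).add
    (hMl.adjoint.comp_right _)).add (hC.comp_left _)

include hΓ hR in
/-- The spectral flow of the index forms on `[0, N]` exists. -/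
theorem exists_isFormSpectralFlow (hJ : ∀ V, ι (J V) = signH1 ϵ (ι V))
    (hϵ : ∀ i, ϵ i = 1 ∨ ϵ i = -1)
    (hsymm : ∀ t v w, frameForm ϵ (R t v) w = frameForm ϵ (R t w) v) (N : ℝ) :
    ∃ k, IsFormSpectralFlow (𝕜 := ℝ) (fun t V W ↦ coeffForm Γ R ϵ (N * t) (ι V) (ι W)) k := by
  obtain ⟨k, hk⟩ := exists_isSpectralFlow (sign_sign hJ hϵ) (norm_sign_le hJ hϵ)
    (T := fun t ↦ indexOp ι hΓ hR ϵ (N * t))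
    ((continuous_indexOp ι hΓ hR).comp (continuous_const.mul continuous_id)).continuousOn
    (fun t _ ↦ isSymmetric_indexOp ι hΓ hR hsymm _)
    (fun t _ ↦ isFiniteRankLimit_indexOp_sub hΓ hR hJ _)
  exact ⟨k, _, fun t _ V W ↦ inner_indexOp_eq ι hΓ hR _ V W, hk⟩

theorem IsFormSpectralFlow.isSpectralFlow_indexOp {N : ℝ} {k : ℤ}
    (h : IsFormSpectralFlow (𝕜 := ℝ) (fun t V W ↦ coeffForm Γ R ϵ (N * t) (ι V) (ι W)) k) :
    ∃ T : ℝ → X →L[ℝ] X, IsSpectralFlow T k ∧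
      ∀ t ∈ Icc (0 : ℝ) 1, T t = indexOp ι hΓ hR ϵ (N * t) := by
  obtain ⟨T, hT, hk⟩ := h
  refine ⟨T, hk, fun t ht ↦ ?_⟩
  ext1 V
  refine ext_inner_right ℝ fun W ↦ ?_
  rw [hT t ht, inner_indexOp_eq]

theorem IsFormSpectralFlow.eventually_eq (hJ : ∀ V, ι (J V) = signH1 ϵ (ι V))
    {N : ℝ} {k : ℤ}
    (h : IsFormSpectralFlow (𝕜 := ℝ) (fun t V W ↦ coeffForm Γ R ϵ (N * t) (ι V) (ι W)) k) :
    ∀ᶠ δ in 𝓝[>] (0 : ℝ), ∀ᶠ E : Submodule ℝ X in fdFilter (J : X →ₗ[ℝ] X),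
      k = (posIdx (opForm (shift (indexOp ι hΓ hR ϵ N) (-δ))) E : ℤ)
        - posIdx (opForm (shift (indexOp ι hΓ hR ϵ 0) (-δ))) E := by
  obtain ⟨T, hk, hT⟩ := h.isSpectralFlow_indexOp hΓ hR
  have := hk.eventually_eq (J := J) fun s hs ↦ by
    rw [hT s hs]
    exact isFiniteRankLimit_indexOp_sub hΓ hR hJ _
  rw [hT 0 (left_mem_Icc.2 zero_le_one), hT 1 (right_mem_Icc.2 zero_le_one), mul_zero,
    mul_one] at this
  exact this

include hΓ hR in
-- Both values equal the same difference of endpoint indices on a common large subspace, which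
-- exists because the filter is nontrivial.
theorem IsFormSpectralFlow.unique (hJ : ∀ V, ι (J V) = signH1 ϵ (ι V))
    (hϵ : ∀ i, ϵ i = 1 ∨ ϵ i = -1) {N : ℝ} {k k' : ℤ}
    (h : IsFormSpectralFlow (𝕜 := ℝ) (fun t V W ↦ coeffForm Γ R ϵ (N * t) (ι V) (ι W)) k)
    (h' : IsFormSpectralFlow (𝕜 := ℝ) (fun t V W ↦ coeffForm Γ R ϵ (N * t) (ι V) (ι W)) k') : k = k' := by
  have : (fdFilter (J : X →ₗ[ℝ] X)).NeBot :=
    fdFilter_neBot (sign_sign hJ hϵ)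
  obtain ⟨δ, h1, h2⟩ := ((h.eventually_eq hΓ hR hJ).and (h'.eventually_eq hΓ hR hJ)).exists
  obtain ⟨E, h3, h4⟩ := (h1.and h2).exists
  rw [h3, h4]

end IndexOp

/-! ### Positive indices and gluing -/

section Gluing

variable {V V' : Type*} [AddCommGroup V] [Module ℝ V] [AddCommGroup V'] [Module ℝ V']

theorem posIdx_map_of_injOn {Q : QuadraticForm ℝ V} {Q' : QuadraticForm ℝ V'}
    {E : Submodule ℝ V} (f : V →ₗ[ℝ] V') (hf : ∀ v ∈ E, f v = 0 → v = 0) {c : ℝ}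
    (hc : 0 < c) [FiniteDimensional ℝ E] (h : ∀ v ∈ E, Q' (f v) = c * Q v) :
    posIdx Q' (E.map f) = posIdx Q E := by
  have h1 : E.map f = (⊤ : Submodule ℝ E).map (f ∘ₗ E.subtype) := by
    rw [Submodule.map_comp, Submodule.map_top, Submodule.range_subtype]
  have h2 : E = (⊤ : Submodule ℝ E).map E.subtype := by
    rw [Submodule.map_top, Submodule.range_subtype]
  rw [h1, posIdx_map (Q := Q.restrict E) (f ∘ₗ E.subtype) ?_ hc fun v _ ↦ h v v.2]
  · conv_rhs => rw [h2]
    exact (posIdx_map E.subtype E.injective_subtype one_pos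
      fun v _ ↦ by rw [one_mul]; rfl).symm
  · rw [← LinearMap.ker_eq_bot, LinearMap.ker_eq_bot']
    exact fun v hv ↦ Subtype.ext (hf v v.2 hv)

/-- Correcting vectors of `E` by elements of `C ≤ E` brings them into `D`, so `E ≤ (E ⊓ D) ⊔ C`. -/
theorem posIdx_inf_le {Q : QuadraticForm ℝ V} {E D C : Submodule ℝ V} [FiniteDimensional ℝ E]
    [FiniteDimensional ℝ C] (hC : ∀ v, ∃ c ∈ C, v - c ∈ D) (hCE : C ≤ E) :
    posIdx Q (E ⊓ D) ≤ posIdx Q E ∧ posIdx Q E ≤ posIdx Q (E ⊓ D) + Module.finrank ℝ C := by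
  refine ⟨posIdx_mono inf_le_left fun _ _ ↦ le_rfl, ?_⟩
  have : FiniteDimensional ℝ ↥(E ⊓ D) := Submodule.finiteDimensional_of_le inf_le_left
  refine le_trans (posIdx_mono (fun v hv ↦ ?_) fun _ _ ↦ le_rfl) (posIdx_sup_le Q (E ⊓ D) C)
  obtain ⟨c, hc, hcD⟩ := hC v
  exact Submodule.mem_sup.2 ⟨v - c, ⟨E.sub_mem hv (hCE hc), hcD⟩, c, hc, sub_add_cancel v c⟩

/-- Differences of positive indices on large subspaces are additive under gluing, up to the
dimension of the defect `C` of the gluing and of the defect `C₀` of the domain `D`. -/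
theorem abs_sub_le_of_gluing {J e₁ e₂ r₁ r₂ : V →ₗ[ℝ] V} (hJ : ∀ v, J (J v) = v)
    {Q Q₀ Q₁ Q₂ : QuadraticForm ℝ V} {D C₀ C : Submodule ℝ V} [FiniteDimensional ℝ C₀]
    [FiniteDimensional ℝ C] (hDJ : ∀ v ∈ D, J v ∈ D) (hCJ : ∀ v ∈ C, J v ∈ C)
    (he₁ : ∀ v, J (e₁ v) = e₁ (J v)) (he₂ : ∀ v, J (e₂ v) = e₂ (J v))
    (hC₀ : ∀ v, ∃ c ∈ C₀, v - c ∈ D) (hr₁ : ∀ v, r₁ v ∈ D) (hr₂ : ∀ v, r₂ v ∈ D)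
    (hC : ∀ v, v - (e₁ (r₁ v) + e₂ (r₂ v)) ∈ C)
    (hre₁ : ∀ v ∈ D, ∀ w ∈ D, r₁ (e₁ v + e₂ w) = v)
    (hre₂ : ∀ v ∈ D, ∀ w ∈ D, r₂ (e₁ v + e₂ w) = w) {a b : ℝ} (ha : 0 < a) (hb : 0 < b)
    (hQ : ∀ v ∈ D, ∀ w ∈ D, Q (e₁ v + e₂ w) = a * Q₁ v + b * Q₂ w)
    (hQ₀ : ∀ v ∈ D, ∀ w ∈ D, Q₀ (e₁ v + e₂ w) = a * Q₀ v + b * Q₀ w) {k k₁ k₂ : ℤ}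
    (hk : ∀ᶠ E in fdFilter J, k = (posIdx Q E : ℤ) - posIdx Q₀ E)
    (hk₁ : ∀ᶠ E in fdFilter J, k₁ = (posIdx Q₁ E : ℤ) - posIdx Q₀ E)
    (hk₂ : ∀ᶠ E in fdFilter J, k₂ = (posIdx Q₂ E : ℤ) - posIdx Q₀ E) :
    |k - (k₁ + k₂)| ≤ Module.finrank ℝ C + 2 * Module.finrank ℝ C₀ := by
  obtain ⟨F, hF, hk⟩ := eventually_fdFilter.1 hk
  have hlarge : ∀ {k' : ℤ} {Q' : QuadraticForm ℝ V} (r : V →ₗ[ℝ] V),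
      (∀ᶠ E in fdFilter J, k' = (posIdx Q' E : ℤ) - posIdx Q₀ E) →
      ∃ E : Submodule ℝ V, FiniteDimensional ℝ E ∧ (∀ v ∈ E, J v ∈ E) ∧ F.map r ≤ E ∧ C₀ ≤ E ∧
        k' = (posIdx Q' E : ℤ) - posIdx Q₀ E := by
    intro k' Q' r h
    have := fdFilter_neBot hJ
    obtain ⟨E, h1, h2, h3, h4, h5⟩ := ((eventually_fdFilter_finiteDimensional J).and
      ((eventually_fdFilter_invariant J).and ((eventually_fdFilter_ge J (F.map r)).and
        ((eventually_fdFilter_ge J C₀).and h)))).exists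
    exact ⟨E, h1, h2, h3, h4, h5⟩
  obtain ⟨E₁, hfd₁, hE₁J, hFE₁, hCE₁, hk₁⟩ := hlarge r₁ hk₁
  obtain ⟨E₂, hfd₂, hE₂J, hFE₂, hCE₂, hk₂⟩ := hlarge r₂ hk₂
  have : FiniteDimensional ℝ ↥(E₁ ⊓ D) := Submodule.finiteDimensional_of_le inf_le_left
  have : FiniteDimensional ℝ ↥(E₂ ⊓ D) := Submodule.finiteDimensional_of_le inf_le_left
  -- `E₁` and `E₂` were taken large enough to compute `k₁` and `k₂` and to contain the restrictions
  -- of `F`. On the glued space `G` the forms `Q` and `Q₀` are orthogonal sums, and the positive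
  -- factors `a`, `b` do not affect indices.
  set G := (E₁ ⊓ D).map e₁ ⊔ (E₂ ⊓ D).map e₂ with hG
  have hind : ∀ {P P₁ P₂ : QuadraticForm ℝ V},
      (∀ v ∈ D, ∀ w ∈ D, P (e₁ v + e₂ w) = a * P₁ v + b * P₂ w) →
      posIdx P G = posIdx P₁ (E₁ ⊓ D) + posIdx P₂ (E₂ ⊓ D) := by
    intro P P₁ P₂ hP
    have h1 : ∀ v ∈ D, P (e₁ v) = a * P₁ v := fun v hv ↦ by
      have := hP v hv 0 D.zero_mem
      rwa [map_zero, add_zero, map_zero, mul_zero, add_zero] at this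
    have h2 : ∀ w ∈ D, P (e₂ w) = b * P₂ w := fun w hw ↦ by
      have := hP 0 D.zero_mem w hw
      rwa [map_zero, zero_add, map_zero, mul_zero, zero_add] at this
    rw [hG, posIdx_sup_of_orthogonal,
      posIdx_map_of_injOn (E := E₁ ⊓ D) e₁ ?_ ha fun v hv ↦ h1 v hv.2,
      posIdx_map_of_injOn (E := E₂ ⊓ D) e₂ ?_ hb fun v hv ↦ h2 v hv.2]
    · intro w hw h0
      have := hre₂ 0 D.zero_mem w hw.2
      rwa [h0, map_zero, add_zero, map_zero, eq_comm] at this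
    · intro v hv h0
      have := hre₁ v hv.2 0 D.zero_mem
      rwa [h0, map_zero, add_zero, map_zero, eq_comm] at this
    · rw [Submodule.disjoint_def]
      rintro _ ⟨v, hv, rfl⟩ ⟨w, hw, hvw⟩
      have := hre₁ v hv.2 (-w) (D.neg_mem hw.2)
      rw [map_neg, hvw, add_neg_cancel, map_zero] at this
      rw [← this, map_zero]
    · rintro _ ⟨v, hv, rfl⟩ _ ⟨w, hw, rfl⟩
      rw [hP v hv.2 w hw.2, h1 v hv.2, h2 w hw.2]
  -- Adding the defect `C` makes `G` contain `F`, since each `v` is its reglued restrictions plus an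
  -- element of `C`; so `G ⊔ C` is large enough to compute `k`.
  have hGC : k = (posIdx Q (G ⊔ C) : ℤ) - posIdx Q₀ (G ⊔ C) := by
    refine hk _ inferInstance ?_ ?_
    · intro v hv
      obtain ⟨x, hx, c, hc, rfl⟩ := Submodule.mem_sup.1 hv
      obtain ⟨_, ⟨v₁, hv₁, rfl⟩, _, ⟨v₂, hv₂, rfl⟩, rfl⟩ := Submodule.mem_sup.1 hx
      rw [map_add, map_add, he₁, he₂]
      exact Submodule.add_mem_sup (Submodule.add_mem_sup ⟨_, ⟨hE₁J _ hv₁.1, hDJ _ hv₁.2⟩, rfl⟩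
        ⟨_, ⟨hE₂J _ hv₂.1, hDJ _ hv₂.2⟩, rfl⟩) (hCJ c hc)
    · intro v hv
      rw [← add_sub_cancel (e₁ (r₁ v) + e₂ (r₂ v)) v]
      exact Submodule.add_mem_sup (Submodule.add_mem_sup
        ⟨_, ⟨hFE₁ ⟨v, hv, rfl⟩, hr₁ v⟩, rfl⟩ ⟨_, ⟨hFE₂ ⟨v, hv, rfl⟩, hr₂ v⟩, rfl⟩) (hC v)
  -- Every index changes by an amount between `0` and a dimension, so a difference of two indices
  -- changes by at most that dimension: `dim C` from `G` to `G ⊔ C`, and `dim C₀` for each of `E₁`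
  -- and `E₂`.
  have b1 := posIdx_inf_le (Q := Q₁) hC₀ hCE₁
  have b2 := posIdx_inf_le (Q := Q₀) hC₀ hCE₁
  have b3 := posIdx_inf_le (Q := Q₂) hC₀ hCE₂
  have b4 := posIdx_inf_le (Q := Q₀) hC₀ hCE₂
  have c1 := posIdx_sup_le Q G C
  have c2 := posIdx_sup_le Q₀ G C
  have c3 : posIdx Q G ≤ posIdx Q (G ⊔ C) := posIdx_mono le_sup_left fun _ _ ↦ le_rfl
  have c4 : posIdx Q₀ G ≤ posIdx Q₀ (G ⊔ C) := posIdx_mono le_sup_left fun _ _ ↦ le_rfl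
  have d1 := hind hQ
  have d2 := hind hQ₀
  rw [abs_le]
  omega

end Gluing

/-! ### Rescaling of fields to subintervals -/

section Window

variable {n : ℕ}

/-- The affine map `x ↦ b * x + a` maps the subinterval `[s, r]` of `[0,1]` into `[0,1]`. -/
structure IsWindow (b a s r : ℝ) : Prop where
  pos : 0 < b
  nonneg : 0 ≤ s
  le : s ≤ r
  le_one : r ≤ 1
  map_nonneg : 0 ≤ b * s + a
  map_le_one : b * r + a ≤ 1

theorem map_affine_volume {b : ℝ} (hb : b ≠ 0) (a : ℝ) :
    volume.map (fun x : ℝ ↦ b * x + a) = ENNReal.ofReal |b⁻¹| • (volume : Measure ℝ) := by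
  have : (fun x : ℝ ↦ b * x + a) = (fun x ↦ x + a) ∘ (fun x ↦ b * x) := rfl
  rw [this, ← Measure.map_map (by fun_prop) (by fun_prop), Real.map_volume_mul_left hb,
    Measure.map_smul, map_add_right_eq_self]

namespace IsWindow

variable {b a s r : ℝ} (h : IsWindow b a s r)

include h

theorem subset : Ioc s r ⊆ Icc 0 1 := fun _ hx ↦ ⟨h.nonneg.trans hx.1.le, hx.2.trans h.le_one⟩

theorem map_mem {x : ℝ} (hx : x ∈ Icc s r) : b * x + a ∈ Icc (0 : ℝ) 1 := by
  have h1 := mul_le_mul_of_nonneg_left hx.1 h.pos.le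
  have h2 := mul_le_mul_of_nonneg_left hx.2 h.pos.le
  exact ⟨by linarith [h.map_nonneg], by linarith [h.map_le_one]⟩

/-- Domination of the image measure by a multiple of Lebesgue measure on `[0, 1]` makes composition
with the affine map well defined on almost everywhere classes and keeps it in `L²`. -/
theorem map_restrict_le : (volume.restrict (Ioc s r)).map (fun x ↦ b * x + a)
    ≤ ENNReal.ofReal |b⁻¹| • volume.restrict (Icc (0 : ℝ) 1) := by
  have h1 : Ioc s r ⊆ (fun x ↦ b * x + a) ⁻¹' Icc 0 1 :=
    fun x hx ↦ h.map_mem (Ioc_subset_Icc_self hx)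
  refine (Measure.map_mono (Measure.restrict_mono h1 le_rfl) (by fun_prop)).trans ?_
  rw [← Measure.restrict_map (by fun_prop) measurableSet_Icc, map_affine_volume h.pos.ne',
    Measure.restrict_smul]

theorem ae_comp {p : ℝ → Prop} (hp : ∀ᵐ y ∂volume.restrict (Icc (0 : ℝ) 1), p y) :
    ∀ᵐ x ∂volume.restrict (Icc (0 : ℝ) 1), x ∈ Ioc s r → p (b * x + a) := by
  have h1 : ∀ᵐ y ∂(volume.restrict (Ioc s r)).map (fun x ↦ b * x + a), p y :=
    (Measure.absolutelyContinuous_of_le h.map_restrict_le).ae_le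
      (Measure.ae_smul_measure hp _)
  have h2 := ae_of_ae_map (by fun_prop) h1
  rw [ae_restrict_iff' measurableSet_Ioc] at h2
  exact ae_restrict_of_ae h2

theorem memLp_pull (f : L2I n) : MemLp ((Ioc s r).indicator fun x ↦ b • f (b * x + a)) 2
    (volume.restrict (Icc (0 : ℝ) 1)) := by
  rw [memLp_indicator_iff_restrict measurableSet_Ioc, Measure.restrict_restrict measurableSet_Ioc,
    inter_eq_left.2 h.subset]
  have h1 : MemLp f 2 ((volume.restrict (Ioc s r)).map (fun x ↦ b * x + a)) :=
    ((Lp.memLp f).smul_measure (by simp)).mono_measure h.map_restrict_le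
  exact ((memLp_map_measure_iff h1.1 (by fun_prop)).1 h1).const_smul b

/-- The function `x ↦ b • f (b * x + a)` on `[s, r]`, extended by `0`. -/
def pull : L2I n →ₗ[ℝ] L2I n where
  toFun f := (h.memLp_pull f).toLp _
  map_add' f g := by
    rw [← MemLp.toLp_add]
    refine MemLp.toLp_congr _ _ ?_
    filter_upwards [h.ae_comp (Lp.coeFn_add f g)] with x hx
    by_cases hm : x ∈ Ioc s r
    · have := hx hm
      rw [Pi.add_apply] at this ⊢
      simp only [indicator_of_mem hm, this, smul_add]
    · simp [hm]
  map_smul' c f := by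
    rw [← MemLp.toLp_const_smul]
    refine MemLp.toLp_congr _ _ ?_
    filter_upwards [h.ae_comp (Lp.coeFn_smul c f)] with x hx
    by_cases hm : x ∈ Ioc s r
    · have := hx hm
      rw [Pi.smul_apply] at this ⊢
      simp only [indicator_of_mem hm, this, smul_comm b c, RingHom.id_apply]
    · simp [hm]

theorem coeFn_pull (f : L2I n) : h.pull f =ᵐ[volume.restrict (Icc (0 : ℝ) 1)]
    (Ioc s r).indicator fun x ↦ b • f (b * x + a) := MemLp.coeFn_toLp (h.memLp_pull f)

theorem pull_pull {b' a' s' r' : ℝ} (h' : IsWindow b' a' s' r') (f : L2I n) :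
    h.pull (h'.pull f) =ᵐ[volume.restrict (Icc (0 : ℝ) 1)] (Ioc s r).indicator fun x ↦
      b • (Ioc s' r').indicator (fun x ↦ b' • f (b' * x + a')) (b * x + a) := by
  filter_upwards [h.coeFn_pull (h'.pull f), h.ae_comp (h'.coeFn_pull f)] with x h1 h2
  rw [h1]
  by_cases hm : x ∈ Ioc s r
  · simp only [indicator_of_mem hm]
    rw [h2 hm]
  · simp [hm]

theorem pull_signL2 (ϵ : Fin n → ℝ) (f : L2I n) : h.pull (signL2 ϵ f) = signL2 ϵ (h.pull f) := by
  refine Lp.ext ?_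
  filter_upwards [h.coeFn_pull (signL2 ϵ f), coeFn_signL2 ϵ (h.pull f), h.coeFn_pull f,
    h.ae_comp (coeFn_signL2 ϵ f)] with x h1 h2 h3 h4
  rw [h1, h2, h3]
  by_cases hm : x ∈ Ioc s r
  · simp only [indicator_of_mem hm]
    rw [h4 hm, map_smul]
  · simp [hm]

/-- The factor `b` in `pull` is the one of the chain rule, so that the primitive is merely
reparametrized. -/
theorem integral_pull (f : L2I n) {x y : ℝ} (hx : s ≤ x) (hxy : x ≤ y) (hy : y ≤ r) :
    ∫ z in x..y, h.pull f z = ∫ z in b * x + a..b * y + a, f z := by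
  have h1 : ∫ z in x..y, h.pull f z = ∫ z in x..y, b • f (b * z + a) := by
    refine intervalIntegral.integral_congr_ae_restrict ?_
    have hx1 : x ∈ Icc (0 : ℝ) 1 := ⟨h.nonneg.trans hx, (hxy.trans hy).trans h.le_one⟩
    have hy1 : y ∈ Icc (0 : ℝ) 1 := ⟨hx1.1.trans hxy, hy.trans h.le_one⟩
    filter_upwards [ae_uIoc_of_ae (h.coeFn_pull f) hx1 hy1,
      ae_restrict_mem measurableSet_uIoc] with z h1 h2
    rw [uIoc_of_le hxy] at h2
    rw [h1, indicator_of_mem (show z ∈ Ioc s r from ⟨hx.trans_lt h2.1, h2.2.trans hy⟩)]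
  rw [h1, intervalIntegral.integral_smul, intervalIntegral.smul_integral_comp_mul_add]

theorem integral_pull_of_disjoint (f : L2I n) {x y : ℝ} (hx : 0 ≤ x) (hxy : x ≤ y) (hy : y ≤ 1)
    (hd : y ≤ s ∨ r ≤ x) : ∫ z in x..y, h.pull f z = 0 := by
  have h1 : ∫ z in x..y, h.pull f z = ∫ z in x..y, (0 : EuclideanSpace ℝ (Fin n)) := by
    refine intervalIntegral.integral_congr_ae_restrict ?_
    filter_upwards [ae_uIoc_of_ae (h.coeFn_pull f) ⟨hx, hxy.trans hy⟩ ⟨hx.trans hxy, hy⟩,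
      ae_restrict_mem measurableSet_uIoc] with z h1 h2
    rw [uIoc_of_le hxy] at h2
    rw [h1, indicator_of_notMem]
    rintro ⟨h3, h4⟩
    rcases hd with hd | hd
    · exact absurd (h3.trans_le (h2.2.trans hd)) (lt_irrefl _)
    · exact absurd (h2.1.trans_le (h4.trans hd)) (lt_irrefl _)
  rw [h1, intervalIntegral.integral_zero]

end IsWindow

/-! ### Primitives -/

/-- The mean value. -/
def meanL2 : L2I n →ₗ[ℝ] EuclideanSpace ℝ (Fin n) where
  toFun f := ∫ x in (0 : ℝ)..1, f x
  map_add' f g := L2I.integral_add f g (left_mem_Icc.2 zero_le_one) (right_mem_Icc.2 zero_le_one)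
  map_smul' c f := L2I.integral_smul c f (left_mem_Icc.2 zero_le_one) (right_mem_Icc.2 zero_le_one)

theorem meanL2_apply (f : L2I n) : meanL2 f = ∫ x in (0 : ℝ)..1, f x := rfl

/-- The constant functions. -/
def constL2 : EuclideanSpace ℝ (Fin n) →ₗ[ℝ] L2I n :=
  (Lp.constL 2 (volume.restrict (Icc (0 : ℝ) 1)) ℝ : EuclideanSpace ℝ (Fin n) →L[ℝ] L2I n)

theorem coeFn_constL2 (v : EuclideanSpace ℝ (Fin n)) :
    constL2 v =ᵐ[volume.restrict (Icc (0 : ℝ) 1)] fun _ ↦ v :=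
  Lp.coeFn_const (p := 2) (volume.restrict (Icc (0 : ℝ) 1)) v

theorem meanL2_constL2 (v : EuclideanSpace ℝ (Fin n)) : meanL2 (constL2 v) = v := by
  rw [meanL2_apply, intervalIntegral.integral_congr_ae_restrict (ae_uIoc_of_ae (coeFn_constL2 v)
    (left_mem_Icc.2 zero_le_one) (right_mem_Icc.2 zero_le_one))]
  simp

theorem signL2_constL2 (ϵ : Fin n → ℝ) (v : EuclideanSpace ℝ (Fin n)) :
    signL2 ϵ (constL2 v) = constL2 (signMap ϵ v) := by
  refine Lp.ext ?_
  filter_upwards [coeFn_signL2 ϵ (constL2 v), coeFn_constL2 v,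
    coeFn_constL2 (signMap ϵ v)] with x h1 h2 h3
  rw [h1, h2, h3]

theorem meanL2_signL2 (ϵ : Fin n → ℝ) (f : L2I n) :
    meanL2 (signL2 ϵ f) = signMap ϵ (meanL2 f) :=
  integral_signL2 ϵ f (left_mem_Icc.2 zero_le_one) (right_mem_Icc.2 zero_le_one)

theorem mem_H1per_iff {V : H1 n} : V ∈ H1per n ↔ meanL2 V.snd = 0 := by
  change V.val 0 = V.val 1 ↔ _
  rw [H1.val_zero, H1.val, left_eq_add]
  rfl

/-- The element of `H¹` with given initial value and derivative. -/
def mkH1 : EuclideanSpace ℝ (Fin n) × L2I n →ₗ[ℝ] H1 n :=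
  (WithLp.linearEquiv 2 ℝ (EuclideanSpace ℝ (Fin n) × L2I n)).symm.toLinearMap

/-- The periodic field with initial value `v` and derivative the mean zero part of `f`. -/
def mkPer : EuclideanSpace ℝ (Fin n) × L2I n →ₗ[ℝ] H1per n :=
  (mkH1 ∘ₗ (LinearMap.id.prodMap (LinearMap.id - constL2 ∘ₗ meanL2))).codRestrict (H1per n) <| by
    rintro ⟨v, f⟩
    rw [mem_H1per_iff]
    change meanL2 (f - constL2 (meanL2 f)) = 0
    rw [map_sub, meanL2_constL2, sub_self]

theorem mkPer_snd (v : EuclideanSpace ℝ (Fin n)) (f : L2I n) :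
    (mkPer (v, f)).1.snd = f - constL2 (meanL2 f) := rfl

theorem mkPer_snd_of_mean {f : L2I n} (hf : meanL2 f = 0) (v : EuclideanSpace ℝ (Fin n)) :
    (mkPer (v, f)).1.snd = f := by
  rw [mkPer_snd, hf, map_zero, sub_zero]

theorem meanL2_snd (V : H1per n) : meanL2 V.1.snd = 0 := mem_H1per_iff.1 V.2

theorem mkPer_eta (V : H1per n) : mkPer (V.1.fst, V.1.snd) = V :=
  Subtype.ext (H1.ext rfl (mkPer_snd_of_mean (meanL2_snd V) _))

theorem signPer_mkPer (ϵ : Fin n → ℝ) (v : EuclideanSpace ℝ (Fin n)) (f : L2I n) :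
    signPer ϵ (mkPer (v, f)) = mkPer (signMap ϵ v, signL2 ϵ f) := by
  refine Subtype.ext (H1.ext rfl ?_)
  rw [signPer_coe, signH1_snd, mkPer_snd, mkPer_snd, map_sub, signL2_constL2, meanL2_signL2]

/-- The derivative of a periodic field. -/
def sndPer : H1per n →ₗ[ℝ] L2I n :=
  (WithLp.sndL 2 ℝ (EuclideanSpace ℝ (Fin n)) (L2I n)).toLinearMap ∘ₗ (H1per n).subtype

/-- The initial value of a periodic field. -/
def fstPer : H1per n →ₗ[ℝ] EuclideanSpace ℝ (Fin n) :=
  (WithLp.fstL 2 ℝ (EuclideanSpace ℝ (Fin n)) (L2I n)).toLinearMap ∘ₗ (H1per n).subtype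

theorem sndPer_apply (V : H1per n) : sndPer V = V.1.snd := rfl
theorem fstPer_apply (V : H1per n) : fstPer V = V.1.fst := rfl

theorem sndPer_signPer (ϵ : Fin n → ℝ) (V : H1per n) : sndPer (signPer ϵ V) = signL2 ϵ (sndPer V) :=
  rfl

theorem fstPer_signPer (ϵ : Fin n → ℝ) (V : H1per n) :
    fstPer (signPer ϵ V) = signMap ϵ (fstPer V) := rfl

/-- The periodic primitive of the mean zero part. -/
def primPer : L2I n →ₗ[ℝ] H1per n := mkPer ∘ₗ LinearMap.inr ℝ _ _

/-- The constant fields. -/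
def constPer : EuclideanSpace ℝ (Fin n) →ₗ[ℝ] H1per n := mkPer ∘ₗ LinearMap.inl ℝ _ _

theorem primPer_apply (f : L2I n) : primPer f = mkPer (0, f) := rfl
theorem constPer_apply (v : EuclideanSpace ℝ (Fin n)) : constPer v = mkPer (v, 0) := rfl

theorem constPer_add_primPer (V : H1per n) : constPer (fstPer V) + primPer (sndPer V) = V := by
  rw [constPer_apply, primPer_apply, ← map_add, Prod.mk_add_mk, add_zero, zero_add]
  exact mkPer_eta V

theorem fstPer_primPer (f : L2I n) : fstPer (primPer f) = 0 := rfl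
theorem fstPer_constPer (v : EuclideanSpace ℝ (Fin n)) : fstPer (constPer v) = v := rfl

theorem sndPer_primPer {f : L2I n} (hf : meanL2 f = 0) : sndPer (primPer f) = f :=
  mkPer_snd_of_mean hf 0

theorem signPer_primPer (ϵ : Fin n → ℝ) (f : L2I n) :
    signPer ϵ (primPer f) = primPer (signL2 ϵ f) := by
  rw [primPer_apply, signPer_mkPer, map_zero]
  rfl

theorem signPer_constPer (ϵ : Fin n → ℝ) (v : EuclideanSpace ℝ (Fin n)) :
    signPer ϵ (constPer v) = constPer (signMap ϵ v) := by
  rw [constPer_apply, signPer_mkPer, map_zero]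
  rfl

end Window

/-! ### Cutting a field at an intermediate time -/

section Cut

variable {n : ℕ} {θ : ℝ}

/-- For a cut at `θ`, the two `ext` windows squeeze a function on `[0, 1]` into `[0, θ]` or `[θ, 1]`
and extend it by zero; the two `res` windows stretch the restriction to one of these intervals back
to `[0, 1]`. -/
theorem isWindow_ext_left (h0 : 0 < θ) (h1 : θ < 1) : IsWindow θ⁻¹ 0 0 θ :=
  ⟨inv_pos.2 h0, le_rfl, h0.le, h1.le, by simp, by rw [inv_mul_cancel₀ h0.ne', add_zero]⟩

theorem isWindow_ext_right (h0 : 0 < θ) (h1 : θ < 1) :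
    IsWindow (1 - θ)⁻¹ (-(θ * (1 - θ)⁻¹)) θ 1 := by
  have : 0 < 1 - θ := by linarith
  refine ⟨inv_pos.2 this, h0.le, h1.le, le_rfl, by nlinarith, le_of_eq ?_⟩
  field_simp
  ring

theorem isWindow_res_left (h0 : 0 < θ) (h1 : θ < 1) : IsWindow θ 0 0 1 :=
  ⟨h0, le_rfl, zero_le_one, le_rfl, by simp, by linarith⟩

theorem isWindow_res_right (h0 : 0 < θ) (h1 : θ < 1) : IsWindow (1 - θ) θ 0 1 :=
  ⟨by linarith, le_rfl, zero_le_one, le_rfl, by linarith, by linarith⟩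

theorem ae_mem_Ioc : ∀ᵐ x ∂volume.restrict (Icc (0 : ℝ) 1), x ∈ Ioc (0 : ℝ) 1 := by
  rw [← restrict_Ioc_eq_restrict_Icc]
  exact ae_restrict_mem measurableSet_Ioc

section Identities

variable (h0 : 0 < θ) (h1 : θ < 1) (f : L2I n)

/-- Restriction inverts extension on the same side and annihilates extension from the other side.
Together with `ext_res_add` this identifies `L²` with two copies of itself. -/
theorem res_left_ext_left :
    (isWindow_res_left h0 h1).pull ((isWindow_ext_left h0 h1).pull f) = f := by
  refine Lp.ext ?_
  filter_upwards [(isWindow_res_left h0 h1).pull_pull (isWindow_ext_left h0 h1) f,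
    ae_mem_Ioc] with x h hx
  have hm : θ * x + 0 ∈ Ioc 0 θ := ⟨by have := mul_pos h0 hx.1; linarith, by nlinarith [hx.2]⟩
  rw [h, indicator_of_mem hx, indicator_of_mem hm, smul_smul, mul_inv_cancel₀ h0.ne', one_smul,
    add_zero, add_zero, inv_mul_cancel_left₀ h0.ne']

theorem res_left_ext_right :
    (isWindow_res_left h0 h1).pull ((isWindow_ext_right h0 h1).pull f) = 0 := by
  refine Lp.ext ?_
  filter_upwards [(isWindow_res_left h0 h1).pull_pull (isWindow_ext_right h0 h1) f,
    ae_mem_Ioc, Lp.coeFn_zero (EuclideanSpace ℝ (Fin n)) 2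
      (volume.restrict (Icc (0 : ℝ) 1))] with x h hx hz
  have hm : θ * x + 0 ∉ Ioc θ 1 := fun hh ↦ by nlinarith [hh.1, hx.2]
  rw [h, indicator_of_mem hx, indicator_of_notMem hm, smul_zero, hz]
  rfl

theorem res_right_ext_right :
    (isWindow_res_right h0 h1).pull ((isWindow_ext_right h0 h1).pull f) = f := by
  refine Lp.ext ?_
  filter_upwards [(isWindow_res_right h0 h1).pull_pull (isWindow_ext_right h0 h1) f,
    ae_mem_Ioc] with x h hx
  have h2 : 0 < 1 - θ := by linarith
  have hm : (1 - θ) * x + θ ∈ Ioc θ 1 :=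
    ⟨by have := mul_pos h2 hx.1; linarith, by nlinarith [hx.2]⟩
  have hx' : (1 - θ)⁻¹ * ((1 - θ) * x + θ) + -(θ * (1 - θ)⁻¹) = x := by
    field_simp
    ring
  rw [h, indicator_of_mem hx, indicator_of_mem hm, smul_smul, mul_inv_cancel₀ h2.ne', one_smul,
    hx']

theorem res_right_ext_left :
    (isWindow_res_right h0 h1).pull ((isWindow_ext_left h0 h1).pull f) = 0 := by
  refine Lp.ext ?_
  filter_upwards [(isWindow_res_right h0 h1).pull_pull (isWindow_ext_left h0 h1) f,
    ae_mem_Ioc, Lp.coeFn_zero (EuclideanSpace ℝ (Fin n)) 2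
      (volume.restrict (Icc (0 : ℝ) 1))] with x h hx hz
  have h2 : 0 < 1 - θ := by linarith
  have hm : (1 - θ) * x + θ ∉ Ioc 0 θ := fun hh ↦ by nlinarith [hh.2, mul_pos h2 hx.1]
  rw [h, indicator_of_mem hx, indicator_of_notMem hm, smul_zero, hz]
  rfl

theorem ext_res_add :
    (isWindow_ext_left h0 h1).pull ((isWindow_res_left h0 h1).pull f)
      + (isWindow_ext_right h0 h1).pull ((isWindow_res_right h0 h1).pull f) = f := by
  refine Lp.ext ?_
  have h2 : 0 < 1 - θ := by linarith
  filter_upwards [(isWindow_ext_left h0 h1).pull_pull (isWindow_res_left h0 h1) f,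
    (isWindow_ext_right h0 h1).pull_pull (isWindow_res_right h0 h1) f, ae_mem_Ioc,
    Lp.coeFn_add ((isWindow_ext_left h0 h1).pull ((isWindow_res_left h0 h1).pull f))
      ((isWindow_ext_right h0 h1).pull ((isWindow_res_right h0 h1).pull f))] with x h3 h4 hx h5
  rw [h5, Pi.add_apply, h3, h4]
  rcases le_or_gt x θ with hxθ | hxθ
  · have hm1 : x ∈ Ioc 0 θ := ⟨hx.1, hxθ⟩
    have hm2 : x ∉ Ioc θ 1 := fun hh ↦ absurd hh.1 (not_lt.2 hxθ)
    have hm3 : θ⁻¹ * x + 0 ∈ Ioc (0 : ℝ) 1 := by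
      rw [add_zero, inv_mul_eq_div]
      exact ⟨div_pos hx.1 h0, (div_le_one h0).2 hxθ⟩
    rw [indicator_of_mem hm1, indicator_of_notMem hm2, indicator_of_mem hm3, smul_smul,
      inv_mul_cancel₀ h0.ne', one_smul, add_zero, add_zero, add_zero, mul_inv_cancel_left₀ h0.ne']
  · have hm1 : x ∉ Ioc 0 θ := fun hh ↦ absurd hh.2 (not_le.2 hxθ)
    have hm2 : x ∈ Ioc θ 1 := ⟨hxθ, hx.2⟩
    have h6 : (1 - θ)⁻¹ * x + -(θ * (1 - θ)⁻¹) = (x - θ) / (1 - θ) := by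
      field_simp
      ring
    have hm3 : (1 - θ)⁻¹ * x + -(θ * (1 - θ)⁻¹) ∈ Ioc (0 : ℝ) 1 := by
      rw [h6]
      exact ⟨div_pos (by linarith) h2, (div_le_one h2).2 (by linarith [hx.2])⟩
    have h7 : (1 - θ) * ((1 - θ)⁻¹ * x + -(θ * (1 - θ)⁻¹)) + θ = x := by
      field_simp
      ring
    rw [indicator_of_notMem hm1, indicator_of_mem hm2, indicator_of_mem hm3, smul_smul,
      inv_mul_cancel₀ h2.ne', one_smul, zero_add, h7]

/-- Squeezing preserves the mean, so the derivative of a periodic field becomes again the derivative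
of a periodic field. -/
theorem meanL2_ext_left : meanL2 ((isWindow_ext_left h0 h1).pull f) = meanL2 f := by
  rw [meanL2_apply, ← intervalIntegral.integral_add_adjacent_intervals
    (L2I.intervalIntegrable _ (left_mem_Icc.2 zero_le_one) ⟨h0.le, h1.le⟩)
    (L2I.intervalIntegrable _ ⟨h0.le, h1.le⟩ (right_mem_Icc.2 zero_le_one)),
    IsWindow.integral_pull _ f le_rfl h0.le le_rfl,
    IsWindow.integral_pull_of_disjoint _ f h0.le h1.le le_rfl (Or.inr le_rfl), mul_zero, add_zero,
    add_zero, add_zero, inv_mul_cancel₀ h0.ne', meanL2_apply]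

theorem meanL2_ext_right : meanL2 ((isWindow_ext_right h0 h1).pull f) = meanL2 f := by
  have h2 : 0 < 1 - θ := by linarith
  have h3 : (1 - θ)⁻¹ * θ + -(θ * (1 - θ)⁻¹) = 0 := by ring
  have h4 : (1 - θ)⁻¹ * 1 + -(θ * (1 - θ)⁻¹) = 1 := by
    field_simp
    ring
  rw [meanL2_apply, ← intervalIntegral.integral_add_adjacent_intervals
    (L2I.intervalIntegrable _ (left_mem_Icc.2 zero_le_one) ⟨h0.le, h1.le⟩)
    (L2I.intervalIntegrable _ ⟨h0.le, h1.le⟩ (right_mem_Icc.2 zero_le_one)),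
    IsWindow.integral_pull _ f le_rfl h1.le le_rfl,
    IsWindow.integral_pull_of_disjoint _ f le_rfl h0.le h1.le (Or.inl le_rfl), h3, h4, zero_add,
    meanL2_apply]

end Identities

/-! ### The energy of a rescaled field -/

variable {Γ R : ℝ → EuclideanSpace ℝ (Fin n) →L[ℝ] EuclideanSpace ℝ (Fin n)} {ϵ : Fin n → ℝ}

/-- The integrand of the quadratic form `V ↦ B_t(V, V) + δ ‖V'‖²`. -/
def energyDensity (Γ R : ℝ → EuclideanSpace ℝ (Fin n) →L[ℝ] EuclideanSpace ℝ (Fin n))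
    (ϵ : Fin n → ℝ) (δ t r : ℝ) (v v' : EuclideanSpace ℝ (Fin n)) : ℝ :=
  indexDensity Γ R ϵ t r v v' v v' + δ * ‖v'‖ ^ 2

theorem frameForm_smul_left (c : ℝ) (v w : EuclideanSpace ℝ (Fin n)) :
    frameForm ϵ (c • v) w = c * frameForm ϵ v w := by
  rw [frameForm_eq, frameForm_eq, map_smul, real_inner_smul_left]

theorem frameForm_smul_right (c : ℝ) (v w : EuclideanSpace ℝ (Fin n)) :
    frameForm ϵ v (c • w) = c * frameForm ϵ v w := by
  rw [frameForm_eq, frameForm_eq, real_inner_smul_right]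

/-- Every term of the density has degree two in `(t, v')` jointly, including `δ ‖v'‖²`. The
coefficients on the two sides are evaluated at times that differ by the integer `m = t * a`, so
periodicity identifies them. -/
theorem energyDensity_scale (hΓp : Function.Periodic Γ 1) (hRp : Function.Periodic R 1) {b a t : ℝ}
    {m : ℤ} (hm : t * a = m) (δ r : ℝ) (v v' : EuclideanSpace ℝ (Fin n)) :
    energyDensity Γ R ϵ δ (b * t) r v (b • v') = b ^ 2 * energyDensity Γ R ϵ δ t (b * r + a) v v' := by
  have h : t * (b * r + a) = b * t * r + m * 1 := by rw [mul_add, hm]; ring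
  have h1 : Γ (t * (b * r + a)) = Γ (b * t * r) := by rw [h]; exact (hΓp.int_mul m) _
  have h2 : R (t * (b * r + a)) = R (b * t * r) := by rw [h]; exact (hRp.int_mul m) _
  rw [energyDensity, energyDensity, indexDensity, indexDensity, h1, h2]
  simp only [frameForm_smul_left, frameForm_smul_right, norm_smul, mul_pow, Real.norm_eq_abs,
    sq_abs]
  ring

/-- The quadratic form `V ↦ B_t(V, V) + δ ‖V'‖²`. -/
def energy (Γ R : ℝ → EuclideanSpace ℝ (Fin n) →L[ℝ] EuclideanSpace ℝ (Fin n))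
    (ϵ : Fin n → ℝ) (δ t : ℝ) (V : H1 n) : ℝ :=
  ∫ x in (0 : ℝ)..1, energyDensity Γ R ϵ δ t x (V.val x) (V.der x)

/-- The energy on a subinterval of a field that is a rescaled copy of `v` there. -/
theorem integral_energyDensity_window (hΓp : Function.Periodic Γ 1) (hRp : Function.Periodic R 1)
    {b a s r : ℝ} (h : IsWindow b a s r) (hs : b * s + a = 0) (hr : b * r + a = 1) {t : ℝ} {m : ℤ}
    (hm : t * a = m) (δ : ℝ) {V v : H1 n} (hV : V.val s = 0) (hv : v.fst = 0)
    (hVv : ∀ᵐ x ∂volume.restrict (Ioc s r), V.der x = b • v.der (b * x + a)) :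
    ∫ x in s..r, energyDensity Γ R ϵ δ (b * t) x (V.val x) (V.der x)
      = b * energy Γ R ϵ δ t v := by
  -- Both sides vanish at the left end of the window and have the same derivative on it.
  have hval : ∀ x ∈ Icc s r, V.val x = v.val (b * x + a) := by
    intro x hx
    have h1 := V.val_sub_val (s := s) (r := x) ⟨h.nonneg, h.le.trans h.le_one⟩
      ⟨h.nonneg.trans hx.1, hx.2.trans h.le_one⟩
    have h2 : ∫ z in s..x, V.snd z = ∫ z in s..x, b • v.der (b * z + a) := by
      refine intervalIntegral.integral_congr_ae_restrict ?_
      rw [uIoc_of_le hx.1]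
      exact ae_restrict_of_ae_restrict_of_subset (Ioc_subset_Ioc_right hx.2) hVv
    rw [h2, intervalIntegral.integral_smul, intervalIntegral.smul_integral_comp_mul_add, hs, hV,
      sub_zero] at h1
    rw [h1, H1.val, hv, zero_add]
  have h3 : ∫ x in s..r, energyDensity Γ R ϵ δ (b * t) x (V.val x) (V.der x)
      = ∫ x in s..r, b ^ 2 * energyDensity Γ R ϵ δ t (b * x + a) (v.val (b * x + a))
          (v.der (b * x + a)) := by
    refine intervalIntegral.integral_congr_ae_restrict ?_
    rw [uIoc_of_le h.le]
    filter_upwards [hVv, ae_restrict_mem measurableSet_Ioc] with x hx hxm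
    rw [hx, hval x (Ioc_subset_Icc_self hxm), energyDensity_scale hΓp hRp hm]
  rw [h3, intervalIntegral.integral_const_mul, intervalIntegral.integral_comp_mul_add
    (fun y ↦ energyDensity Γ R ϵ δ t y (v.val y) (v.der y)) h.pos.ne', hs, hr, energy, smul_eq_mul,
    ← mul_assoc, pow_two, mul_assoc b b, mul_inv_cancel₀ h.pos.ne', mul_one]

theorem intervalIntegrable_energyDensity (hΓ : Continuous Γ) (hR : Continuous R) (δ t : ℝ)
    (V : H1 n) {s r : ℝ} (hs : s ∈ Icc (0 : ℝ) 1) (hr : r ∈ Icc (0 : ℝ) 1) :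
    IntervalIntegrable (fun x ↦ energyDensity Γ R ϵ δ t x (V.val x) (V.der x)) volume s r := by
  have h1 : IntegrableOn (fun x ↦ energyDensity Γ R ϵ δ t x (V.val x) (V.der x)) (Icc (0 : ℝ) 1) :=
    (integrable_indexDensity LinearIsometry.id hΓ hR t V V).add
      ((memLp_two_iff_integrable_sq_norm (Lp.memLp V.snd).1).1 (Lp.memLp V.snd) |>.const_mul δ)
  rw [intervalIntegrable_iff]
  exact h1.mono_set (uIoc_subset_uIcc.trans (ordConnected_Icc.uIcc_subset hs hr))

/-- When the initial value vanishes, the norm of `H¹` is the `L²` norm of the derivative. The shift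
by `δ` then has a local density and splits under cutting like the rest of the form. -/
theorem energy_eq (hΓ : Continuous Γ) (hR : Continuous R) (δ t : ℝ) {V : H1 n} (hV : V.fst = 0) :
    energy Γ R ϵ δ t V = coeffForm Γ R ϵ t V V + δ * ‖V‖ ^ 2 := by
  have h1 : ‖V‖ ^ 2 = ∫ x in (0 : ℝ)..1, ‖V.der x‖ ^ 2 := by
    rw [WithLp.prod_norm_sq_eq_of_L2, hV, norm_zero, zero_pow two_ne_zero, zero_add,
      ← real_inner_self_eq_norm_sq, L2.inner_def, intervalIntegral.integral_of_le zero_le_one,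
      ← integral_Icc_eq_integral_Ioc]
    exact integral_congr_ae (ae_of_all _ fun x ↦ real_inner_self_eq_norm_sq _)
  have h2 : IntervalIntegrable (fun x ↦ ‖V.der x‖ ^ 2) volume 0 1 := by
    rw [intervalIntegrable_iff_integrableOn_Icc_of_le zero_le_one]
    exact (memLp_two_iff_integrable_sq_norm (Lp.memLp V.snd).1).1 (Lp.memLp V.snd)
  have h3 : IntervalIntegrable (fun x ↦ indexDensity Γ R ϵ t x (V.val x) (V.der x) (V.val x)
      (V.der x)) volume 0 1 := by
    rw [intervalIntegrable_iff_integrableOn_Icc_of_le zero_le_one]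
    exact integrable_indexDensity LinearIsometry.id hΓ hR t V V
  rw [h1, energy, coeffForm, ← intervalIntegral.integral_const_mul,
    ← intervalIntegral.integral_add h3 (h2.const_mul δ)]
  rfl

end Cut

/-! ### Quasi-additivity of the spectral flow over `[0, N]` -/

section QuasiAdditive

variable {n : ℕ} {θ : ℝ} {Γ R : ℝ → EuclideanSpace ℝ (Fin n) →L[ℝ] EuclideanSpace ℝ (Fin n)}
  {ϵ : Fin n → ℝ}

/-- The inclusion of the periodic fields. -/
def inclPer : H1per n →ₗᵢ[ℝ] H1 n := (H1per n).subtypeₗᵢ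
theorem inclPer_signPer (V : H1per n) : inclPer (signPer ϵ V) = signH1 ϵ (inclPer V) := rfl
/-- The quadratic form of the shifted index form on periodic fields. -/
def shiftedForm (hΓ : Continuous Γ) (hR : Continuous R) (ϵ : Fin n → ℝ) (δ t : ℝ) :
    QuadraticForm ℝ (H1per n) :=
  opForm (H := H1per n) (shift (indexOp inclPer hΓ hR ϵ t) (-δ))

theorem shiftedForm_eq_energy (hΓ : Continuous Γ) (hR : Continuous R) (δ t : ℝ) {V : H1per n}
    (hV : fstPer V = 0) : shiftedForm hΓ hR ϵ δ t V = energy Γ R ϵ δ t V.1 := by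
  rw [shiftedForm, opForm_shift, opForm_apply, inner_indexOp_eq, energy_eq (V := V.1) hΓ hR δ t hV, neg_mul,
    sub_neg_eq_add]
  rfl

/-- The glued field vanishes at `0` and at `θ`, so on either side it is a rescaled copy of `V` or
`W` in both value and derivative. The integrality of `θ * t` lets the second copy see the
coefficients from the start of a period. -/
theorem energy_primPer_add (hΓ : Continuous Γ) (hR : Continuous R)
    (hΓp : Function.Periodic Γ 1) (hRp : Function.Periodic R 1) (h0 : 0 < θ) (h1 : θ < 1)
    {t : ℝ} {m : ℤ} (hm : θ * t = m) (δ : ℝ) {V W : H1per n} (hV : fstPer V = 0)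
    (hW : fstPer W = 0) :
    energy Γ R ϵ δ t (primPer ((isWindow_ext_left h0 h1).pull (sndPer V))
        + primPer ((isWindow_ext_right h0 h1).pull (sndPer W))).1
      = θ⁻¹ * energy Γ R ϵ δ (θ * t) V.1 + (1 - θ)⁻¹ * energy Γ R ϵ δ ((1 - θ) * t) W.1 := by
  have h2 : 0 < 1 - θ := by linarith
  set f := (isWindow_ext_left h0 h1).pull (sndPer V) with hf
  set g := (isWindow_ext_right h0 h1).pull (sndPer W) with hg
  set U : H1per n := primPer f + primPer g with hU
  have hmf : meanL2 f = 0 := by rw [hf, meanL2_ext_left h0 h1]; exact meanL2_snd V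
  have hmg : meanL2 g = 0 := by rw [hg, meanL2_ext_right h0 h1]; exact meanL2_snd W
  have hsnd : U.1.snd = f + g := by
    rw [← sndPer_apply, hU, map_add, sndPer_primPer hmf, sndPer_primPer hmg]
  have hfst : U.1.fst = 0 := by
    rw [← fstPer_apply, hU, map_add, fstPer_primPer, fstPer_primPer, add_zero]
  have hI0 : (0 : ℝ) ∈ Icc (0 : ℝ) 1 := left_mem_Icc.2 zero_le_one
  have hI1 : (1 : ℝ) ∈ Icc (0 : ℝ) 1 := right_mem_Icc.2 zero_le_one
  have hIθ : θ ∈ Icc (0 : ℝ) 1 := ⟨h0.le, h1.le⟩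
  have hder : ∀ᵐ x ∂volume.restrict (Icc (0 : ℝ) 1), U.1.der x = f x + g x := by
    rw [H1.der, hsnd]
    exact Lp.coeFn_add f g
  have hval0 : U.1.val 0 = 0 := by rw [H1.val_zero, hfst]
  have hvalθ : U.1.val θ = 0 := by
    have := U.1.val_sub_val hI0 hIθ
    rw [hval0, sub_zero, hsnd, L2I.integral_add f g hI0 hIθ,
      IsWindow.integral_pull _ _ le_rfl h0.le le_rfl,
      IsWindow.integral_pull_of_disjoint _ _ le_rfl h0.le h1.le (Or.inl le_rfl), mul_zero,
      add_zero, add_zero, add_zero, inv_mul_cancel₀ h0.ne'] at this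
    rw [this]
    exact meanL2_snd V
  have hleft : ∀ᵐ x ∂volume.restrict (Ioc 0 θ), U.1.der x = θ⁻¹ • V.1.der (θ⁻¹ * x + 0) := by
    have hsub : Ioc 0 θ ⊆ Icc (0 : ℝ) 1 := (isWindow_ext_left h0 h1).subset
    filter_upwards [ae_restrict_of_ae_restrict_of_subset hsub hder,
      ae_restrict_of_ae_restrict_of_subset hsub ((isWindow_ext_left h0 h1).coeFn_pull (sndPer V)),
      ae_restrict_of_ae_restrict_of_subset hsub ((isWindow_ext_right h0 h1).coeFn_pull (sndPer W)),
      ae_restrict_mem measurableSet_Ioc] with x e1 e2 e3 hx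
    have hx2 : x ∉ Ioc θ 1 := fun hh ↦ absurd hh.1 (not_lt.2 hx.2)
    rw [e1, hf, hg, e2, e3, indicator_of_mem hx, indicator_of_notMem hx2, add_zero]
    rfl
  have hright : ∀ᵐ x ∂volume.restrict (Ioc θ 1),
      U.1.der x = (1 - θ)⁻¹ • W.1.der ((1 - θ)⁻¹ * x + -(θ * (1 - θ)⁻¹)) := by
    have hsub : Ioc θ 1 ⊆ Icc (0 : ℝ) 1 := (isWindow_ext_right h0 h1).subset
    filter_upwards [ae_restrict_of_ae_restrict_of_subset hsub hder,
      ae_restrict_of_ae_restrict_of_subset hsub ((isWindow_ext_left h0 h1).coeFn_pull (sndPer V)),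
      ae_restrict_of_ae_restrict_of_subset hsub ((isWindow_ext_right h0 h1).coeFn_pull (sndPer W)),
      ae_restrict_mem measurableSet_Ioc] with x e1 e2 e3 hx
    have hx2 : x ∉ Ioc 0 θ := fun hh ↦ absurd hh.2 (not_le.2 hx.1)
    rw [e1, hf, hg, e2, e3, indicator_of_notMem hx2, indicator_of_mem hx, zero_add]
    rfl
  -- The left window has offset `0`, hence shift `0`; for the right window the shift is `(1 - θ) * t
  -- * (-θ / (1 - θ)) = -θ * t = -m`.
  have i1 := integral_energyDensity_window (ϵ := ϵ) hΓp hRp (isWindow_ext_left h0 h1)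
    (by simp) (by rw [add_zero, inv_mul_cancel₀ h0.ne']) (t := θ * t) (m := 0) (by simp) (v := V.1) δ hval0
    hV hleft
  have i2 := integral_energyDensity_window (ϵ := ϵ) hΓp hRp (isWindow_ext_right h0 h1)
    (by ring) (by field_simp; ring) (t := (1 - θ) * t) (m := -m)
    (by push_cast; rw [← hm]; field_simp) (v := W.1) δ hvalθ hW hright
  rw [inv_mul_cancel_left₀ h0.ne'] at i1
  rw [inv_mul_cancel_left₀ h2.ne'] at i2
  rw [← i1, ← i2, energy, intervalIntegral.integral_add_adjacent_intervals
    (intervalIntegrable_energyDensity hΓ hR δ t _ hI0 hIθ)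
    (intervalIntegrable_energyDensity hΓ hR δ t _ hIθ hI1)]

theorem signPer_signPer (hϵ : ∀ i, ϵ i = 1 ∨ ϵ i = -1) (V : H1per n) :
    signPer ϵ (signPer ϵ V) = V :=
  sign_sign (ι := (H1per n).subtypeₗᵢ) (fun _ ↦ rfl) hϵ V

theorem finrank_range_le_of_euclidean {V : Type*} [AddCommGroup V] [Module ℝ V]
    (f : EuclideanSpace ℝ (Fin n) →ₗ[ℝ] V) : Module.finrank ℝ f.range ≤ n :=
  (LinearMap.finrank_range_le f).trans (by simp)

/-- The map of periodic fields that rescales the derivative to a subinterval. -/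
def IsWindow.perMap {b a s r : ℝ} (h : IsWindow b a s r) : H1per n →ₗ[ℝ] H1per n :=
  primPer ∘ₗ h.pull ∘ₗ sndPer

theorem IsWindow.perMap_apply {b a s r : ℝ} (h : IsWindow b a s r) (V : H1per n) :
    h.perMap V = primPer (h.pull (sndPer V)) := rfl

theorem IsWindow.signPer_perMap {b a s r : ℝ} (h : IsWindow b a s r) (V : H1per n) :
    signPer ϵ (h.perMap V) = h.perMap (signPer ϵ V) := by
  rw [perMap_apply, perMap_apply, signPer_primPer, ← pull_signL2, sndPer_signPer]

/-- The rescaled constant fields. -/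
def IsWindow.constMap {b a s r : ℝ} (h : IsWindow b a s r) :
    EuclideanSpace ℝ (Fin n) →ₗ[ℝ] H1per n :=
  primPer ∘ₗ h.pull ∘ₗ constL2

theorem IsWindow.constMap_apply {b a s r : ℝ} (h : IsWindow b a s r)
    (v : EuclideanSpace ℝ (Fin n)) : h.constMap v = primPer (h.pull (constL2 v)) := rfl

theorem IsWindow.signPer_constMap {b a s r : ℝ} (h : IsWindow b a s r)
    (v : EuclideanSpace ℝ (Fin n)) :
    signPer ϵ (h.constMap v) = h.constMap (signMap ϵ v) := by
  rw [constMap_apply, constMap_apply, signPer_primPer, ← pull_signL2, signL2_constL2]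

theorem sndPer_primPer_eq (f : L2I n) : sndPer (primPer f) = f - constL2 (meanL2 f) :=
  mkPer_snd 0 f

theorem sub_constPer (V : H1per n) : V - constPer (fstPer V) = primPer (sndPer V) :=
  sub_eq_of_eq_add' (constPer_add_primPer V).symm

theorem primPer_sndPer {V : H1per n} (hV : fstPer V = 0) : primPer (sndPer V) = V := by
  rw [← sub_constPer, hV, map_zero, sub_zero]

/-! ### Cutting and regluing periodic fields -/

section Maps

variable (h0 : 0 < θ) (h1 : θ < 1)

theorem sndPer_perMap_add (V W : H1per n) :
    sndPer ((isWindow_ext_left h0 h1).perMap V + (isWindow_ext_right h0 h1).perMap W)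
      = (isWindow_ext_left h0 h1).pull (sndPer V) + (isWindow_ext_right h0 h1).pull (sndPer W) := by
  rw [map_add, IsWindow.perMap_apply, IsWindow.perMap_apply,
    sndPer_primPer (by rw [meanL2_ext_left h0 h1]; exact meanL2_snd V),
    sndPer_primPer (by rw [meanL2_ext_right h0 h1]; exact meanL2_snd W)]

theorem res_left_perMap_add {V W : H1per n} (hV : fstPer V = 0) :
    (isWindow_res_left h0 h1).perMap
      ((isWindow_ext_left h0 h1).perMap V + (isWindow_ext_right h0 h1).perMap W) = V := by
  rw [IsWindow.perMap_apply, sndPer_perMap_add h0 h1, map_add, res_left_ext_left h0 h1, res_left_ext_right h0 h1,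
    add_zero, primPer_sndPer hV]

theorem res_right_perMap_add {V W : H1per n} (hW : fstPer W = 0) :
    (isWindow_res_right h0 h1).perMap
      ((isWindow_ext_left h0 h1).perMap V + (isWindow_ext_right h0 h1).perMap W) = W := by
  rw [IsWindow.perMap_apply, sndPer_perMap_add h0 h1, map_add, res_right_ext_left h0 h1, res_right_ext_right h0 h1,
    zero_add, primPer_sndPer hW]

/-- Regluing loses the initial value and the means of the derivative on the two subintervals, each a
vector in `ℝⁿ`. This is the defect space, of dimension at most `3 * n`. -/
theorem sub_perMap_add (V : H1per n) :
    V - ((isWindow_ext_left h0 h1).perMap ((isWindow_res_left h0 h1).perMap V)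
      + (isWindow_ext_right h0 h1).perMap ((isWindow_res_right h0 h1).perMap V))
      = constPer (fstPer V)
        + (isWindow_ext_left h0 h1).constMap (meanL2 ((isWindow_res_left h0 h1).pull (sndPer V)))
        + (isWindow_ext_right h0 h1).constMap
          (meanL2 ((isWindow_res_right h0 h1).pull (sndPer V))) := by
  have h3 := sub_constPer V
  rw [sub_eq_iff_eq_add, ← ext_res_add h0 h1 (sndPer V), map_add] at h3
  simp only [IsWindow.perMap_apply, IsWindow.constMap_apply, sndPer_primPer_eq, map_sub]
  nth_rewrite 1 [h3]
  abel

end Maps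

/-- Gluing is applied with `D` the fields vanishing at `0`, complemented by the constant fields
`C₀`, and with `C` spanned by the constants and the two families of rescaled constants. The error is
at most `3 * n + 2 * n`. -/
theorem abs_sub_le_of_eventually_posIdx (hΓ : Continuous Γ) (hR : Continuous R)
    (hΓp : Function.Periodic Γ 1) (hRp : Function.Periodic R 1)
    (hϵ : ∀ i, ϵ i = 1 ∨ ϵ i = -1) (h0 : 0 < θ) (h1 : θ < 1) {N P M δ : ℝ} {m : ℤ} (hm : N = m)
    (hθN : θ * M = N) (hθP : (1 - θ) * M = P) {k k₁ k₂ : ℤ}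
    (hk : ∀ᶠ E in fdFilter (signPer ϵ : H1per n →ₗ[ℝ] H1per n),
      k = (posIdx (shiftedForm hΓ hR ϵ δ M) E : ℤ) - posIdx (shiftedForm hΓ hR ϵ δ 0) E)
    (hk₁ : ∀ᶠ E in fdFilter (signPer ϵ : H1per n →ₗ[ℝ] H1per n),
      k₁ = (posIdx (shiftedForm hΓ hR ϵ δ N) E : ℤ) - posIdx (shiftedForm hΓ hR ϵ δ 0) E)
    (hk₂ : ∀ᶠ E in fdFilter (signPer ϵ : H1per n →ₗ[ℝ] H1per n),
      k₂ = (posIdx (shiftedForm hΓ hR ϵ δ P) E : ℤ) - posIdx (shiftedForm hΓ hR ϵ δ 0) E) :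
    |k - (k₁ + k₂)| ≤ 5 * n := by
  have h2 : 0 < 1 - θ := by linarith
  set e₁ : H1per n →ₗ[ℝ] H1per n := (isWindow_ext_left h0 h1).perMap
  set e₂ : H1per n →ₗ[ℝ] H1per n := (isWindow_ext_right h0 h1).perMap
  set C₁ : Submodule ℝ (H1per n) :=
    ((isWindow_ext_left h0 h1).constMap : EuclideanSpace ℝ (Fin n) →ₗ[ℝ] H1per n).range
  set C₂ : Submodule ℝ (H1per n) :=
    ((isWindow_ext_right h0 h1).constMap : EuclideanSpace ℝ (Fin n) →ₗ[ℝ] H1per n).range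
  set C₀ : Submodule ℝ (H1per n) :=
    (constPer : EuclideanSpace ℝ (Fin n) →ₗ[ℝ] H1per n).range
  set D : Submodule ℝ (H1per n) := (fstPer : H1per n →ₗ[ℝ] EuclideanSpace ℝ (Fin n)).ker
  have glue := @abs_sub_le_of_gluing (H1per n) _ _ (signPer ϵ : H1per n →ₗ[ℝ] H1per n) e₁ e₂
    (isWindow_res_left h0 h1).perMap (isWindow_res_right h0 h1).perMap (signPer_signPer hϵ)
    (shiftedForm hΓ hR ϵ δ M) (shiftedForm hΓ hR ϵ δ 0) (shiftedForm hΓ hR ϵ δ N)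
    (shiftedForm hΓ hR ϵ δ P) D C₀ (C₀ ⊔ C₁ ⊔ C₂) _ _
  have hfst : ∀ V W, fstPer (e₁ V + e₂ W) = 0 := fun V W ↦ by
    rw [map_add]
    exact add_zero _
  have hDJ : ∀ V ∈ D, signPer ϵ V ∈ D := by
    intro V hV
    rw [LinearMap.mem_ker] at hV ⊢
    rw [fstPer_signPer, hV, map_zero]
  have hCJ : ∀ V ∈ C₀ ⊔ C₁ ⊔ C₂, signPer ϵ V ∈ C₀ ⊔ C₁ ⊔ C₂ := by
    intro V hV
    obtain ⟨x, hx, _, ⟨v, rfl⟩, rfl⟩ := Submodule.mem_sup.1 hV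
    obtain ⟨_, ⟨u, rfl⟩, _, ⟨w, rfl⟩, rfl⟩ := Submodule.mem_sup.1 hx
    rw [map_add, map_add]
    exact Submodule.add_mem_sup (Submodule.add_mem_sup
      ⟨signMap ϵ u, (signPer_constPer ϵ u).symm⟩
      ⟨signMap ϵ w, (IsWindow.signPer_constMap _ w).symm⟩)
      ⟨signMap ϵ v, (IsWindow.signPer_constMap _ v).symm⟩
  have hC₀ : ∀ V, ∃ c ∈ C₀, V - c ∈ D := by
    intro V
    refine ⟨constPer (fstPer V), ⟨_, rfl⟩, ?_⟩
    rw [LinearMap.mem_ker, map_sub, fstPer_constPer, sub_self]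
  have hC : ∀ V, V - (e₁ ((isWindow_res_left h0 h1).perMap V)
      + e₂ ((isWindow_res_right h0 h1).perMap V)) ∈ C₀ ⊔ C₁ ⊔ C₂ := by
    intro V
    rw [sub_perMap_add h0 h1 V]
    exact Submodule.add_mem_sup (Submodule.add_mem_sup ⟨_, rfl⟩ ⟨_, rfl⟩) ⟨_, rfl⟩
  have hQ : ∀ V ∈ D, ∀ W ∈ D, shiftedForm hΓ hR ϵ δ M (e₁ V + e₂ W)
      = θ⁻¹ * shiftedForm hΓ hR ϵ δ N V + (1 - θ)⁻¹ * shiftedForm hΓ hR ϵ δ P W := by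
    intro V hV W hW
    have := energy_primPer_add (ϵ := ϵ) hΓ hR hΓp hRp h0 h1 (t := M) (m := m) (by rw [hθN, hm]) δ
      hV hW
    rw [hθN, hθP] at this
    rw [shiftedForm_eq_energy _ _ _ _ (hfst V W), shiftedForm_eq_energy _ _ _ _ hV,
      shiftedForm_eq_energy _ _ _ _ hW]
    exact this
  -- At time `0` all three times coincide and the shift is the integer `0`, so the reference form
  -- splits into two copies of itself.
  have hQ₀ : ∀ V ∈ D, ∀ W ∈ D, shiftedForm hΓ hR ϵ δ 0 (e₁ V + e₂ W)
      = θ⁻¹ * shiftedForm hΓ hR ϵ δ 0 V + (1 - θ)⁻¹ * shiftedForm hΓ hR ϵ δ 0 W := by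
    intro V hV W hW
    have := energy_primPer_add (ϵ := ϵ) hΓ hR hΓp hRp h0 h1 (t := 0) (m := 0) (by simp) δ hV hW
    rw [mul_zero, mul_zero] at this
    rw [shiftedForm_eq_energy _ _ _ _ (hfst V W), shiftedForm_eq_energy _ _ _ _ hV,
      shiftedForm_eq_energy _ _ _ _ hW]
    exact this
  have d0 : Module.finrank ℝ C₀ ≤ n := finrank_range_le_of_euclidean _
  have d1 : Module.finrank ℝ C₁ ≤ n := finrank_range_le_of_euclidean _
  have d2 : Module.finrank ℝ C₂ ≤ n := finrank_range_le_of_euclidean _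
  have d3 := Submodule.finrank_add_le_finrank_add_finrank C₀ C₁
  have d4 := Submodule.finrank_add_le_finrank_add_finrank (C₀ ⊔ C₁) C₂
  refine (glue hDJ hCJ (IsWindow.signPer_perMap _) (IsWindow.signPer_perMap _) hC₀
    (fun V ↦ fstPer_primPer _) (fun V ↦ fstPer_primPer _) hC
    (fun V hV W _ ↦ res_left_perMap_add h0 h1 hV) (fun V _ W hW ↦ res_right_perMap_add h0 h1 hW)
    (inv_pos.2 h0) (inv_pos.2 h2) hQ hQ₀ hk hk₁ hk₂).trans ?_
  omega

/-- `k` is the spectral flow of the index forms with coefficients `Γ`, `R` over `[0, N]`. -/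
def IsCoeffSpectralFlow (Γ R : ℝ → EuclideanSpace ℝ (Fin n) →L[ℝ] EuclideanSpace ℝ (Fin n))
    (ϵ : Fin n → ℝ) (N : ℝ) (k : ℤ) : Prop :=
  IsFormSpectralFlow (𝕜 := ℝ) (H := H1per n) (fun t V W ↦ coeffForm Γ R ϵ (N * t) (inclPer V)
     (inclPer W)) k

theorem IsCoeffSpectralFlow.unique (hΓ : Continuous Γ) (hR : Continuous R)
    (hϵ : ∀ i, ϵ i = 1 ∨ ϵ i = -1) {N : ℝ} {k k' : ℤ} (h : IsCoeffSpectralFlow Γ R ϵ N k)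
    (h' : IsCoeffSpectralFlow Γ R ϵ N k') : k = k' := by
  have := @IsFormSpectralFlow.unique n (H1per n) _ _ inclPer (signPer ϵ) Γ R _ ϵ hΓ hR
    inclPer_signPer hϵ N k k'
  exact this h h'

theorem exists_isCoeffSpectralFlow (hΓ : Continuous Γ) (hR : Continuous R)
    (hϵ : ∀ i, ϵ i = 1 ∨ ϵ i = -1)
    (hsymm : ∀ t v w, frameForm ϵ (R t v) w = frameForm ϵ (R t w) v) (N : ℝ) :
    ∃ k, IsCoeffSpectralFlow Γ R ϵ N k := by
  have := @exists_isFormSpectralFlow n (H1per n) _ _ inclPer (signPer ϵ) Γ R _ ϵ hΓ hR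
    inclPer_signPer hϵ hsymm N
  exact this

theorem IsCoeffSpectralFlow.eventually_eq (hΓ : Continuous Γ) (hR : Continuous R) {N : ℝ} {k : ℤ}
    (h : IsCoeffSpectralFlow Γ R ϵ N k) :
    ∀ᶠ δ in 𝓝[>] (0 : ℝ), ∀ᶠ E in fdFilter (signPer ϵ : H1per n →ₗ[ℝ] H1per n),
      k = (posIdx (shiftedForm hΓ hR ϵ δ N) E : ℤ) - posIdx (shiftedForm hΓ hR ϵ δ 0) E := by
  have := @IsFormSpectralFlow.eventually_eq n (H1per n) _ _ inclPer (signPer ϵ) Γ R _ ϵ hΓ hR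
    inclPer_signPer N k
  exact this h

/-- The spectral flow over `[0, N]` is additive in `N` up to a bounded error. -/
theorem abs_spectralFlow_sub_le (hΓ : Continuous Γ) (hR : Continuous R)
    (hΓp : Function.Periodic Γ 1) (hRp : Function.Periodic R 1)
    (hϵ : ∀ i, ϵ i = 1 ∨ ϵ i = -1) {N P : ℕ} (hN : 1 ≤ N) (hP : 1 ≤ P) {k k₁ k₂ : ℤ}
    (hk : IsCoeffSpectralFlow Γ R ϵ ((N + P : ℕ) : ℝ) k) (hk₁ : IsCoeffSpectralFlow Γ R ϵ N k₁)
    (hk₂ : IsCoeffSpectralFlow Γ R ϵ P k₂) :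
    |k - (k₁ + k₂)| ≤ 5 * n := by
  have hN' : (0 : ℝ) < N := by exact_mod_cast hN
  have hP' : (0 : ℝ) < P := by exact_mod_cast hP
  -- The cut lies at time `N` of `[0, N + P]`, a whole number of periods.
  set θ : ℝ := N / (N + P) with hθ
  have h0 : 0 < θ := by positivity
  have h1 : θ < 1 := by rw [hθ, div_lt_one (by positivity)]; linarith
  have hθN : θ * ((N + P : ℕ) : ℝ) = N := by rw [hθ]; push_cast; field_simp
  have hθP : (1 - θ) * ((N + P : ℕ) : ℝ) = P := by rw [sub_mul, hθN]; push_cast; ring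
  obtain ⟨δ, hk, hk₁, hk₂⟩ := ((hk.eventually_eq hΓ hR).and
    ((hk₁.eventually_eq hΓ hR).and (hk₂.eventually_eq hΓ hR))).exists
  exact abs_sub_le_of_eventually_posIdx hΓ hR hΓp hRp hϵ h0 h1 (m := N) (by simp) hθN hθP hk hk₁ hk₂

end QuasiAdditive

/-! ### Quasi-additive sequences -/

section QuasiAdditiveSequence

/-- Adding the constant `K` makes the sequence subadditive; Fekete's lemma gives the limit as an
infimum, and the infimum property is the one-sided estimate. -/
theorem exists_tendsto_of_quasiAdditive {a : ℕ → ℝ} {K : ℝ}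
    (h : ∀ N P : ℕ, 1 ≤ N → 1 ≤ P → |a (N + P) - (a N + a P)| ≤ K) :
    ∃ L : ℝ, Tendsto (fun N : ℕ ↦ a N / N) atTop (𝓝 L) ∧ ∀ N : ℕ, 1 ≤ N → L * N ≤ a N + K := by
  have hK : 0 ≤ K := (abs_nonneg _).trans (h 1 1 le_rfl le_rfl)
  -- The value `0` at `N = 0` preserves subadditivity, since nothing is known about `a 0`.
  set u : ℕ → ℝ := fun N ↦ if N = 0 then 0 else a N + K with hu
  have hpos : ∀ N : ℕ, 1 ≤ N → u N = a N + K := fun N hN ↦ if_neg (by omega)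
  have hsub : Subadditive u := by
    intro N P
    rcases Nat.eq_zero_or_pos N with rfl | hN
    · simp [hu]
    rcases Nat.eq_zero_or_pos P with rfl | hP
    · simp [hu]
    rw [hpos _ hN, hpos _ hP, hpos _ (by omega)]
    linarith [(abs_le.1 (h N P hN hP)).2]
  have hlow : ∀ N : ℕ, (N + 1 : ℝ) * (a 1 - K) ≤ a (N + 1) := by
    intro N
    induction N with
    | zero => simp; linarith
    | succ N ih =>
      have := (abs_le.1 (h (N + 1) 1 (by omega) le_rfl)).1
      push_cast
      linarith
  have hbdd : BddBelow (range fun N : ℕ ↦ u N / N) := by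
    refine ⟨min 0 (a 1 - K), ?_⟩
    rintro _ ⟨N, rfl⟩
    rcases N with _ | N
    · simp
    · refine (min_le_right _ _).trans ?_
      simp only
      rw [hpos _ (by omega), le_div_iff₀ (by positivity)]
      push_cast
      linarith [hlow N]
  refine ⟨hsub.lim, ?_, fun N hN ↦ ?_⟩
  · have h1 := hsub.tendsto_lim hbdd
    have h2 : Tendsto (fun N : ℕ ↦ K / (N : ℝ)) atTop (𝓝 0) :=
      tendsto_const_nhds.div_atTop tendsto_natCast_atTop_atTop
    have h3 := h1.sub h2
    rw [sub_zero] at h3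
    refine h3.congr' ?_
    filter_upwards [eventually_ge_atTop 1] with N hN
    rw [hpos N hN]
    ring
  · have h1 := hsub.lim_le_div hbdd (n := N) (by omega)
    rw [hpos N hN, le_div_iff₀ (by exact_mod_cast hN)] at h1
    exact h1

/-- A quasi-additive sequence has linear growth up to a bounded error. -/
theorem exists_linear_growth {a : ℕ → ℝ} {K : ℝ}
    (h : ∀ N P : ℕ, 1 ≤ N → 1 ≤ P → |a (N + P) - (a N + a P)| ≤ K) :
    ∃ L : ℝ, Tendsto (fun N : ℕ ↦ a N / N) atTop (𝓝 L) ∧ ∀ N : ℕ, 1 ≤ N → |a N - L * N| ≤ K := by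
  obtain ⟨L, hL, h1⟩ := exists_tendsto_of_quasiAdditive h
  -- The hypothesis is invariant under sign change; the negated sequence has limit `-L` and supplies
  -- the opposite estimate.
  obtain ⟨L', hL', h2⟩ := exists_tendsto_of_quasiAdditive (a := fun N ↦ -a N) (K := K)
    fun N P hN hP ↦ by
      rw [← abs_neg]
      convert h N P hN hP using 2
      ring
  have : L' = -L := by
    refine tendsto_nhds_unique hL' ?_
    simpa [neg_div] using hL.neg
  subst this
  refine ⟨L, hL, fun N hN ↦ abs_le.2 ⟨?_, ?_⟩⟩
  · linarith [h1 N hN]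
  · linarith [h2 N hN]

theorem bounded_or_linear_growth {a : ℕ → ℤ} {K : ℕ}
    (h : ∀ N P : ℕ, 1 ≤ N → 1 ≤ P → |a (N + P) - (a N + a P)| ≤ K) :
    ∃ L : ℝ, Tendsto (fun N : ℕ ↦ (a N : ℝ) / N) atTop (𝓝 L) ∧
      ((∃ C : ℤ, ∀ N, 1 ≤ N → |a N| ≤ C) ↔ L = 0) ∧
      ((∃ C : ℤ, ∀ N, 1 ≤ N → |a N| ≤ C) ∨
        (L ≠ 0 ∧ ∃ α : ℝ, ∀ N P : ℕ, 1 ≤ N →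
          L * P - α ≤ (a (N + P) : ℝ) - a N ∧ (a (N + P) : ℝ) - a N ≤ L * P + α)) := by
  obtain ⟨L, hL, hb⟩ := exists_linear_growth (a := fun N ↦ (a N : ℝ)) (K := K) fun N P hN hP ↦ by
    exact_mod_cast h N P hN hP
  have hzero : L = 0 → ∃ C : ℤ, ∀ N, 1 ≤ N → |a N| ≤ C := by
    rintro rfl
    refine ⟨K, fun N hN ↦ ?_⟩
    have := hb N hN
    rw [zero_mul, sub_zero] at this
    exact_mod_cast this
  have hbounded : (∃ C : ℤ, ∀ N, 1 ≤ N → |a N| ≤ C) → L = 0 := by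
    rintro ⟨C, hC⟩
    refine tendsto_nhds_unique hL ?_
    refine squeeze_zero_norm' ?_ (tendsto_const_nhds.div_atTop tendsto_natCast_atTop_atTop :
      Tendsto (fun N : ℕ ↦ (C : ℝ) / N) atTop (𝓝 0))
    filter_upwards [eventually_ge_atTop 1] with N hN
    rw [norm_div, Real.norm_natCast, Real.norm_eq_abs]
    gcongr
    exact_mod_cast hC N hN
  refine ⟨L, hL, ⟨hbounded, hzero⟩, ?_⟩
  by_cases hL0 : L = 0
  · exact Or.inl (hzero hL0)
  -- The error `K` enters once at `N` and once at `N + P`. No condition on `P` is needed, so `P = 0`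
  -- is covered.
  · refine Or.inr ⟨hL0, 2 * K, fun N P hN ↦ ?_⟩
    have h1 := abs_le.1 (hb N hN)
    have h2 := abs_le.1 (hb (N + P) (by omega))
    push_cast at h2
    constructor <;> linarith [h1.1, h1.2, h2.1, h2.2]

end QuasiAdditiveSequence

/-! ### Christoffel symbols and curvature of a metric on a vector space -/

section LocalGeometry

variable {E : Type*} [NormedAddCommGroup E] [NormedSpace ℝ E]

/-- The Christoffel symbols of the first kind of a metric `h`. -/
def firstKind (h : E → E →L[ℝ] E →L[ℝ] ℝ) (y u v w : E) : ℝ :=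
  (1 / 2) * (fderiv ℝ h y u v w + fderiv ℝ h y v u w - fderiv ℝ h y w u v)

/-- The curvature of the connection with Christoffel symbols `Γ`. -/
def localCurvature (Γ : E → E →L[ℝ] E →L[ℝ] E) (y u v w : E) : E :=
  fderiv ℝ Γ y u v w - fderiv ℝ Γ y v u w + Γ y u (Γ y v w) - Γ y v (Γ y u w)

theorem fderiv_clm_apply₂ {F : Type*} [NormedAddCommGroup F] [NormedSpace ℝ F]
    {h : E → E →L[ℝ] E →L[ℝ] F} {y : E} (hh : DifferentiableAt ℝ h y) {p q : E → E}
    {p' q' : E →L[ℝ] E} (hp : HasFDerivAt p p' y) (hq : HasFDerivAt q q' y) (a : E) :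
    fderiv ℝ (fun z ↦ h z (p z) (q z)) y a
      = fderiv ℝ h y a (p y) (q y) + h y (p' a) (q y) + h y (p y) (q' a) := by
  rw [((hh.hasFDerivAt.clm_apply hp).clm_apply hq).fderiv]
  simp
  abel

theorem fderiv_apply₂ {F : Type*} [NormedAddCommGroup F] [NormedSpace ℝ F]
    {h : E → E →L[ℝ] E →L[ℝ] F} {y : E} (hh : DifferentiableAt ℝ h y) (a u v : E) :
    fderiv ℝ (fun z ↦ h z u v) y a = fderiv ℝ h y a u v := by
  simpa using fderiv_clm_apply₂ hh (hasFDerivAt_const u y) (hasFDerivAt_const v y) a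

section Transform

variable {h₀ h₁ : E → E →L[ℝ] E →L[ℝ] ℝ} {ψ : E → E} {y : E}

theorem fderiv_pullback_metric (hh₀ : DifferentiableAt ℝ h₀ y) (hh₁ : DifferentiableAt ℝ h₁ (ψ y))
    (hψ : DifferentiableAt ℝ ψ y) (hψ' : DifferentiableAt ℝ (fderiv ℝ ψ) y)
    (h : ∀ᶠ z in 𝓝 y, ∀ u v, h₀ z u v = h₁ (ψ z) (fderiv ℝ ψ z u) (fderiv ℝ ψ z v)) (a u v : E) :
    fderiv ℝ h₀ y a u v
      = fderiv ℝ h₁ (ψ y) (fderiv ℝ ψ y a) (fderiv ℝ ψ y u) (fderiv ℝ ψ y v)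
        + h₁ (ψ y) (fderiv ℝ (fderiv ℝ ψ) y a u) (fderiv ℝ ψ y v)
        + h₁ (ψ y) (fderiv ℝ ψ y u) (fderiv ℝ (fderiv ℝ ψ) y a v) := by
  have h1 : (fun z ↦ h₀ z u v) =ᶠ[𝓝 y] fun z ↦ (h₁ ∘ ψ) z (fderiv ℝ ψ z u) (fderiv ℝ ψ z v) :=
    h.mono fun z hz ↦ hz u v
  have h2 : ∀ w, HasFDerivAt (fun z ↦ fderiv ℝ ψ z w) ((fderiv ℝ (fderiv ℝ ψ) y).flip w) y := by
    intro w
    simpa using hψ'.hasFDerivAt.clm_apply (hasFDerivAt_const w y)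
  have h3 : DifferentiableAt ℝ (h₁ ∘ ψ) y :=
    DifferentiableAt.comp (G := E →L[ℝ] E →L[ℝ] ℝ) y hh₁ hψ
  rw [← fderiv_apply₂ hh₀, h1.fderiv_eq, fderiv_clm_apply₂ h3 (h2 u) (h2 v),
    fderiv_comp (G := E →L[ℝ] E →L[ℝ] ℝ) y hh₁ hψ]
  simp

/-- Of the six second-derivative terms produced by the product rule, four cancel by symmetry of
`D²ψ` and of `h₁`; the remaining two are equal and absorb the factor `1 / 2`. -/
theorem firstKind_pullback (hh₀ : DifferentiableAt ℝ h₀ y) (hh₁ : DifferentiableAt ℝ h₁ (ψ y))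
    (hψ : ContDiffAt ℝ 2 ψ y) (hsymm : ∀ u v, h₁ (ψ y) u v = h₁ (ψ y) v u)
    (h : ∀ᶠ z in 𝓝 y, ∀ u v, h₀ z u v = h₁ (ψ z) (fderiv ℝ ψ z u) (fderiv ℝ ψ z v)) (u v w : E) :
    firstKind h₀ y u v w
      = firstKind h₁ (ψ y) (fderiv ℝ ψ y u) (fderiv ℝ ψ y v) (fderiv ℝ ψ y w)
        + h₁ (ψ y) (fderiv ℝ (fderiv ℝ ψ) y u v) (fderiv ℝ ψ y w) := by
  have h1 : DifferentiableAt ℝ ψ y := hψ.differentiableAt (by norm_num)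
  have h2 : DifferentiableAt ℝ (fderiv ℝ ψ) y :=
    (hψ.fderiv_right (m := 1) (by norm_num)).differentiableAt (by norm_num)
  have h3 : IsSymmSndFDerivAt ℝ ψ y := hψ.isSymmSndFDerivAt (by simp)
  simp only [firstKind, fderiv_pullback_metric hh₀ hh₁ h1 h2 h]
  rw [h3.eq w u, h3.eq w v, h3.eq v u, hsymm (fderiv ℝ ψ y u) (fderiv ℝ (fderiv ℝ ψ) y v w),
    hsymm (fderiv ℝ ψ y v) (fderiv ℝ (fderiv ℝ ψ) y u w)]
  ring

/-- The two sides have the same `h₁`-product with every vector `Dψ w`. These exhaust the space by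
surjectivity, and `h₁` is nondegenerate. -/
theorem christoffel_pullback {Γ₀ Γ₁ : E →L[ℝ] E →L[ℝ] E} (hh₀ : DifferentiableAt ℝ h₀ y)
    (hh₁ : DifferentiableAt ℝ h₁ (ψ y)) (hψ : ContDiffAt ℝ 2 ψ y)
    (hsymm : ∀ u v, h₁ (ψ y) u v = h₁ (ψ y) v u) (hnd : ∀ u, (∀ v, h₁ (ψ y) u v = 0) → u = 0)
    (hsurj : Function.Surjective (fderiv ℝ ψ y))
    (h : ∀ᶠ z in 𝓝 y, ∀ u v, h₀ z u v = h₁ (ψ z) (fderiv ℝ ψ z u) (fderiv ℝ ψ z v))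
    (hΓ₀ : ∀ u v w, h₀ y (Γ₀ u v) w = firstKind h₀ y u v w)
    (hΓ₁ : ∀ u v w, h₁ (ψ y) (Γ₁ u v) w = firstKind h₁ (ψ y) u v w) (u v : E) :
    fderiv ℝ ψ y (Γ₀ u v)
      = Γ₁ (fderiv ℝ ψ y u) (fderiv ℝ ψ y v) + fderiv ℝ (fderiv ℝ ψ) y u v := by
  rw [← sub_eq_zero]
  refine hnd _ fun w' ↦ ?_
  obtain ⟨w, rfl⟩ := hsurj w'
  rw [map_sub, map_add]
  simp only [sub_apply, add_apply]
  rw [← h.self_of_nhds, hΓ₀, hΓ₁, firstKind_pullback hh₀ hh₁ hψ hsymm h]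
  ring

/-- The transformation law of the curvature under a change of coordinates. -/
theorem localCurvature_pullback {Γ₀ Γ₁ : E → E →L[ℝ] E →L[ℝ] E} (hΓ₀ : DifferentiableAt ℝ Γ₀ y)
    (hΓ₁ : DifferentiableAt ℝ Γ₁ (ψ y)) (hψ : ContDiffAt ℝ 3 ψ y)
    (h : ∀ᶠ z in 𝓝 y, ∀ u v, fderiv ℝ ψ z (Γ₀ z u v)
      = Γ₁ (ψ z) (fderiv ℝ ψ z u) (fderiv ℝ ψ z v) + fderiv ℝ (fderiv ℝ ψ) z u v) (a b w : E) :
    fderiv ℝ ψ y (localCurvature Γ₀ y a b w)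
      = localCurvature Γ₁ (ψ y) (fderiv ℝ ψ y a) (fderiv ℝ ψ y b) (fderiv ℝ ψ y w) := by
  have h1 : DifferentiableAt ℝ ψ y := hψ.differentiableAt (by norm_num)
  have hψ2 : ContDiffAt ℝ 2 (fderiv ℝ ψ) y := hψ.fderiv_right (by norm_num)
  have h2 : DifferentiableAt ℝ (fderiv ℝ ψ) y := hψ2.differentiableAt (by norm_num)
  have h3 : DifferentiableAt ℝ (fderiv ℝ (fderiv ℝ ψ)) y :=
    (hψ2.fderiv_right (m := 1) (by norm_num)).differentiableAt (by norm_num)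
  have hs2 : IsSymmSndFDerivAt ℝ ψ y := (hψ.of_le (m := 2) (by norm_num)).isSymmSndFDerivAt (by simp)
  have hs3 : IsSymmSndFDerivAt ℝ (fderiv ℝ ψ) y := hψ2.isSymmSndFDerivAt (by simp)
  have hJ : ∀ v, HasFDerivAt (fun z ↦ fderiv ℝ ψ z v) ((fderiv ℝ (fderiv ℝ ψ) y).flip v) y := by
    intro v
    simpa using h2.hasFDerivAt.clm_apply (hasFDerivAt_const v y)
  -- This differentiates the transformation law of the Christoffel symbols. After antisymmetrizing
  -- in the first two arguments the third derivatives of `ψ` cancel, and the second-derivative terms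
  -- cancel against the quadratic ones.
  have key : ∀ a u v : E, fderiv ℝ (fderiv ℝ ψ) y a (Γ₀ y u v)
      + fderiv ℝ ψ y (fderiv ℝ Γ₀ y a u v)
      = fderiv ℝ Γ₁ (ψ y) (fderiv ℝ ψ y a) (fderiv ℝ ψ y u) (fderiv ℝ ψ y v)
        + Γ₁ (ψ y) (fderiv ℝ (fderiv ℝ ψ) y a u) (fderiv ℝ ψ y v)
        + Γ₁ (ψ y) (fderiv ℝ ψ y u) (fderiv ℝ (fderiv ℝ ψ) y a v)
        + fderiv ℝ (fderiv ℝ (fderiv ℝ ψ)) y a u v := by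
    intro a u v
    have e1 : (fun z ↦ fderiv ℝ ψ z (Γ₀ z u v)) =ᶠ[𝓝 y] fun z ↦
        (Γ₁ ∘ ψ) z (fderiv ℝ ψ z u) (fderiv ℝ ψ z v) + fderiv ℝ (fderiv ℝ ψ) z u v :=
      h.mono fun z hz ↦ hz u v
    have e2 : HasFDerivAt (fun z ↦ Γ₀ z u v) (((fderiv ℝ Γ₀ y).flip u).flip v) y := by
      simpa using (hΓ₀.hasFDerivAt.clm_apply (hasFDerivAt_const u y)).clm_apply
        (hasFDerivAt_const v y)
    have e0 : DifferentiableAt ℝ (Γ₁ ∘ ψ) y :=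
      DifferentiableAt.comp (G := E →L[ℝ] E →L[ℝ] E) y hΓ₁ h1
    have e3 := congrArg (fun L : E →L[ℝ] E ↦ L a) e1.fderiv_eq
    have e4 : DifferentiableAt ℝ (fun z ↦ (Γ₁ ∘ ψ) z (fderiv ℝ ψ z u) (fderiv ℝ ψ z v)) y :=
      (e0.clm_apply (hJ u).differentiableAt).clm_apply (hJ v).differentiableAt
    have e5 : DifferentiableAt ℝ (fun z ↦ fderiv ℝ (fderiv ℝ ψ) z u v) y :=
      (h3.clm_apply (differentiableAt_const u)).clm_apply (differentiableAt_const v)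
    rw [(h2.hasFDerivAt.clm_apply e2).fderiv, fderiv_fun_add e4 e5, add_apply, add_apply,
      fderiv_clm_apply₂ e0 (hJ u) (hJ v), fderiv_apply₂ h3,
      fderiv_comp (G := E →L[ℝ] E →L[ℝ] E) y hΓ₁ h1] at e3
    simp only [ContinuousLinearMap.comp_apply, ContinuousLinearMap.flip_apply,
      Function.comp_apply] at e3
    rw [← e3]
    abel
  have key' : ∀ a u v : E, fderiv ℝ ψ y (fderiv ℝ Γ₀ y a u v) = _ :=
    fun a u v ↦ eq_sub_of_add_eq' (key a u v)
  have hy := h.self_of_nhds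
  simp only [localCurvature, map_sub, map_add, key', hy]
  rw [hs2.eq b a, hs3.eq b a]
  abel

end Transform

set_option maxSynthPendingDepth 3 in
/-- The pair symmetry of the curvature of a metric. -/
theorem localCurvature_symm {h : E → E →L[ℝ] E →L[ℝ] ℝ} {Γ : E → E →L[ℝ] E →L[ℝ] E} {y : E}
    (hh : ContDiffAt ℝ 2 h y) (hsymm : ∀ᶠ z in 𝓝 y, ∀ u v, h z u v = h z v u)
    (hΓ : DifferentiableAt ℝ Γ y) (hΓs : ∀ u v, Γ y u v = Γ y v u)
    (hC : ∀ᶠ z in 𝓝 y, ∀ u v w, h z (Γ z u v) w = firstKind h z u v w) (c v z : E) :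
    h y (localCurvature Γ y c v c) z = h y (localCurvature Γ y c z c) v := by
  have h1 : DifferentiableAt ℝ h y := hh.differentiableAt (by norm_num)
  have h2 : DifferentiableAt ℝ (fderiv ℝ h) y :=
    (hh.fderiv_right (m := 1) (by norm_num)).differentiableAt (by norm_num)
  have hs : IsSymmSndFDerivAt ℝ h y := hh.isSymmSndFDerivAt (by simp)
  have hD : ∀ a u v, fderiv ℝ h y a u v = fderiv ℝ h y a v u := by
    intro a u v
    rw [← fderiv_apply₂ h1, ← fderiv_apply₂ h1]
    exact congrArg (fun L : E →L[ℝ] ℝ ↦ L a)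
      (Filter.EventuallyEq.fderiv_eq (hsymm.mono fun z hz ↦ hz u v))
  have hsymm' : ∀ᶠ z in 𝓝 y, ∀ a u v, fderiv ℝ h z a u v = fderiv ℝ h z a v u := by
    have hd : ∀ᶠ z in 𝓝 y, DifferentiableAt ℝ h z := by
      filter_upwards [hh.eventually (by simp)] with z hz using hz.differentiableAt (by norm_num)
    filter_upwards [hsymm.eventually_nhds, hd] with z hz hdz a u v
    rw [← fderiv_apply₂ hdz, ← fderiv_apply₂ hdz]
    exact congrArg (fun L : E →L[ℝ] ℝ ↦ L a)
      (Filter.EventuallyEq.fderiv_eq (hz.mono fun z hz ↦ hz u v))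
  have hDD : ∀ a b u v, fderiv ℝ (fderiv ℝ h) y a b u v = fderiv ℝ (fderiv ℝ h) y a b v u := by
    have e : ∀ a b u v, fderiv ℝ (fun z ↦ fderiv ℝ h z b u v) y a
        = fderiv ℝ (fderiv ℝ h) y a b u v := by
      intro a b u v
      rw [fderiv_apply₂ (h := fun z ↦ fderiv ℝ h z b) (h2.clm_apply (differentiableAt_const b))]
      rw [(h2.hasFDerivAt.clm_apply (hasFDerivAt_const b y)).fderiv]
      simp
    intro a b u v
    rw [← e, ← e]
    exact congrArg (fun L : E →L[ℝ] ℝ ↦ L a)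
      (Filter.EventuallyEq.fderiv_eq (hsymm'.mono fun z hz ↦ hz b u v))
  -- The connection is metric: summing the defining relation over the two slots leaves the
  -- derivative of `h`.
  have hcompat : ∀ a u v, fderiv ℝ h y a u v = h y (Γ y a u) v + h y (Γ y a v) u := by
    intro a u v
    rw [hC.self_of_nhds, hC.self_of_nhds, firstKind, firstKind, hD u a v, hD a v u, hD v a u]
    ring
  -- Differentiating the relation that defines `Γ` expresses derivatives of `Γ` by second
  -- derivatives of `h` and quadratic terms in `Γ`. Symmetry in `v` and `z` is then visible once
  -- partial derivatives commute.
  have key : ∀ a u v w, fderiv ℝ h y a (Γ y u v) w + h y (fderiv ℝ Γ y a u v) w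
      = (1 / 2) * (fderiv ℝ (fderiv ℝ h) y a u v w + fderiv ℝ (fderiv ℝ h) y a v u w
        - fderiv ℝ (fderiv ℝ h) y a w u v) := by
    intro a u v w
    have e1 : (fun z ↦ h z (Γ z u v) w) =ᶠ[𝓝 y] fun z ↦ (1 / 2) * (fderiv ℝ h z u v w
        + fderiv ℝ h z v u w - fderiv ℝ h z w u v) := hC.mono fun z hz ↦ hz u v w
    have e2 : HasFDerivAt (fun z ↦ Γ z u v) (((fderiv ℝ Γ y).flip u).flip v) y := by
      simpa using (hΓ.hasFDerivAt.clm_apply (hasFDerivAt_const u y)).clm_apply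
        (hasFDerivAt_const v y)
    have e3 : ∀ b u v, HasFDerivAt (fun z ↦ fderiv ℝ h z b u v)
        ((((fderiv ℝ (fderiv ℝ h) y).flip b).flip u).flip v) y := by
      intro b u v
      simpa using ((h2.hasFDerivAt.clm_apply (hasFDerivAt_const b y)).clm_apply
        (hasFDerivAt_const u y)).clm_apply (hasFDerivAt_const v y)
    have e4 := congrArg (fun L : E →L[ℝ] ℝ ↦ L a) e1.fderiv_eq
    rw [fderiv_clm_apply₂ h1 e2 (hasFDerivAt_const w y),
      ((((e3 u v w).fun_add (e3 v u w)).fun_sub (e3 w u v)).const_mul (1 / 2)).fderiv] at e4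
    simpa using e4
  have key' : ∀ a u v w, h y (fderiv ℝ Γ y a u v) w = _ :=
    fun a u v w ↦ eq_sub_of_add_eq' (key a u v w)
  have hsy := hsymm.self_of_nhds
  simp only [localCurvature, map_sub, map_add, sub_apply, add_apply, key', hcompat]
  rw [hs.eq v c, hs.eq z c, hs.eq z v, hDD c v z c, hDD c z v c, hDD c c z v, hΓs v c, hΓs z c,
    hΓs z v, hsy (Γ y c v) (Γ y c z)]
  ring

end LocalGeometry

/-! ### Tangent vectors in charts -/

section Charts

variable {n : ℕ} {M : Type*} [TopologicalSpace M] [ChartedSpace (EuclideanSpace ℝ (Fin n)) M]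
  [IsManifold (𝓡 n) ∞ M]

theorem isManifold_one : IsManifold (𝓡 n) 1 M := IsManifold.of_le (n := ∞) (by norm_num)

theorem chartVec_add (x₀ : M) (y u v : EuclideanSpace ℝ (Fin n)) :
    chartVec x₀ y (u + v) = chartVec x₀ y u + chartVec x₀ y v := map_add _ _ _

theorem chartVec_smul (x₀ : M) (y : EuclideanSpace ℝ (Fin n)) (c : ℝ)
    (u : EuclideanSpace ℝ (Fin n)) : chartVec x₀ y (c • u) = c • chartVec x₀ y u := map_smul _ _ _

theorem chartCoord_smul (x₀ p : M) (c : ℝ) (v : TangentSpace (𝓡 n) p) :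
    chartCoord x₀ p (c • v) = c • chartCoord x₀ p v := map_smul _ _ _

theorem chartCoord_chartVec {x₀ : M} {y : EuclideanSpace ℝ (Fin n)}
    (hy : y ∈ (extChartAt (𝓡 n) x₀).target) (u : EuclideanSpace ℝ (Fin n)) :
    chartCoord x₀ _ (chartVec x₀ y u) = u := by
  have := isManifold_one (n := n) (M := M)
  have h := mfderiv_extChartAt_comp_mfderivWithin_extChartAt_symm hy
  rw [ModelWithCorners.range_eq_univ, mfderivWithin_univ] at h
  exact congrArg (fun L ↦ L u) h

theorem chartVec_chartCoord {x₀ : M} {y : EuclideanSpace ℝ (Fin n)}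
    (hy : y ∈ (extChartAt (𝓡 n) x₀).target)
    (v : TangentSpace (𝓡 n) ((extChartAt (𝓡 n) x₀).symm y)) :
    chartVec x₀ y (chartCoord x₀ _ v) = v := by
  have := isManifold_one (n := n) (M := M)
  have h := mfderivWithin_extChartAt_symm_comp_mfderiv_extChartAt hy
  rw [ModelWithCorners.range_eq_univ, mfderivWithin_univ] at h
  exact congrArg (fun L ↦ L v) h

/-- The tangent space at `x` is modelled by the preferred chart at `x`, so the derivative of this
chart is the identity. No other point of the chart has this property in general, hence the need for
transformation laws. -/
theorem chartCoord_self (x : M) (v : TangentSpace (𝓡 n) x) : chartCoord x x v = v := by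
  have := isManifold_one (n := n) (M := M)
  exact congrArg (fun L ↦ L v) (mfderiv_extChartAt_self (I := 𝓡 n) (x := x))

theorem vecAt_eq (x : M) (u : EuclideanSpace ℝ (Fin n)) : vecAt x u = u := by
  have := isManifold_one (n := n) (M := M)
  have h := mfderivWithin_range_extChartAt_symm (I := 𝓡 n) (x := x)
  rw [ModelWithCorners.range_eq_univ, mfderivWithin_univ] at h
  exact congrArg (fun L ↦ L u) h

theorem chartCoord_surjective {x₀ p : M} (hp : p ∈ (extChartAt (𝓡 n) x₀).source) :
    Function.Surjective (chartCoord x₀ p : TangentSpace (𝓡 n) p → EuclideanSpace ℝ (Fin n)) := by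
  have := isManifold_one (n := n) (M := M)
  intro u
  have h := mfderiv_extChartAt_comp_mfderivWithin_extChartAt_symm' hp
  exact ⟨_, congrArg (fun L ↦ L u) h⟩

theorem tangent_trivialization_snd {x₁ p : M} (hp : p ∈ (chartAt (EuclideanSpace ℝ (Fin n)) x₁).source)
    (v : TangentSpace (𝓡 n) p) :
    (trivializationAt (EuclideanSpace ℝ (Fin n)) (TangentSpace (𝓡 n)) x₁ ⟨p, v⟩).2
      = chartCoord x₁ p v := by
  have := isManifold_one (n := n) (M := M)
  have h := TangentBundle.continuousLinearMapAt_trivializationAt (𝕜 := ℝ) (I := 𝓡 n) hp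
  refine Eq.trans ?_ (congrArg (fun L ↦ L v) h)
  have hm : p ∈ (trivializationAt (EuclideanSpace ℝ (Fin n)) (TangentSpace (𝓡 n)) x₁).baseSet := by
    simpa using hp
  exact (congrFun (Bundle.Trivialization.coe_linearMapAt_of_mem (R := ℝ) _ hm) v).symm

variable {D : Type*} [NormedAddCommGroup D] [NormedSpace ℝ D]

/-- A vector field along a map is smooth if and only if its chart coordinates are. -/
theorem contMDiffAt_tangent_iff {f : D → TangentBundle (𝓡 n) M} {d : D} {x₁ : M}
    (hb : ContMDiffAt 𝓘(ℝ, D) (𝓡 n) ∞ (fun s ↦ (f s).proj) d)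
    (hp : (f d).proj ∈ (chartAt (EuclideanSpace ℝ (Fin n)) x₁).source) :
    ContMDiffAt 𝓘(ℝ, D) (𝓡 n).tangent ∞ f d ↔
      ContDiffAt ℝ ∞ (fun s ↦ chartCoord x₁ (f s).proj (f s).snd) d := by
  have he : f d ∈ (trivializationAt (EuclideanSpace ℝ (Fin n)) (TangentSpace (𝓡 n)) x₁).source := by
    rw [Bundle.Trivialization.mem_source]
    simpa using hp
  have h := Bundle.Trivialization.contMDiffAt_iff (IM := 𝓘(ℝ, D)) (IB := 𝓡 n) (n := ∞) he
  refine Iff.trans h ?_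
  rw [and_iff_right hb, contMDiffAt_iff_contDiffAt]
  have hev : (fun s ↦ (trivializationAt (EuclideanSpace ℝ (Fin n)) (TangentSpace (𝓡 n)) x₁ (f s)).2)
      =ᶠ[𝓝 d] fun s ↦ chartCoord x₁ (f s).proj (f s).snd := by
    filter_upwards [hb.continuousAt.eventually_mem ((chartAt _ x₁).open_source.mem_nhds hp)] with s hs
    exact tangent_trivialization_snd hs _
  exact ⟨fun h ↦ h.congr_of_eventuallyEq hev.symm, fun h ↦ h.congr_of_eventuallyEq hev⟩

theorem contDiffAt_form_apply (g : Metric n M) {b : D → M} {d : D}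
    {v w : ∀ s, TangentSpace (𝓡 n) (b s)}
    (hv : ContMDiffAt 𝓘(ℝ, D) (𝓡 n).tangent ∞ (fun s ↦ (⟨b s, v s⟩ : TangentBundle (𝓡 n) M)) d)
    (hw : ContMDiffAt 𝓘(ℝ, D) (𝓡 n).tangent ∞ (fun s ↦ (⟨b s, w s⟩ : TangentBundle (𝓡 n) M)) d) :
    ContDiffAt ℝ ∞ (fun s ↦ g.form (b s) (v s) (w s)) d := by
  have hb : ContMDiffAt 𝓘(ℝ, D) (𝓡 n) ∞ b d := by
    have := hv
    simp only [ModelWithCorners.tangent, Bundle.contMDiffAt_totalSpace] at this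
    exact this.1
  have : ContMDiffAt 𝓘(ℝ, D) ((𝓡 n).prod 𝓘(ℝ)) ∞
      (fun s ↦ Bundle.TotalSpace.mk' ℝ (E := Bundle.Trivial M ℝ) (b s) (g.form (b s) (v s) (w s)))
      d := by
    apply ContMDiffAt.clm_bundle_apply₂ (F₁ := EuclideanSpace ℝ (Fin n))
      (F₂ := EuclideanSpace ℝ (Fin n))
    · exact g.contMDiff.contMDiffAt.comp d hb
    · exact hv
    · exact hw
  rw [Bundle.contMDiffAt_totalSpace] at this
  exact this.2.contDiffAt

theorem contDiffAt_metricMatrix (g : Metric n M) {x₀ : M} {y : EuclideanSpace ℝ (Fin n)}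
    (hy : y ∈ (extChartAt (𝓡 n) x₀).target) (i j : Fin n) :
    ContDiffAt ℝ ∞ (fun z ↦ metricMatrix g x₀ z i j) y := by
  have hnhds := (isOpen_extChartAt_target (I := 𝓡 n) x₀).mem_nhds hy
  -- Coordinate vector fields are smooth because their coordinates in the chart are constant.
  have key : ∀ u : EuclideanSpace ℝ (Fin n),
      ContMDiffAt 𝓘(ℝ, EuclideanSpace ℝ (Fin n)) (𝓡 n).tangent ∞
        (fun z ↦ (⟨(extChartAt (𝓡 n) x₀).symm z, chartVec x₀ z u⟩ : TangentBundle (𝓡 n) M)) y := by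
    intro u
    rw [contMDiffAt_tangent_iff (x₁ := x₀)]
    · refine (contDiffAt_const (c := u)).congr_of_eventuallyEq ?_
      filter_upwards [hnhds] with z hz using chartCoord_chartVec hz u
    · exact (contMDiffOn_extChartAt_symm x₀).contMDiffAt hnhds
    · rw [← extChartAt_source (𝓡 n)]
      exact (extChartAt (𝓡 n) x₀).map_target hy
  exact contDiffAt_form_apply g (key (stdVec i)) (key (stdVec j))

end Charts

/-! ### Metric, connection and curvature in a chart -/

section Bilinear

variable {n : ℕ} {F : Type*} [NormedAddCommGroup F] [NormedSpace ℝ F]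

theorem sum_smul_stdVec (u : EuclideanSpace ℝ (Fin n)) : ∑ i, u i • stdVec i = u := by
  ext j
  simp [stdVec, Pi.single_apply]

theorem stdVec_apply (i j : Fin n) : stdVec i j = if j = i then 1 else 0 := by
  simp [stdVec]

/-- The bilinear map with given values at the standard basis vectors. -/
def bilinOfCoeff (c : Fin n → Fin n → F) :
    EuclideanSpace ℝ (Fin n) →L[ℝ] EuclideanSpace ℝ (Fin n) →L[ℝ] F :=
  ∑ i, ∑ j, (EuclideanSpace.proj i : EuclideanSpace ℝ (Fin n) →L[ℝ] ℝ).smulRight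
    ((EuclideanSpace.proj j : EuclideanSpace ℝ (Fin n) →L[ℝ] ℝ).smulRight (c i j))

theorem bilinOfCoeff_apply (c : Fin n → Fin n → F) (u v : EuclideanSpace ℝ (Fin n)) :
    bilinOfCoeff c u v = ∑ i, ∑ j, u i • v j • c i j := by
  simp [bilinOfCoeff]

theorem bilinOfCoeff_stdVec (c : Fin n → Fin n → F) (i j : Fin n) :
    bilinOfCoeff c (stdVec i) (stdVec j) = c i j := by
  simp [bilinOfCoeff_apply, stdVec_apply]

theorem linear_expand {f : EuclideanSpace ℝ (Fin n) → F} (h : IsLinearMap ℝ f)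
    (u : EuclideanSpace ℝ (Fin n)) : f u = ∑ i, u i • f (stdVec i) := by
  conv_lhs => rw [← sum_smul_stdVec u, ← h.mk'_apply, map_sum]
  simp

theorem bilinear_expand {f : EuclideanSpace ℝ (Fin n) → EuclideanSpace ℝ (Fin n) → F}
    (h₁ : ∀ v, IsLinearMap ℝ fun u ↦ f u v) (h₂ : ∀ u, IsLinearMap ℝ (f u))
    (u v : EuclideanSpace ℝ (Fin n)) :
    f u v = ∑ i, ∑ j, u i • v j • f (stdVec i) (stdVec j) := by
  rw [linear_expand (h₁ v)]
  simp_rw [fun i ↦ linear_expand (h₂ (stdVec i)) v, Finset.smul_sum]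

theorem trilinear_expand
    {f : EuclideanSpace ℝ (Fin n) → EuclideanSpace ℝ (Fin n) → EuclideanSpace ℝ (Fin n) → F}
    (h₁ : ∀ v w, IsLinearMap ℝ fun u ↦ f u v w) (h₂ : ∀ u w, IsLinearMap ℝ fun v ↦ f u v w)
    (h₃ : ∀ u v, IsLinearMap ℝ (f u v)) (u v w : EuclideanSpace ℝ (Fin n)) :
    f u v w = ∑ i, ∑ j, ∑ k, u i • v j • w k • f (stdVec i) (stdVec j) (stdVec k) := by
  rw [bilinear_expand (f := fun u v ↦ f u v w) (fun v ↦ h₁ v w) (fun u ↦ h₂ u w)]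
  simp_rw [fun i j ↦ linear_expand (h₃ (stdVec i) (stdVec j)) w, Finset.smul_sum]

theorem contDiffAt_clm_of_stdVec {D F : Type*} [NormedAddCommGroup F] [NormedSpace ℝ F]
    [NormedAddCommGroup D] [NormedSpace ℝ D] {k : WithTop ℕ∞}
    {B : D → EuclideanSpace ℝ (Fin n) →L[ℝ] F} {d : D}
    (h : ∀ i, ContDiffAt ℝ k (fun z ↦ B z (stdVec i)) d) : ContDiffAt ℝ k B d := by
  have : B = fun z ↦ ∑ i,
      ContinuousLinearMap.smulRightL ℝ (EuclideanSpace ℝ (Fin n)) F (EuclideanSpace.proj i)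
        (B z (stdVec i)) := by
    ext z u
    conv_lhs => rw [← sum_smul_stdVec u]
    simp [map_sum]
  rw [this]
  exact ContDiffAt.sum fun i _ ↦ (ContinuousLinearMap.contDiff _).contDiffAt.comp d (h i)

theorem contDiffAt_bilin {D : Type*} [NormedAddCommGroup D] [NormedSpace ℝ D] {k : WithTop ℕ∞}
    {c : D → Fin n → Fin n → F} {d : D} (h : ∀ i j, ContDiffAt ℝ k (fun z ↦ c z i j) d) :
    ContDiffAt ℝ k (fun z ↦ bilinOfCoeff (c z)) d := by
  refine contDiffAt_clm_of_stdVec fun i ↦ contDiffAt_clm_of_stdVec fun j ↦ ?_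
  simp only [bilinOfCoeff_stdVec]
  exact h i j

end Bilinear

/-! ### Metric, Levi-Civita connection and curvature as multilinear maps in a chart -/

section Local

variable {n : ℕ} {M : Type*} [TopologicalSpace M] [ChartedSpace (EuclideanSpace ℝ (Fin n)) M]
  [IsManifold (𝓡 n) ∞ M] (g : Metric n M) (x₀ : M)

/-- The metric in the chart centred at `x₀`. -/
def localMetric (y : EuclideanSpace ℝ (Fin n)) :
    EuclideanSpace ℝ (Fin n) →L[ℝ] EuclideanSpace ℝ (Fin n) →L[ℝ] ℝ :=
  bilinOfCoeff fun i j ↦ metricMatrix g x₀ y i j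

/-- The Levi-Civita connection in the chart centred at `x₀`. -/
def localChristoffel (y : EuclideanSpace ℝ (Fin n)) :
    EuclideanSpace ℝ (Fin n) →L[ℝ] EuclideanSpace ℝ (Fin n) →L[ℝ] EuclideanSpace ℝ (Fin n) :=
  bilinOfCoeff fun i j ↦ WithLp.toLp 2 fun k ↦ christoffel g x₀ k i j y

theorem localMetric_apply (y u v : EuclideanSpace ℝ (Fin n)) :
    localMetric g x₀ y u v = g.form _ (chartVec x₀ y u) (chartVec x₀ y v) := by
  rw [localMetric, bilinOfCoeff_apply]
  exact (bilinear_expand (f := fun u v ↦ g.form _ (chartVec x₀ y u) (chartVec x₀ y v))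
    (fun v ↦ ⟨fun a b ↦ by rw [chartVec_add, map_add, add_apply],
      fun c a ↦ by rw [chartVec_smul, map_smul, smul_apply]⟩)
    (fun u ↦ ⟨fun a b ↦ by rw [chartVec_add, map_add],
      fun c a ↦ by rw [chartVec_smul, map_smul]⟩) u v).symm

theorem localMetric_symm (y u v : EuclideanSpace ℝ (Fin n)) :
    localMetric g x₀ y u v = localMetric g x₀ y v u := by
  rw [localMetric_apply, localMetric_apply, g.symm]

theorem localMetric_stdVec (y : EuclideanSpace ℝ (Fin n)) (i j : Fin n) :
    localMetric g x₀ y (stdVec i) (stdVec j) = metricMatrix g x₀ y i j :=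
  bilinOfCoeff_stdVec _ _ _

theorem localChristoffel_apply (y u v : EuclideanSpace ℝ (Fin n)) (k : Fin n) :
    localChristoffel g x₀ y u v k = ∑ i, ∑ j, christoffel g x₀ k i j y * u i * v j := by
  rw [localChristoffel, bilinOfCoeff_apply]
  simp only [WithLp.ofLp_sum, Finset.sum_apply, PiLp.smul_apply, smul_eq_mul]
  refine Finset.sum_congr rfl fun i _ ↦ Finset.sum_congr rfl fun j _ ↦ by ring

theorem metricMatrix_symm (y : EuclideanSpace ℝ (Fin n)) (i j : Fin n) :
    metricMatrix g x₀ y i j = metricMatrix g x₀ y j i := g.symm _ _ _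

theorem localChristoffel_symm (y u v : EuclideanSpace ℝ (Fin n)) :
    localChristoffel g x₀ y u v = localChristoffel g x₀ y v u := by
  ext k
  rw [localChristoffel_apply, localChristoffel_apply, Finset.sum_comm]
  refine Finset.sum_congr rfl fun i _ ↦ Finset.sum_congr rfl fun j _ ↦ ?_
  have : christoffel g x₀ k i j y = christoffel g x₀ k j i y := by
    simp only [christoffel, metricMatrix_symm g x₀ _ i j]
    congr 1
    exact Finset.sum_congr rfl fun l _ ↦ by ring
  rw [this]
  ring

variable {g x₀} {y : EuclideanSpace ℝ (Fin n)}

theorem localMetric_nondegenerate (hy : y ∈ (extChartAt (𝓡 n) x₀).target)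
    (u : EuclideanSpace ℝ (Fin n)) (h : ∀ v, localMetric g x₀ y u v = 0) : u = 0 := by
  have h0 : chartVec x₀ y u = 0 := by
    refine g.nondegenerate _ _ fun w ↦ ?_
    rw [← chartVec_chartCoord hy w, ← localMetric_apply]
    exact h _
  rw [← chartCoord_chartVec hy u, h0]
  exact map_zero _

theorem isUnit_det_metricMatrix (hy : y ∈ (extChartAt (𝓡 n) x₀).target) :
    IsUnit (metricMatrix g x₀ y).det := by
  rw [isUnit_iff_ne_zero]
  intro h
  obtain ⟨v, hv, hv'⟩ := Matrix.exists_mulVec_eq_zero_iff.2 h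
  refine hv ?_
  have : WithLp.toLp 2 v = 0 := by
    refine localMetric_nondegenerate (g := g) hy _ fun w ↦ ?_
    rw [localMetric_symm, localMetric, bilinOfCoeff_apply]
    refine Finset.sum_eq_zero fun i _ ↦ ?_
    have := congrFun hv' i
    simp only [Matrix.mulVec, dotProduct, Pi.zero_apply] at this
    simp only [smul_eq_mul]
    rw [← Finset.mul_sum, show (∑ j, v j * metricMatrix g x₀ y i j) = 0 by
      rw [← this]; exact Finset.sum_congr rfl fun j _ ↦ mul_comm _ _, mul_zero]
  simpa using this

theorem contDiffAt_localMetric (hy : y ∈ (extChartAt (𝓡 n) x₀).target) :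
    ContDiffAt ℝ ∞ (localMetric g x₀) y :=
  contDiffAt_bilin fun i j ↦ contDiffAt_metricMatrix g hy i j

theorem firstKind_localMetric_stdVec (hy : y ∈ (extChartAt (𝓡 n) x₀).target) (i j l : Fin n) :
    firstKind (localMetric g x₀) y (stdVec i) (stdVec j) (stdVec l)
      = (1 / 2) * (partialDeriv i (fun z ↦ metricMatrix g x₀ z j l) y
      + partialDeriv j (fun z ↦ metricMatrix g x₀ z i l) y
      - partialDeriv l (fun z ↦ metricMatrix g x₀ z i j) y) := by
  have hd : DifferentiableAt ℝ (localMetric g x₀) y :=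
    (contDiffAt_localMetric hy).differentiableAt (by simp)
  simp only [firstKind, ← fderiv_apply₂ hd, localMetric_stdVec, partialDeriv]

/-- On basis vectors this is the contraction of the metric matrix with its inverse, and both sides
are trilinear. The identity determines the connection without reference to coordinates, so
transformation laws are derived from it. -/
theorem localMetric_localChristoffel (hy : y ∈ (extChartAt (𝓡 n) x₀).target)
    (u v w : EuclideanSpace ℝ (Fin n)) :
    localMetric g x₀ y (localChristoffel g x₀ y u v) w
      = firstKind (localMetric g x₀) y u v w := by
  have hbasis : ∀ i j l, localMetric g x₀ y (localChristoffel g x₀ y (stdVec i) (stdVec j))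
      (stdVec l) = firstKind (localMetric g x₀) y (stdVec i) (stdVec j) (stdVec l) := by
    intro i j l
    rw [localChristoffel, bilinOfCoeff_stdVec, localMetric, bilinOfCoeff_apply]
    have hinv := Matrix.mul_nonsing_inv _ (isUnit_det_metricMatrix (g := g) hy)
    have hl : ∀ m, ∑ k, metricMatrix g x₀ y l k * (metricMatrix g x₀ y)⁻¹ k m
        = if l = m then 1 else 0 := by
      intro m
      rw [← Matrix.mul_apply, hinv, Matrix.one_apply]
    simp only [stdVec_apply, smul_eq_mul, ite_mul, one_mul, zero_mul, mul_ite, mul_zero,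
      Finset.sum_ite_eq', Finset.mem_univ, if_true, christoffel]
    calc _ = ∑ m, (∑ k, metricMatrix g x₀ y l k * (metricMatrix g x₀ y)⁻¹ k m)
          * firstKind (localMetric g x₀) y (stdVec i) (stdVec j) (stdVec m) := by
          simp only [firstKind_localMetric_stdVec hy, Finset.mul_sum, Finset.sum_mul]
          rw [Finset.sum_comm]
          refine Finset.sum_congr rfl fun k _ ↦ Finset.sum_congr rfl fun m _ ↦ ?_
          rw [metricMatrix_symm g x₀ y l]
          ring
      _ = _ := by simp [hl]
  have e1 := trilinear_expand
    (f := fun u v w ↦ localMetric g x₀ y (localChristoffel g x₀ y u v) w)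
    (fun v w ↦ ⟨fun a b ↦ by simp, fun c a ↦ by simp⟩)
    (fun v w ↦ ⟨fun a b ↦ by simp, fun c a ↦ by simp⟩)
    (fun v w ↦ ⟨fun a b ↦ by simp, fun c a ↦ by simp⟩) u v w
  have e2 := trilinear_expand (f := firstKind (localMetric g x₀) y)
    (fun v w ↦ ⟨fun a b ↦ by simp [firstKind]; ring, fun c a ↦ by simp [firstKind]; ring⟩)
    (fun v w ↦ ⟨fun a b ↦ by simp [firstKind]; ring, fun c a ↦ by simp [firstKind]; ring⟩)
    (fun v w ↦ ⟨fun a b ↦ by simp [firstKind]; ring, fun c a ↦ by simp [firstKind]; ring⟩) u v w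
  rw [e1, e2]
  simp only [hbasis]

/-- By Cramer's rule the entries of the inverse are polynomials in the entries divided by the
nonvanishing determinant. -/
theorem contDiffAt_inv_metricMatrix (hy : y ∈ (extChartAt (𝓡 n) x₀).target) (i j : Fin n) :
    ContDiffAt ℝ ∞ (fun z ↦ (metricMatrix g x₀ z)⁻¹ i j) y := by
  have hA := contDiffAt_metricMatrix g hy
  have hdet : ∀ A : EuclideanSpace ℝ (Fin n) → Matrix (Fin n) (Fin n) ℝ,
      (∀ i j, ContDiffAt ℝ ∞ (fun z ↦ A z i j) y) → ContDiffAt ℝ ∞ (fun z ↦ (A z).det) y := by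
    intro A hA
    simp only [Matrix.det_apply']
    exact ContDiffAt.sum fun σ _ ↦ contDiffAt_const.mul (contDiffAt_prod fun k _ ↦ hA _ _)
  simp only [Matrix.inv_def, Ring.inverse_eq_inv', Matrix.smul_apply, smul_eq_mul,
    Matrix.adjugate_apply]
  refine ((hdet _ hA).inv (isUnit_det_metricMatrix hy).ne_zero).mul (hdet _ fun k l ↦ ?_)
  simp only [Matrix.updateRow_apply]
  split_ifs
  · exact contDiffAt_const
  · exact hA k l

theorem contDiffAt_christoffel (hy : y ∈ (extChartAt (𝓡 n) x₀).target) (k i j : Fin n) :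
    ContDiffAt ℝ ∞ (christoffel g x₀ k i j) y := by
  have hA := contDiffAt_metricMatrix g hy
  have hd : ∀ a b c, ContDiffAt ℝ ∞ (fun z ↦ partialDeriv a (fun z ↦ metricMatrix g x₀ z b c) z) y :=
    fun a b c ↦ ((hA b c).fderiv_right (m := ∞) (by simp)).clm_apply contDiffAt_const
  unfold christoffel
  exact contDiffAt_const.mul (ContDiffAt.sum fun l _ ↦
    (contDiffAt_inv_metricMatrix hy k l).mul (((hd _ _ _).add (hd _ _ _)).sub (hd _ _ _)))

theorem contDiffAt_localChristoffel (hy : y ∈ (extChartAt (𝓡 n) x₀).target) :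
    ContDiffAt ℝ ∞ (localChristoffel g x₀) y := by
  refine contDiffAt_bilin fun i j ↦ ?_
  rw [contDiffAt_euclidean]
  exact fun k ↦ contDiffAt_christoffel hy k i j

theorem localCurvature_apply (hy : y ∈ (extChartAt (𝓡 n) x₀).target)
    (u v w : EuclideanSpace ℝ (Fin n)) (l : Fin n) :
    localCurvature (localChristoffel g x₀) y u v w l
      = ∑ i, ∑ j, ∑ k, curvatureCoeff g x₀ l i j k y * u i * v j * w k := by
  have hd : DifferentiableAt ℝ (localChristoffel g x₀) y :=
    (contDiffAt_localChristoffel hy).differentiableAt (by simp)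
  have hpart : ∀ i j k, fderiv ℝ (localChristoffel g x₀) y (stdVec i) (stdVec j) (stdVec k) l
      = partialDeriv i (christoffel g x₀ l j k) y := by
    intro i j k
    have h1 : DifferentiableAt ℝ (fun z ↦ localChristoffel g x₀ z (stdVec j) (stdVec k)) y :=
      (hd.clm_apply (differentiableAt_const _)).clm_apply (differentiableAt_const _)
    have h2 := ((EuclideanSpace.proj (𝕜 := ℝ) l).hasFDerivAt.comp y h1.hasFDerivAt).fderiv
    have h3 : (EuclideanSpace.proj (𝕜 := ℝ) l) ∘
        (fun z ↦ localChristoffel g x₀ z (stdVec j) (stdVec k)) = christoffel g x₀ l j k := by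
      ext z
      simp [localChristoffel, bilinOfCoeff_stdVec]
    rw [h3] at h2
    rw [← fderiv_apply₂ hd, partialDeriv, h2]
    rfl
  have hquad : ∀ i j k, localChristoffel g x₀ y (stdVec i)
      (localChristoffel g x₀ y (stdVec j) (stdVec k)) l
      = ∑ m, christoffel g x₀ l i m y * christoffel g x₀ m j k y := by
    intro i j k
    simp [localChristoffel_apply, stdVec_apply]
  have e := trilinear_expand (f := fun u v w ↦ localCurvature (localChristoffel g x₀) y u v w l)
    (fun v w ↦ ⟨fun a b ↦ by simp [localCurvature]; ring, fun c a ↦ by simp [localCurvature]; ring⟩)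
    (fun v w ↦ ⟨fun a b ↦ by simp [localCurvature]; ring, fun c a ↦ by simp [localCurvature]; ring⟩)
    (fun v w ↦ ⟨fun a b ↦ by simp [localCurvature]; ring, fun c a ↦ by simp [localCurvature]; ring⟩)
    u v w
  rw [e]
  refine Finset.sum_congr rfl fun i _ ↦ Finset.sum_congr rfl fun j _ ↦
    Finset.sum_congr rfl fun k _ ↦ ?_
  simp only [localCurvature, PiLp.sub_apply, PiLp.add_apply, hpart, hquad, curvatureCoeff,
    Finset.sum_sub_distrib, smul_eq_mul]
  ring

end Local

/-! ### Change of charts -/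

section ChartChange

variable {n : ℕ} {M : Type*} [TopologicalSpace M] [ChartedSpace (EuclideanSpace ℝ (Fin n)) M]
  [IsManifold (𝓡 n) ∞ M]

/-- The change of coordinates between the charts centred at `x₀` and `x₁`. -/
def chartChange (x₀ x₁ : M) (y : EuclideanSpace ℝ (Fin n)) : EuclideanSpace ℝ (Fin n) :=
  extChartAt (𝓡 n) x₁ ((extChartAt (𝓡 n) x₀).symm y)

/-- The domain of the change of coordinates. -/
def chartOverlap (x₀ x₁ : M) : Set (EuclideanSpace ℝ (Fin n)) :=
  {y | y ∈ (extChartAt (𝓡 n) x₀).target ∧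
    (extChartAt (𝓡 n) x₀).symm y ∈ (extChartAt (𝓡 n) x₁).source}

variable {x₀ x₁ p : M} {y : EuclideanSpace ℝ (Fin n)}

theorem mem_chartOverlap (h₀ : p ∈ (extChartAt (𝓡 n) x₀).source)
    (h₁ : p ∈ (extChartAt (𝓡 n) x₁).source) :
    extChartAt (𝓡 n) x₀ p ∈ chartOverlap (n := n) x₀ x₁ :=
  ⟨(extChartAt (𝓡 n) x₀).map_source h₀, by rwa [(extChartAt (𝓡 n) x₀).left_inv h₀]⟩

theorem chartChange_apply (h₀ : p ∈ (extChartAt (𝓡 n) x₀).source) :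
    chartChange x₀ x₁ (extChartAt (𝓡 n) x₀ p) = extChartAt (𝓡 n) x₁ p := by
  rw [chartChange, (extChartAt (𝓡 n) x₀).left_inv h₀]

theorem isOpen_chartOverlap (x₀ x₁ : M) : IsOpen (chartOverlap (n := n) x₀ x₁) :=
  (continuousOn_extChartAt_symm x₀).isOpen_inter_preimage (isOpen_extChartAt_target x₀)
    (isOpen_extChartAt_source x₁)

theorem contMDiffAt_extChartAt_symm_of_mem (hy : y ∈ (extChartAt (𝓡 n) x₀).target) :
    ContMDiffAt 𝓘(ℝ, EuclideanSpace ℝ (Fin n)) (𝓡 n) ∞ (extChartAt (𝓡 n) x₀).symm y :=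
  (contMDiffOn_extChartAt_symm x₀).contMDiffAt ((isOpen_extChartAt_target x₀).mem_nhds hy)

theorem contMDiffAt_extChartAt_of_mem (hp : p ∈ (extChartAt (𝓡 n) x₁).source) :
    ContMDiffAt (𝓡 n) 𝓘(ℝ, EuclideanSpace ℝ (Fin n)) ∞ (extChartAt (𝓡 n) x₁) p :=
  contMDiffAt_extChartAt' (by rwa [← extChartAt_source (𝓡 n)])

theorem contDiffAt_chartChange (hy : y ∈ chartOverlap x₀ x₁) :
    ContDiffAt ℝ ∞ (chartChange (n := n) x₀ x₁) y :=
  ((contMDiffAt_extChartAt_of_mem hy.2).comp y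
    (contMDiffAt_extChartAt_symm_of_mem hy.1)).contDiffAt

theorem fderiv_chartChange (hy : y ∈ chartOverlap x₀ x₁) (u : EuclideanSpace ℝ (Fin n)) :
    fderiv ℝ (chartChange (n := n) x₀ x₁) y u = chartCoord x₁ _ (chartVec x₀ y u) := by
  have h := mfderiv_comp y
    ((contMDiffAt_extChartAt_of_mem hy.2).mdifferentiableAt (by simp))
    ((contMDiffAt_extChartAt_symm_of_mem hy.1).mdifferentiableAt (by simp))
  rw [← mfderiv_eq_fderiv]
  exact congrArg (fun L ↦ L u) h

theorem fderiv_chartChange_chartCoord (h₀ : p ∈ (extChartAt (𝓡 n) x₀).source)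
    (h₁ : p ∈ (extChartAt (𝓡 n) x₁).source) (v : TangentSpace (𝓡 n) p) :
    fderiv ℝ (chartChange (n := n) x₀ x₁) (extChartAt (𝓡 n) x₀ p) (chartCoord x₀ p v)
      = chartCoord x₁ p v := by
  have hy := mem_chartOverlap h₀ h₁
  have hp := (extChartAt (𝓡 n) x₀).left_inv h₀
  -- The type of `v` depends on `p`; replacing `p` by the image of its coordinates lets the inverse
  -- relation between `chartVec` and `chartCoord` apply.
  generalize extChartAt (𝓡 n) x₀ p = y at hy hp ⊢
  subst hp
  rw [fderiv_chartChange hy, chartVec_chartCoord hy.1]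

theorem fderiv_chartChange_surjective (hy : y ∈ chartOverlap x₀ x₁) :
    Function.Surjective (fderiv ℝ (chartChange (n := n) x₀ x₁) y) := by
  intro u
  obtain ⟨v, rfl⟩ := chartCoord_surjective hy.2 u
  exact ⟨chartCoord x₀ _ v, by rw [fderiv_chartChange hy, chartVec_chartCoord hy.1]⟩

variable (g : Metric n M)

theorem localMetric_chartCoord (hp : p ∈ (extChartAt (𝓡 n) x₁).source)
    (v w : TangentSpace (𝓡 n) p) :
    localMetric g x₁ (extChartAt (𝓡 n) x₁ p) (chartCoord x₁ p v) (chartCoord x₁ p w)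
      = g.form p v w := by
  have hy := (extChartAt (𝓡 n) x₁).map_source hp
  have hp' := (extChartAt (𝓡 n) x₁).left_inv hp
  generalize extChartAt (𝓡 n) x₁ p = y at hy hp' ⊢
  subst hp'
  rw [localMetric_apply, chartVec_chartCoord hy, chartVec_chartCoord hy]

theorem localMetric_chartChange (hy : y ∈ chartOverlap x₀ x₁) (u v : EuclideanSpace ℝ (Fin n)) :
    localMetric g x₀ y u v = localMetric g x₁ (chartChange x₀ x₁ y)
      (fderiv ℝ (chartChange x₀ x₁) y u) (fderiv ℝ (chartChange x₀ x₁) y v) := by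
  rw [fderiv_chartChange hy, fderiv_chartChange hy, chartChange, localMetric_chartCoord g hy.2,
    localMetric_apply]

theorem chartChange_mem_target (hy : y ∈ chartOverlap x₀ x₁) :
    chartChange (n := n) x₀ x₁ y ∈ (extChartAt (𝓡 n) x₁).target :=
  (extChartAt (𝓡 n) x₁).map_source hy.2

theorem localChristoffel_chartChange (hy : y ∈ chartOverlap x₀ x₁)
    (u v : EuclideanSpace ℝ (Fin n)) :
    fderiv ℝ (chartChange x₀ x₁) y (localChristoffel g x₀ y u v)
      = localChristoffel g x₁ (chartChange x₀ x₁ y) (fderiv ℝ (chartChange x₀ x₁) y u)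
          (fderiv ℝ (chartChange x₀ x₁) y v)
        + fderiv ℝ (fderiv ℝ (chartChange x₀ x₁)) y u v :=
  christoffel_pullback ((contDiffAt_localMetric hy.1).differentiableAt (by simp))
    ((contDiffAt_localMetric (chartChange_mem_target hy)).differentiableAt (by simp))
    ((contDiffAt_chartChange hy).of_le (WithTop.coe_le_coe.2 (le_top : (2 : ℕ∞) ≤ ⊤))) (localMetric_symm g x₁ _)
    (localMetric_nondegenerate (chartChange_mem_target hy)) (fderiv_chartChange_surjective hy)
    (((isOpen_chartOverlap x₀ x₁).eventually_mem hy).mono fun _ hz ↦ localMetric_chartChange g hz)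
    (localMetric_localChristoffel hy.1)
    (localMetric_localChristoffel (chartChange_mem_target hy)) u v

theorem localCurvature_chartChange (hy : y ∈ chartOverlap x₀ x₁)
    (a b w : EuclideanSpace ℝ (Fin n)) :
    fderiv ℝ (chartChange x₀ x₁) y (localCurvature (localChristoffel g x₀) y a b w)
      = localCurvature (localChristoffel g x₁) (chartChange x₀ x₁ y)
          (fderiv ℝ (chartChange x₀ x₁) y a) (fderiv ℝ (chartChange x₀ x₁) y b)
          (fderiv ℝ (chartChange x₀ x₁) y w) :=
  localCurvature_pullback ((contDiffAt_localChristoffel hy.1).differentiableAt (by simp))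
    ((contDiffAt_localChristoffel (chartChange_mem_target hy)).differentiableAt (by simp))
    ((contDiffAt_chartChange hy).of_le (WithTop.coe_le_coe.2 (le_top : (3 : ℕ∞) ≤ ⊤)))
    (((isOpen_chartOverlap x₀ x₁).eventually_mem hy).mono
      fun _ hz ↦ localChristoffel_chartChange g hz) a b w

theorem chartCoord_vecAt (x : M) (u : EuclideanSpace ℝ (Fin n)) : chartCoord x x (vecAt x u) = u := by
  rw [chartCoord_self, vecAt_eq]

theorem curvature_eq (u v w : TangentSpace (𝓡 n) p) :
    curvature g p u v w = vecAt p (localCurvature (localChristoffel g p) (extChartAt (𝓡 n) p p)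
      (chartCoord p p u) (chartCoord p p v) (chartCoord p p w)) := by
  rw [curvature]
  congr 1
  ext l
  exact (localCurvature_apply (mem_extChartAt_target p) _ _ _ l).symm

/-- The definition uses the chart centred at `p`; tensoriality transfers it to any fixed chart
around `p`, where smooth dependence on `p` can be read off. -/
theorem chartCoord_curvature (hp : p ∈ (extChartAt (𝓡 n) x₁).source)
    (u v w : TangentSpace (𝓡 n) p) :
    chartCoord x₁ p (curvature g p u v w)
      = localCurvature (localChristoffel g x₁) (extChartAt (𝓡 n) x₁ p)
          (chartCoord x₁ p u) (chartCoord x₁ p v) (chartCoord x₁ p w) := by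
  have hs := mem_extChartAt_source (I := 𝓡 n) p
  rw [← fderiv_chartChange_chartCoord hs hp, curvature_eq, chartCoord_vecAt,
    localCurvature_chartChange g (mem_chartOverlap hs hp), chartChange_apply hs]
  simp only [fderiv_chartChange_chartCoord hs hp]

theorem form_curvature_symm (c v w : TangentSpace (𝓡 n) p) :
    g.form p (curvature g p c v c) w = g.form p (curvature g p c w c) v := by
  have hs := mem_extChartAt_source (I := 𝓡 n) p
  have ht := mem_extChartAt_target (I := 𝓡 n) p
  rw [← localMetric_chartCoord g hs, ← localMetric_chartCoord g hs, chartCoord_curvature g hs,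
    chartCoord_curvature g hs]
  refine localCurvature_symm ((contDiffAt_localMetric ht).of_le (WithTop.coe_le_coe.2 (le_top : (2 : ℕ∞) ≤ ⊤)))
    (Eventually.of_forall fun z u v ↦ localMetric_symm g p z u v)
    ((contDiffAt_localChristoffel ht).differentiableAt (by simp)) (localChristoffel_symm g p _) ?_
    _ _ _
  filter_upwards [(isOpen_extChartAt_target (I := 𝓡 n) p).eventually_mem ht] with z hz
  exact localMetric_localChristoffel hz

end ChartChange

/-! ### Vector fields along curves -/

section Curves

/-- The product rule for `Dψ(c) v` yields a term `D²ψ(c', v)`, which is exactly the inhomogeneous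
term in the change of the Christoffel symbols. Hence the covariant derivative transforms as a
vector. -/
theorem fderiv_apply_deriv_add {E : Type*} [NormedAddCommGroup E] [NormedSpace ℝ E] {ψ : E → E}
    {c v v₁ : ℝ → E} {t : ℝ} (hψ : DifferentiableAt ℝ (fderiv ℝ ψ) (c t))
    (hc : DifferentiableAt ℝ c t) (hv : DifferentiableAt ℝ v t)
    (h : v₁ =ᶠ[𝓝 t] fun s ↦ fderiv ℝ ψ (c s) (v s)) {a b : E}
    (hab : fderiv ℝ ψ (c t) a = b + fderiv ℝ (fderiv ℝ ψ) (c t) (deriv c t) (v t)) :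
    fderiv ℝ ψ (c t) (deriv v t + a) = deriv v₁ t + b := by
  have hder := ((hψ.hasFDerivAt.comp_hasDerivAt t hc.hasDerivAt).clm_apply hv.hasDerivAt).deriv
  simp only [Function.comp_apply] at hder
  rw [h.deriv_eq, hder, map_add, hab]
  abel

variable {n : ℕ} {M : Type*} [TopologicalSpace M] [ChartedSpace (EuclideanSpace ℝ (Fin n)) M]
  [IsManifold (𝓡 n) ∞ M] {γ : ℝ → M} {x₁ : M} {t : ℝ} {V : ∀ t, TangentSpace (𝓡 n) (γ t)}

theorem contDiffAt_chart_curve (hγ : ContMDiff 𝓘(ℝ, ℝ) (𝓡 n) ∞ γ)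
    (ht : γ t ∈ (extChartAt (𝓡 n) x₁).source) :
    ContDiffAt ℝ ∞ (fun s ↦ extChartAt (𝓡 n) x₁ (γ s)) t :=
  ((contMDiffAt_extChartAt_of_mem ht).comp t hγ.contMDiffAt).contDiffAt

theorem contMDiffAt_field_iff (hγ : ContMDiff 𝓘(ℝ, ℝ) (𝓡 n) ∞ γ)
    (ht : γ t ∈ (extChartAt (𝓡 n) x₁).source) :
    ContMDiffAt 𝓘(ℝ, ℝ) (𝓡 n).tangent ∞ (fun t ↦ (⟨γ t, V t⟩ : TangentBundle (𝓡 n) M)) t ↔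
      ContDiffAt ℝ ∞ (fun s ↦ chartCoord x₁ (γ s) (V s)) t :=
  contMDiffAt_tangent_iff hγ.contMDiffAt (by rwa [← extChartAt_source (𝓡 n)])

theorem eventually_mem_source (hγ : ContMDiff 𝓘(ℝ, ℝ) (𝓡 n) ∞ γ)
    (ht : γ t ∈ (extChartAt (𝓡 n) x₁).source) :
    ∀ᶠ s in 𝓝 t, γ s ∈ (extChartAt (𝓡 n) x₁).source :=
  hγ.continuous.continuousAt.eventually_mem ((isOpen_extChartAt_source x₁).mem_nhds ht)

theorem chartCoord_velocity (hγ : ContMDiff 𝓘(ℝ, ℝ) (𝓡 n) ∞ γ)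
    (ht : γ t ∈ (extChartAt (𝓡 n) x₁).source) :
    chartCoord x₁ (γ t) (velocity γ t) = deriv (fun s ↦ extChartAt (𝓡 n) x₁ (γ s)) t := by
  have h := mfderiv_comp t
    ((contMDiffAt_extChartAt_of_mem ht).mdifferentiableAt (by simp))
    (hγ.contMDiffAt.mdifferentiableAt (by simp))
  rw [← fderiv_apply_one_eq_deriv, ← mfderiv_eq_fderiv]
  exact (congrArg (fun L ↦ L (1 : ℝ)) h).symm

theorem contMDiff_velocity (hγ : ContMDiff 𝓘(ℝ, ℝ) (𝓡 n) ∞ γ) :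
    ContMDiff 𝓘(ℝ, ℝ) (𝓡 n).tangent ∞
      (fun t ↦ (⟨γ t, velocity γ t⟩ : TangentBundle (𝓡 n) M)) := by
  intro t
  have hs := mem_extChartAt_source (I := 𝓡 n) (γ t)
  rw [contMDiffAt_field_iff hγ hs]
  refine ContDiffAt.congr_of_eventuallyEq (f := deriv fun s ↦ extChartAt (𝓡 n) (γ t) (γ s)) ?_ ?_
  · exact ((contDiffAt_chart_curve hγ hs).fderiv_right (m := ∞) (by simp)).clm_apply
      contDiffAt_const
  · filter_upwards [eventually_mem_source hγ hs] with s hs using chartCoord_velocity hγ hs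

variable (g : Metric n M)

theorem covDeriv_eq (hγ : ContMDiff 𝓘(ℝ, ℝ) (𝓡 n) ∞ γ)
    (hV : ContMDiffAt 𝓘(ℝ, ℝ) (𝓡 n).tangent ∞ (fun t ↦ (⟨γ t, V t⟩ : TangentBundle (𝓡 n) M)) t) :
    covDeriv g γ V t = vecAt (γ t) (deriv (fun s ↦ chartCoord (γ t) (γ s) (V s)) t
      + localChristoffel g (γ t) (extChartAt (𝓡 n) (γ t) (γ t))
        (chartCoord (γ t) (γ t) (velocity γ t)) (chartCoord (γ t) (γ t) (V t))) := by
  have hs := mem_extChartAt_source (I := 𝓡 n) (γ t)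
  have hd := ((contMDiffAt_field_iff hγ hs).1 hV).differentiableAt (by simp)
  rw [covDeriv]
  refine congrArg (vecAt (γ t)) ?_
  ext k
  rw [PiLp.add_apply, localChristoffel_apply]
  refine congrArg₂ (· + ·) ?_ rfl
  exact ((EuclideanSpace.proj (𝕜 := ℝ) k).hasFDerivAt.comp_hasDerivAt t hd.hasDerivAt).deriv

theorem chartCoord_covDeriv (hγ : ContMDiff 𝓘(ℝ, ℝ) (𝓡 n) ∞ γ)
    (hV : ContMDiffAt 𝓘(ℝ, ℝ) (𝓡 n).tangent ∞ (fun t ↦ (⟨γ t, V t⟩ : TangentBundle (𝓡 n) M)) t)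
    (ht : γ t ∈ (extChartAt (𝓡 n) x₁).source) :
    chartCoord x₁ (γ t) (covDeriv g γ V t) = deriv (fun s ↦ chartCoord x₁ (γ s) (V s)) t
      + localChristoffel g x₁ (extChartAt (𝓡 n) x₁ (γ t))
        (chartCoord x₁ (γ t) (velocity γ t)) (chartCoord x₁ (γ t) (V t)) := by
  have hs := mem_extChartAt_source (I := 𝓡 n) (γ t)
  have hd := ((contMDiffAt_field_iff hγ hs).1 hV).differentiableAt (by simp)
  have hc := (contDiffAt_chart_curve hγ hs).differentiableAt (by simp)
  have hy := mem_chartOverlap hs ht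
  have hψ := ((contDiffAt_chartChange hy).fderiv_right (m := ∞) (by simp)).differentiableAt (by simp)
  have hev : (fun s ↦ chartCoord x₁ (γ s) (V s)) =ᶠ[𝓝 t] fun s ↦
      fderiv ℝ (chartChange (γ t) x₁) (extChartAt (𝓡 n) (γ t) (γ s))
        (chartCoord (γ t) (γ s) (V s)) := by
    filter_upwards [eventually_mem_source hγ hs, eventually_mem_source hγ ht] with s h0 h1
    exact (fderiv_chartChange_chartCoord h0 h1 _).symm
  rw [← fderiv_chartChange_chartCoord hs ht, covDeriv_eq g hγ hV, chartCoord_vecAt]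
  refine fderiv_apply_deriv_add hψ hc hd hev ?_
  rw [← chartCoord_velocity hγ hs, localChristoffel_chartChange g hy, chartChange_apply hs,
    fderiv_chartChange_chartCoord hs ht, fderiv_chartChange_chartCoord hs ht]

/-- Near a given time the covariant derivative is read in the single chart centred at that time's
point, in place of the chart that moves along the curve. -/
theorem contMDiff_covDeriv (hγ : ContMDiff 𝓘(ℝ, ℝ) (𝓡 n) ∞ γ)
    (hV : ContMDiff 𝓘(ℝ, ℝ) (𝓡 n).tangent ∞ (fun t ↦ (⟨γ t, V t⟩ : TangentBundle (𝓡 n) M))) :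
    ContMDiff 𝓘(ℝ, ℝ) (𝓡 n).tangent ∞
      (fun t ↦ (⟨γ t, covDeriv g γ V t⟩ : TangentBundle (𝓡 n) M)) := by
  intro t
  have hs := mem_extChartAt_source (I := 𝓡 n) (γ t)
  rw [contMDiffAt_field_iff hγ hs]
  have hc := contDiffAt_chart_curve hγ hs
  have hv := (contMDiffAt_field_iff hγ hs).1 (hV t)
  have hu := (contMDiffAt_field_iff hγ hs).1 (contMDiff_velocity hγ t)
  have hΓ : ContDiffAt ℝ ∞ (fun s ↦ localChristoffel g (γ t) (extChartAt (𝓡 n) (γ t) (γ s))) t :=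
    ContDiffAt.comp (g := localChristoffel g (γ t)) t
      (contDiffAt_localChristoffel (mem_extChartAt_target (γ t))) hc
  refine ContDiffAt.congr_of_eventuallyEq (((hv.fderiv_right (m := ∞) (by simp)).clm_apply
      (contDiffAt_const (c := (1 : ℝ)))).add ((hΓ.clm_apply hu).clm_apply hv)) ?_
  filter_upwards [eventually_mem_source hγ hs] with s hs
  exact chartCoord_covDeriv g hγ (hV s) hs

set_option maxSynthPendingDepth 3 in
theorem contMDiff_curvature {U W : ∀ t, TangentSpace (𝓡 n) (γ t)}
    (hγ : ContMDiff 𝓘(ℝ, ℝ) (𝓡 n) ∞ γ)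
    (hU : ContMDiff 𝓘(ℝ, ℝ) (𝓡 n).tangent ∞ (fun t ↦ (⟨γ t, U t⟩ : TangentBundle (𝓡 n) M)))
    (hV : ContMDiff 𝓘(ℝ, ℝ) (𝓡 n).tangent ∞ (fun t ↦ (⟨γ t, V t⟩ : TangentBundle (𝓡 n) M)))
    (hW : ContMDiff 𝓘(ℝ, ℝ) (𝓡 n).tangent ∞ (fun t ↦ (⟨γ t, W t⟩ : TangentBundle (𝓡 n) M))) :
    ContMDiff 𝓘(ℝ, ℝ) (𝓡 n).tangent ∞
      (fun t ↦ (⟨γ t, curvature g (γ t) (U t) (V t) (W t)⟩ : TangentBundle (𝓡 n) M)) := by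
  intro t
  have hs := mem_extChartAt_source (I := 𝓡 n) (γ t)
  rw [contMDiffAt_field_iff hγ hs]
  have hc := contDiffAt_chart_curve hγ hs
  have hu := (contMDiffAt_field_iff hγ hs).1 (hU t)
  have hv := (contMDiffAt_field_iff hγ hs).1 (hV t)
  have hw := (contMDiffAt_field_iff hγ hs).1 (hW t)
  have hΓ₀ := contDiffAt_localChristoffel (g := g) (mem_extChartAt_target (I := 𝓡 n) (γ t))
  have hΓ : ContDiffAt ℝ ∞ (fun s ↦ localChristoffel g (γ t) (extChartAt (𝓡 n) (γ t) (γ s))) t :=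
    ContDiffAt.comp (g := localChristoffel g (γ t)) t hΓ₀ hc
  have hΓ' : ContDiffAt ℝ ∞
      (fun s ↦ fderiv ℝ (localChristoffel g (γ t)) (extChartAt (𝓡 n) (γ t) (γ s))) t :=
    ContDiffAt.comp t (hΓ₀.fderiv_right (m := ∞) (by simp)) hc
  refine ContDiffAt.congr_of_eventuallyEq
    ((((((hΓ'.clm_apply hu).clm_apply hv).clm_apply hw).sub
      (((hΓ'.clm_apply hv).clm_apply hu).clm_apply hw)).add
      ((hΓ.clm_apply hu).clm_apply ((hΓ.clm_apply hv).clm_apply hw))).sub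
      ((hΓ.clm_apply hv).clm_apply ((hΓ.clm_apply hu).clm_apply hw))) ?_
  filter_upwards [eventually_mem_source hγ hs] with s hs
  exact chartCoord_curvature g hs _ _ _

theorem chartCoord_frameVec (T : Fin n → ∀ t, TangentSpace (𝓡 n) (γ t)) (x₁ : M) (t : ℝ)
    (v : EuclideanSpace ℝ (Fin n)) :
    chartCoord x₁ (γ t) (frameVec γ T t v) = ∑ i, v i • chartCoord x₁ (γ t) (T i t) := by
  rw [frameVec]
  refine (map_sum (mfderiv (𝓡 n) (𝓡 n) (extChartAt (𝓡 n) x₁) (γ t)) _ _).trans ?_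
  exact Finset.sum_congr rfl fun i _ ↦ chartCoord_smul _ _ _ _

variable {T : Fin n → ∀ t, TangentSpace (𝓡 n) (γ t)}

theorem contMDiff_frameVec (hγ : ContMDiff 𝓘(ℝ, ℝ) (𝓡 n) ∞ γ)
    (hT : ∀ i, ContMDiff 𝓘(ℝ, ℝ) (𝓡 n).tangent ∞
      (fun t ↦ (⟨γ t, T i t⟩ : TangentBundle (𝓡 n) M))) (v : EuclideanSpace ℝ (Fin n)) :
    ContMDiff 𝓘(ℝ, ℝ) (𝓡 n).tangent ∞
      (fun t ↦ (⟨γ t, frameVec γ T t v⟩ : TangentBundle (𝓡 n) M)) := by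
  intro t
  have hs := mem_extChartAt_source (I := 𝓡 n) (γ t)
  rw [contMDiffAt_field_iff hγ hs]
  simp only [chartCoord_frameVec]
  exact ContDiffAt.sum fun i _ ↦ ContDiffAt.const_smul (v i) ((contMDiffAt_field_iff hγ hs).1 (hT i t))

theorem chartCoord_injective_self (x : M) {v w : TangentSpace (𝓡 n) x}
    (h : chartCoord x x v = chartCoord x x w) : v = w := by
  rwa [chartCoord_self, chartCoord_self] at h

theorem covDeriv_frameVec (hγ : ContMDiff 𝓘(ℝ, ℝ) (𝓡 n) ∞ γ)
    (hT : ∀ i, ContMDiff 𝓘(ℝ, ℝ) (𝓡 n).tangent ∞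
      (fun t ↦ (⟨γ t, T i t⟩ : TangentBundle (𝓡 n) M))) (t : ℝ) (v : EuclideanSpace ℝ (Fin n)) :
    covDeriv g γ (fun s ↦ frameVec γ T s v) t = frameVec γ (fun i ↦ covDeriv g γ (T i)) t v := by
  have hs := mem_extChartAt_source (I := 𝓡 n) (γ t)
  apply chartCoord_injective_self
  rw [chartCoord_frameVec, chartCoord_covDeriv g hγ (contMDiff_frameVec hγ hT v t) hs]
  simp only [chartCoord_frameVec, fun i ↦ chartCoord_covDeriv g hγ (hT i t) hs, smul_add,
    Finset.sum_add_distrib, map_sum, map_smul]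
  congr 1
  have hd := fun i ↦ ((contMDiffAt_field_iff hγ hs).1 (hT i t)).differentiableAt (by simp)
  exact (HasDerivAt.fun_sum fun i _ ↦ (hd i).hasDerivAt.const_smul (v i)).deriv

/-! ### Reparametrization -/

theorem velocity_comp (hγ : ContMDiff 𝓘(ℝ, ℝ) (𝓡 n) ∞ γ) {ρ : ℝ → ℝ} {a : ℝ}
    (hρ : HasDerivAt ρ a t) :
    velocity (n := n) (fun s ↦ γ (ρ s)) t = a • velocity (n := n) γ (ρ t) := by
  have h := mfderiv_comp t (hγ.contMDiffAt.mdifferentiableAt (x := ρ t) (by simp))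
    hρ.differentiableAt.mdifferentiableAt
  have h2 : mfderiv 𝓘(ℝ, ℝ) 𝓘(ℝ, ℝ) ρ t (1 : ℝ) = a • (1 : ℝ) := by
    rw [mfderiv_eq_fderiv]
    exact (fderiv_apply_one_eq_deriv.trans hρ.deriv).trans (mul_one a).symm
  have h3 := congrArg (fun L ↦ L (1 : ℝ)) h
  refine h3.trans ?_
  exact (congrArg (mfderiv 𝓘(ℝ, ℝ) (𝓡 n) γ (ρ t)) h2).trans (map_smul _ _ _)

theorem covDeriv_comp (hγ : ContMDiff 𝓘(ℝ, ℝ) (𝓡 n) ∞ γ)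
    (hV : ContMDiff 𝓘(ℝ, ℝ) (𝓡 n).tangent ∞ (fun t ↦ (⟨γ t, V t⟩ : TangentBundle (𝓡 n) M)))
    {ρ : ℝ → ℝ} {a : ℝ} (hρ : ContDiff ℝ ∞ ρ) (hρ' : HasDerivAt ρ a t) :
    covDeriv g (fun s ↦ γ (ρ s)) (fun s ↦ V (ρ s)) t = a • covDeriv g γ V (ρ t) := by
  have hs := mem_extChartAt_source (I := 𝓡 n) (γ (ρ t))
  have hγ' : ContMDiff 𝓘(ℝ, ℝ) (𝓡 n) ∞ (fun s ↦ γ (ρ s)) := hγ.comp hρ.contMDiff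
  have hV' : ContMDiff 𝓘(ℝ, ℝ) (𝓡 n).tangent ∞
      (fun s ↦ (⟨γ (ρ s), V (ρ s)⟩ : TangentBundle (𝓡 n) M)) := hV.comp hρ.contMDiff
  have hd := ((contMDiffAt_field_iff hγ hs).1 (hV (ρ t))).differentiableAt (by simp)
  apply chartCoord_injective_self
  rw [chartCoord_smul, chartCoord_covDeriv g hγ (hV (ρ t)) hs, chartCoord_covDeriv g hγ' (hV' t) hs,
    velocity_comp hγ hρ', chartCoord_smul, map_smul, smul_apply, smul_add]
  congr 1
  exact (hd.hasDerivAt.scomp t hρ').deriv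

end Curves

/-! ### The coefficients of the index form in the frame -/

section FrameCoefficients

variable {n : ℕ} {M : Type*} [TopologicalSpace M] [ChartedSpace (EuclideanSpace ℝ (Fin n)) M]
  [IsManifold (𝓡 n) ∞ M] (g : Metric n M)

theorem localCurvature_linear_middle (Γ : EuclideanSpace ℝ (Fin n) → EuclideanSpace ℝ (Fin n) →L[ℝ]
    EuclideanSpace ℝ (Fin n) →L[ℝ] EuclideanSpace ℝ (Fin n))
    (y u w : EuclideanSpace ℝ (Fin n)) : IsLinearMap ℝ fun v ↦ localCurvature Γ y u v w :=
  ⟨fun a b ↦ by simp only [localCurvature, map_add, add_apply]; abel,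
    fun c a ↦ by simp only [localCurvature, map_smul, smul_apply, smul_add, smul_sub]⟩

theorem curvature_smul_smul {p : M} (a : ℝ) (u v w : TangentSpace (𝓡 n) p) :
    curvature g p (a • u) v (a • w) = a ^ 2 • curvature g p u v w := by
  have hs := mem_extChartAt_source (I := 𝓡 n) p
  apply chartCoord_injective_self
  rw [chartCoord_smul, chartCoord_curvature g hs, chartCoord_curvature g hs, chartCoord_smul,
    chartCoord_smul]
  simp only [localCurvature, map_smul, smul_apply, smul_add, smul_sub, smul_smul, sq]

variable (γ : ℝ → M) (T : Fin n → ∀ t, TangentSpace (𝓡 n) (γ t)) (ϵ : Fin n → ℝ)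

theorem curvature_frameVec (t : ℝ) (u w : TangentSpace (𝓡 n) (γ t))
    (v : EuclideanSpace ℝ (Fin n)) :
    curvature g (γ t) u (frameVec γ T t v) w
      = ∑ i, v i • curvature g (γ t) u (T i t) w := by
  have hs := mem_extChartAt_source (I := 𝓡 n) (γ t)
  apply chartCoord_injective_self
  have e : chartCoord (γ t) (γ t) (∑ i, v i • curvature g (γ t) u (T i t) w)
      = ∑ i, v i • chartCoord (γ t) (γ t) (curvature g (γ t) u (T i t) w) := by
    refine (map_sum (mfderiv (𝓡 n) (𝓡 n) (extChartAt (𝓡 n) (γ t)) (γ t)) _ _).trans ?_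
    exact Finset.sum_congr rfl fun i _ ↦ chartCoord_smul _ _ _ _
  rw [e, chartCoord_curvature g hs, chartCoord_frameVec]
  simp only [chartCoord_curvature g hs]
  have hl := localCurvature_linear_middle (localChristoffel g (γ t))
    (extChartAt (𝓡 n) (γ t) (γ t)) (chartCoord (γ t) (γ t) u) (chartCoord (γ t) (γ t) w)
  have h := map_sum (hl.mk' _) (fun i ↦ v i • chartCoord (γ t) (γ t) (T i t)) Finset.univ
  simp only [map_smul, IsLinearMap.mk'_apply] at h
  exact h

theorem frameCoord_smul (t a : ℝ) (w : TangentSpace (𝓡 n) (γ t)) :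
    frameCoord g γ T ϵ t (a • w) = a • frameCoord g γ T ϵ t w := by
  ext i
  simp only [frameCoord, map_smul, smul_apply, PiLp.smul_apply, smul_eq_mul]
  ring

theorem frameCoord_sum (t : ℝ) (v : EuclideanSpace ℝ (Fin n))
    (S : Fin n → TangentSpace (𝓡 n) (γ t)) :
    frameCoord g γ T ϵ t (∑ j, v j • S j) = ∑ j, v j • frameCoord g γ T ϵ t (S j) := by
  ext i
  simp only [frameCoord, map_sum, map_smul, sum_apply, smul_apply, smul_eq_mul, WithLp.ofLp_sum,
    Finset.sum_apply, PiLp.smul_apply, Finset.mul_sum]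
  exact Finset.sum_congr rfl fun j _ ↦ by ring

/-- The endomorphism of `ℝⁿ` whose columns are the frame components of the fields `S j`. -/
def frameEndo (S : Fin n → ∀ t, TangentSpace (𝓡 n) (γ t)) (t : ℝ) :
    EuclideanSpace ℝ (Fin n) →L[ℝ] EuclideanSpace ℝ (Fin n) :=
  ∑ j, (EuclideanSpace.proj j : EuclideanSpace ℝ (Fin n) →L[ℝ] ℝ).smulRight
    (frameCoord g γ T ϵ t (S j t))

theorem frameEndo_apply (S : Fin n → ∀ t, TangentSpace (𝓡 n) (γ t)) (t : ℝ)
    (v : EuclideanSpace ℝ (Fin n)) :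
    frameEndo g γ T ϵ S t v = frameCoord g γ T ϵ t (∑ j, v j • S j t) := by
  rw [frameCoord_sum]
  simp [frameEndo]

variable {γ T ϵ}

theorem continuous_frameEndo {S : Fin n → ∀ t, TangentSpace (𝓡 n) (γ t)}
    (hT : ∀ i, ContMDiff 𝓘(ℝ, ℝ) (𝓡 n).tangent ∞
      (fun t ↦ (⟨γ t, T i t⟩ : TangentBundle (𝓡 n) M)))
    (hS : ∀ i, ContMDiff 𝓘(ℝ, ℝ) (𝓡 n).tangent ∞
      (fun t ↦ (⟨γ t, S i t⟩ : TangentBundle (𝓡 n) M))) :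
    Continuous (frameEndo g γ T ϵ S) := by
  have hF : ∀ j, Continuous fun t ↦ frameCoord g γ T ϵ t (S j t) := by
    intro j
    refine (PiLp.continuous_toLp 2 _).comp (continuous_pi fun i ↦ continuous_const.mul ?_)
    exact continuous_iff_continuousAt.2 fun t ↦
      (contDiffAt_form_apply g (hS j t) (hT i t)).continuousAt
  refine continuous_finsetSum _ fun j _ ↦ ?_
  exact (ContinuousLinearMap.smulRightL ℝ (EuclideanSpace ℝ (Fin n)) (EuclideanSpace ℝ (Fin n))
    (EuclideanSpace.proj j)).continuous.comp (hF j)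

theorem frameForm_frameCoord (hϵ : ∀ i, ϵ i = 1 ∨ ϵ i = -1) (t : ℝ) (w : TangentSpace (𝓡 n) (γ t))
    (v : EuclideanSpace ℝ (Fin n)) :
    frameForm ϵ (frameCoord g γ T ϵ t w) v = g.form (γ t) w (frameVec γ T t v) := by
  simp only [frameForm, frameCoord, frameVec, map_sum, map_smul, smul_eq_mul]
  refine Finset.sum_congr rfl fun i _ ↦ ?_
  rcases hϵ i with h | h <;> rw [h] <;> ring

theorem frameForm_frameCurvature_symm (hϵ : ∀ i, ϵ i = 1 ∨ ϵ i = -1) (t : ℝ)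
    (v w : EuclideanSpace ℝ (Fin n)) :
    frameForm ϵ (frameCurvature g γ T ϵ t v) w = frameForm ϵ (frameCurvature g γ T ϵ t w) v := by
  rw [frameCurvature, frameCurvature, frameForm_frameCoord g hϵ, frameForm_frameCoord g hϵ,
    form_curvature_symm]

theorem frameEndo_covDeriv (hγ : ContMDiff 𝓘(ℝ, ℝ) (𝓡 n) ∞ γ)
    (hT : ∀ i, ContMDiff 𝓘(ℝ, ℝ) (𝓡 n).tangent ∞
      (fun t ↦ (⟨γ t, T i t⟩ : TangentBundle (𝓡 n) M))) (t : ℝ) (v : EuclideanSpace ℝ (Fin n)) :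
    frameEndo g γ T ϵ (fun i ↦ covDeriv g γ (T i)) t v = frameChristoffel g γ T ϵ t v := by
  rw [frameEndo_apply, frameChristoffel, covDeriv_frameVec g hγ hT, frameVec]

theorem frameEndo_curvature (t : ℝ) (v : EuclideanSpace ℝ (Fin n)) :
    frameEndo g γ T ϵ (fun i t ↦ curvature g (γ t) (velocity γ t) (T i t) (velocity γ t)) t v
      = frameCurvature g γ T ϵ t v := by
  rw [frameEndo_apply, frameCurvature, curvature_frameVec]

theorem frameChristoffel_comp (hγ : ContMDiff 𝓘(ℝ, ℝ) (𝓡 n) ∞ γ)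
    (hT : ∀ i, ContMDiff 𝓘(ℝ, ℝ) (𝓡 n).tangent ∞
      (fun t ↦ (⟨γ t, T i t⟩ : TangentBundle (𝓡 n) M)))
    {ρ : ℝ → ℝ} {a t : ℝ} (hρ : ContDiff ℝ ∞ ρ) (hρ' : HasDerivAt ρ a t)
    (v : EuclideanSpace ℝ (Fin n)) :
    frameChristoffel g (fun s ↦ γ (ρ s)) (fun i s ↦ T i (ρ s)) ϵ t v
      = a • frameChristoffel g γ T ϵ (ρ t) v := by
  have h := covDeriv_comp g hγ (contMDiff_frameVec hγ hT v) hρ hρ'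
  have h2 := congrArg (frameCoord g γ T ϵ (ρ t)) h
  rw [frameCoord_smul] at h2
  exact h2

theorem frameCurvature_comp (hγ : ContMDiff 𝓘(ℝ, ℝ) (𝓡 n) ∞ γ)
    {ρ : ℝ → ℝ} {a t : ℝ} (hρ' : HasDerivAt ρ a t) (v : EuclideanSpace ℝ (Fin n)) :
    frameCurvature g (fun s ↦ γ (ρ s)) (fun i s ↦ T i (ρ s)) ϵ t v
      = a ^ 2 • frameCurvature g γ T ϵ (ρ t) v := by
  have h : curvature g (γ (ρ t)) (velocity (n := n) (fun s ↦ γ (ρ s)) t) (frameVec γ T (ρ t) v)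
      (velocity (n := n) (fun s ↦ γ (ρ s)) t) = a ^ 2 • curvature g (γ (ρ t)) (velocity γ (ρ t))
        (frameVec γ T (ρ t) v) (velocity γ (ρ t)) := by
    rw [velocity_comp hγ hρ', curvature_smul_smul]
  have h2 := congrArg (frameCoord g γ T ϵ (ρ t)) h
  rw [frameCoord_smul] at h2
  exact h2

/-- Fields along equal but not identical curves have different types, so they are compared in the
total space of the tangent bundle. -/
theorem frameChristoffel_congr {γ₁ γ₂ : ℝ → M} {T₁ : Fin n → ∀ t, TangentSpace (𝓡 n) (γ₁ t)}
    {T₂ : Fin n → ∀ t, TangentSpace (𝓡 n) (γ₂ t)} (h : γ₁ = γ₂)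
    (hT : ∀ i t, (⟨γ₁ t, T₁ i t⟩ : TangentBundle (𝓡 n) M) = ⟨γ₂ t, T₂ i t⟩) (t : ℝ)
    (v : EuclideanSpace ℝ (Fin n)) :
    frameChristoffel g γ₁ T₁ ϵ t v = frameChristoffel g γ₂ T₂ ϵ t v
      ∧ frameCurvature g γ₁ T₁ ϵ t v = frameCurvature g γ₂ T₂ ϵ t v := by
  subst h
  have : T₁ = T₂ := by
    funext i t
    exact (Bundle.TotalSpace.mk_inj).1 (hT i t)
  subst this
  exact ⟨rfl, rfl⟩

end FrameCoefficients

/-! ### The spectral flow of the iterates -/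

section Iterates

variable {n : ℕ} {M : Type*} [TopologicalSpace M] [ChartedSpace (EuclideanSpace ℝ (Fin n)) M]
  [IsManifold (𝓡 n) ∞ M]

/-- Running at speed `N` multiplies `Γ` by `N` and the curvature term, quadratic in the velocity, by
`N ^ 2`. These factors are absorbed by replacing `t` with `N * t`, so all iterates sample one family
of forms. -/
theorem indexForm_iterate (g : Metric n M) {γ : ℝ → M} (hγ : ContMDiff 𝓘(ℝ, ℝ) (𝓡 n) ∞ γ)
    {T : Fin n → ∀ t, TangentSpace (𝓡 n) (γ t)}
    (hT : ∀ i, ContMDiff 𝓘(ℝ, ℝ) (𝓡 n).tangent ∞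
      (fun t ↦ (⟨γ t, T i t⟩ : TangentBundle (𝓡 n) M))) {ϵ : Fin n → ℝ}
    {Γ R : ℝ → EuclideanSpace ℝ (Fin n) →L[ℝ] EuclideanSpace ℝ (Fin n)}
    (hΓ : ∀ t v, Γ t v = frameChristoffel g γ T ϵ t v)
    (hR : ∀ t v, R t v = frameCurvature g γ T ϵ t v) (N : ℕ) (t : ℝ) (V W : H1per n) :
    indexForm g (iterateCurve γ N) (iterateFrame γ T N) ϵ t V W
      = coeffForm Γ R ϵ (N * t) (inclPer V) (inclPer W) := by
  have hρ : ∀ s, HasDerivAt (fun s : ℝ ↦ (N : ℝ) * s) N s := fun s ↦ by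
    simpa using (hasDerivAt_id s).const_mul (N : ℝ)
  have hρs : ContDiff ℝ ∞ fun s : ℝ ↦ (N : ℝ) * s := contDiff_const.mul contDiff_id
  have hC : ∀ s v, frameChristoffel g (iterateCurve γ N) (iterateFrame γ T N) ϵ s v
      = (N : ℝ) • Γ (N * s) v := by
    intro s v
    rw [hΓ]
    exact frameChristoffel_comp g hγ hT hρs (hρ s) v
  have hK : ∀ s v, frameCurvature g (iterateCurve γ N) (iterateFrame γ T N) ϵ s v
      = (N : ℝ) ^ 2 • R (N * s) v := by
    intro s v
    rw [hR]
    exact frameCurvature_comp g hγ (hρ s) v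
  unfold indexForm coeffForm
  refine intervalIntegral.integral_congr fun r _ ↦ ?_
  simp only [indexDensity, hC, hK, frameForm_smul_left, frameForm_smul_right, mul_assoc]
  change frameForm ϵ (V.1.der r) (W.1.der r) + _ + _ + _ + _ =
    frameForm ϵ (V.1.der r) (W.1.der r) + _ + _ + _ + _
  change _ = _ + _ * (_ * frameForm ϵ _ (W.1.der r)) + _ * (_ * frameForm ϵ (V.1.der r) _) + _ + _
  have e1 : (inclPer V).val r = V.1.val r := rfl
  have e2 : (inclPer W).val r = W.1.val r := rfl
  rw [e1, e2]
  ring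

/-- Translation by `1` is a reparametrization of unit speed that fixes both the curve and the frame.
-/
theorem periodic_frame_coefficients (g : Metric n M) {γ : ℝ → M}
    (hγ : ContMDiff 𝓘(ℝ, ℝ) (𝓡 n) ∞ γ) (hγp : Function.Periodic γ 1)
    {T : Fin n → ∀ t, TangentSpace (𝓡 n) (γ t)} {ϵ : Fin n → ℝ} (hT : IsPeriodicFrame g γ T ϵ)
    (t : ℝ) (v : EuclideanSpace ℝ (Fin n)) :
    frameChristoffel g γ T ϵ (t + 1) v = frameChristoffel g γ T ϵ t v
      ∧ frameCurvature g γ T ϵ (t + 1) v = frameCurvature g γ T ϵ t v := by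
  have hρ : HasDerivAt (fun s : ℝ ↦ s + 1) 1 t := (hasDerivAt_id t).add_const 1
  have hρs : ContDiff ℝ ∞ fun s : ℝ ↦ s + 1 := contDiff_id.add contDiff_const
  have h1 := frameChristoffel_comp (ϵ := ϵ) g hγ hT.contMDiff hρs hρ v
  have h2 := frameCurvature_comp (T := T) (ϵ := ϵ) g hγ hρ v
  have h3 := frameChristoffel_congr (ϵ := ϵ) g (T₁ := fun i s ↦ T i (s + 1)) (T₂ := T)
    (funext hγp) (fun i s ↦ hT.periodic i s) t v
  rw [one_smul] at h1
  rw [one_pow, one_smul] at h2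
  exact ⟨h1.symm.trans h3.1, h2.symm.trans h3.2⟩

/-- The index forms of all iterates come from the same continuous periodic coefficients. -/
theorem exists_coefficients (g : Metric n M) {γ : ℝ → M} (hγ : IsClosedGeodesic g γ)
    {T : Fin n → ∀ t, TangentSpace (𝓡 n) (γ t)} {ϵ : Fin n → ℝ} (hT : IsPeriodicFrame g γ T ϵ) :
    ∃ Γ R : ℝ → EuclideanSpace ℝ (Fin n) →L[ℝ] EuclideanSpace ℝ (Fin n),
      Continuous Γ ∧ Continuous R ∧ Function.Periodic Γ 1 ∧ Function.Periodic R 1 ∧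
      (∀ t v w, frameForm ϵ (R t v) w = frameForm ϵ (R t w) v) ∧
      ∀ (N : ℕ) k, IsGeodesicSpectralFlow g (iterateCurve γ N) (iterateFrame γ T N) ϵ k
        ↔ IsCoeffSpectralFlow Γ R ϵ N k := by
  have hΓ := fun t v ↦ frameEndo_covDeriv g (ϵ := ϵ) hγ.contMDiff hT.contMDiff t v
  have hR := fun t v ↦ frameEndo_curvature g (T := T) (ϵ := ϵ) t v
  have hp := periodic_frame_coefficients g hγ.contMDiff hγ.periodic hT
  have hvel := contMDiff_velocity hγ.contMDiff
  refine ⟨_, _, continuous_frameEndo (ϵ := ϵ) g hT.contMDiff fun i ↦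
      contMDiff_covDeriv g hγ.contMDiff (hT.contMDiff i),
    continuous_frameEndo (ϵ := ϵ) g hT.contMDiff fun i ↦
      contMDiff_curvature g hγ.contMDiff hvel (hT.contMDiff i) hvel, ?_, ?_, ?_, ?_⟩
  · intro t
    ext1 v
    rw [hΓ, hΓ, (hp t v).1]
  · intro t
    ext1 v
    rw [hR, hR, (hp t v).2]
  · intro t v w
    rw [hR, hR, frameForm_frameCurvature_symm g hT.sign]
  · intro N k
    have : indexForm g (iterateCurve γ N) (iterateFrame γ T N) ϵ = _ :=
      funext fun t ↦ funext fun V ↦ funext fun W ↦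
        indexForm_iterate g hγ.contMDiff hT.contMDiff hΓ hR N t V W
    rw [IsGeodesicSpectralFlow, this]
    exact Iff.rfl

theorem existsUnique_isGeodesicSpectralFlow (g : Metric n M) {γ : ℝ → M}
    (hγ : IsClosedGeodesic g γ) {T : Fin n → ∀ t, TangentSpace (𝓡 n) (γ t)} {ϵ : Fin n → ℝ}
    (hT : IsPeriodicFrame g γ T ϵ) (N : ℕ) :
    ∃! k, IsGeodesicSpectralFlow g (iterateCurve γ N) (iterateFrame γ T N) ϵ k := by
  obtain ⟨Γ, R, hΓ, hR, -, -, hs, h⟩ := exists_coefficients g hγ hT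
  obtain ⟨k, hk⟩ := exists_isCoeffSpectralFlow hΓ hR hT.sign hs N
  exact ⟨k, (h N k).2 hk, fun k' hk' ↦
    IsCoeffSpectralFlow.unique hΓ hR hT.sign ((h N k').1 hk') hk⟩

theorem isGeodesicSpectralFlow_geodesicSpectralFlow (g : Metric n M) {γ : ℝ → M}
    {T : Fin n → ∀ t, TangentSpace (𝓡 n) (γ t)} {ϵ : Fin n → ℝ}
    (h : ∃ k, IsGeodesicSpectralFlow g γ T ϵ k) :
    IsGeodesicSpectralFlow g γ T ϵ (geodesicSpectralFlow g γ T ϵ) := by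
  rw [geodesicSpectralFlow, dif_pos h]
  exact h.choose_spec

/-- The spectral flow of the iterates is additive up to a bounded error. -/
theorem abs_geodesicSpectralFlow_sub_le (g : Metric n M) {γ : ℝ → M}
    (hγ : IsClosedGeodesic g γ) {T : Fin n → ∀ t, TangentSpace (𝓡 n) (γ t)} {ϵ : Fin n → ℝ}
    (hT : IsPeriodicFrame g γ T ϵ) {N P : ℕ} (hN : 1 ≤ N) (hP : 1 ≤ P) :
    |geodesicSpectralFlow g (iterateCurve γ (N + P)) (iterateFrame γ T (N + P)) ϵ
      - (geodesicSpectralFlow g (iterateCurve γ N) (iterateFrame γ T N) ϵ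
        + geodesicSpectralFlow g (iterateCurve γ P) (iterateFrame γ T P) ϵ)| ≤ 5 * n := by
  obtain ⟨Γ, R, hΓ, hR, hΓp, hRp, -, h⟩ := exists_coefficients g hγ hT
  have hk := fun N ↦ (h N _).1 (isGeodesicSpectralFlow_geodesicSpectralFlow g
    (existsUnique_isGeodesicSpectralFlow g hγ hT N).exists)
  exact abs_spectralFlow_sub_le hΓ hR hΓp hRp hT.sign hN hP (hk (N + P)) (hk N) (hk P)

end Iterates

end SemiRiem

end
theorem corollary6p10 {n : ℕ} {M : Type*} [TopologicalSpace M]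
    [ChartedSpace (EuclideanSpace ℝ (Fin n)) M] [IsManifold (𝓡 n) ∞ M]
    (g : SemiRiem.Metric n M) (γ : ℝ → M) (hγ : SemiRiem.IsClosedGeodesic g γ)
    (T : Fin n → ∀ t, TangentSpace (𝓡 n) (γ t)) (ϵ : Fin n → ℝ)
    (hT : SemiRiem.IsPeriodicFrame g γ T ϵ)
    (sf : ℕ → ℤ)
    (hsf : ∀ N, sf N = SemiRiem.geodesicSpectralFlow g (SemiRiem.iterateCurve γ N)
      (SemiRiem.iterateFrame γ T N) ϵ) :
    (∀ N, 1 ≤ N → ∃! k, SemiRiem.IsGeodesicSpectralFlow g (SemiRiem.iterateCurve γ N)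
      (SemiRiem.iterateFrame γ T N) ϵ k) ∧
    ∃ L : ℝ, Tendsto (fun N : ℕ ↦ (sf N : ℝ) / N) atTop (𝓝 L) ∧
      ((∃ C : ℤ, ∀ N, 1 ≤ N → |sf N| ≤ C) ↔ L = 0) ∧
      ((∃ C : ℤ, ∀ N, 1 ≤ N → |sf N| ≤ C) ∨
        (L ≠ 0 ∧ ∃ α : ℝ, ∀ N P : ℕ, 1 ≤ N →
          L * P - α ≤ (sf (N + P) : ℝ) - sf N ∧ (sf (N + P) : ℝ) - sf N ≤ L * P + α)) := by
  refine ⟨fun N _ ↦ SemiRiem.existsUnique_isGeodesicSpectralFlow g hγ hT N,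
    SemiRiem.bounded_or_linear_growth (K := 5 * n) fun N P hN hP ↦ ?_⟩
  rw [hsf, hsf, hsf]
  exact_mod_cast SemiRiem.abs_geodesicSpectralFlow_sub_le g hγ hT hN hP
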